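/- **Setting.** Let $M$ be a compact orientable 3-manifold whose boundary consists of finitely many tori, and let $\mathcal T$ be an oriented ideal triangulation of $M$ with tetrahedra $\sigma_1,\dots,\sigma_n$ (finitely many tetrahedra glued in pairs along their faces by orientation-reversing maps, so that truncating the vertices gives $M$). Each tetrahedron has three quad types; a quad type is a partition of its four vertices into two pairs, and the two edges spanned by these pairs are said to *face* the quad type. The orientation gives a cyclic order of the quad types of each tetrahedron; list them accordingly and write $(a_j,b_j,c_j)$ for the coordinates of $S\in\mathbb Z^{3n}$ in $\sigma_j$. To $S$ are assigned the shears $c_j-b_j$, $a_j-c_j$, $b_j-a_j$ along the edges of $\sigma_j$ that face the first, second and third quad type. Let $Q(\mathcal T;\mathbb Z)\subset\mathbb Z^{3n}$ be the subgroup of those $S$ ("$Q$-normal classes") for which the shears add up to $0$ over each edge class of $\mathcal T$. It contains: * for each edge class $i$ the edge solution $E_i$, whose coordinate at a quad type is the number of edges in the class $i$ facing it; * for each $j$ the tetrahedral solution $T_j$, with coordinates $(1,1,1)$ in $\sigma_j$ and $0$ elsewhere; put $\mathbb T=\sum_j\mathbb Z T_j$; * for each oriented simple closed essential curve $\gamma$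 on $\partial M$, normal with respect to the induced triangulation of $\partial M$, the peripheral curve solution $P(\gamma)$: each normal arc of $\gamma$ winds around an edge of a tetrahedron and contributes $\pm1$ to the quad type which this edge faces, with sign $+$ if it winds anticlockwise, viewed from the cusp, and $-$ otherwise. These solutions span $Q(\mathcal T;\mathbb Z)\otimes\mathbb R$, and the formal Euler characteristic $\chi$ is the linear function on $Q(\mathcal T;\mathbb Z)$ with $\chi(E_i)=-2$, $\chi(T_j)=-1$ and $\chi(P(\gamma))=0$ for all $i$, $j$, $\gamma$. Replace each quad by the twisted octagon in the truncated tetrahedron, with four boundary arcs in $\partial M$, each of them directed from an edge of shear $+1$ to an edge of shear $-1$ of this quad. The octagons of $S\in Q(\mathcal T;\mathbb Z)$ represent a class $[S]_2\in H_2(M,\partial M;\mathbb Z/2)$, and their boundary arcs a class $[\partial S]\in H_1(\partial M;\mathbb Z)$. Both vanish on $\mathbb T$; let $$h:Q(\mathcal T;\mathbb Z)/\mathbb T\to H_2(M,\partial M;\mathbb Z/2)\times H_1(\partial M;\mathbb Z),\qquad h([S])=([S]_2,[\partial S]).$$ **The index.** In $\mathbb Z((q^{1/2}))$ put $$I_\Delta(m,e)=\sum_{n\ge\max(0,-e)}(-1)^n\frac{q^{\frac12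 n(n+1)-(n+\frac12e)m}}{(q)_n\,(q)_{n+e}},\qquad (q)_n=\prod_{i=1}^n(1-q^i),$$ $$J_\Delta(a,b,c)=(-q^{1/2})^{-b}I_\Delta(b-c,a-b),\qquad I(S)=(-q^{1/2})^{-\chi(S)}\prod_{j}J_\Delta(a_j,b_j,c_j).$$ $I(S)$ depends only on the class $[S]$ of $S$ modulo $\mathbb T$. For $a\in H_2(M,\partial M;\mathbb Z/2)$ and $b\in H_1(\partial M;\mathbb Z)$ let $$I^a_{\mathcal T}(b)=\sum_{[S]\in h^{-1}(a,b)}I([S])\in\mathbb Z((q^{1/2})).$$ It is *defined* if the sum converges formally, i.e. for every $D$ only finitely many summands have a nonzero term of degree at most $D$. **The 0-2 move.** Let $F_1,F_2$ be two distinct faces of $\mathcal T$ that have an edge $uv$ in common (at chosen places in the cycle of faces around this edge), with third vertices $w_1$, $w_2$. Open $M$ along $F_1\cup F_2$ and fill the resulting cavity with two new tetrahedra, each with vertices $u,v,w_1,w_2$, which are glued to each other along their two faces that contain the edge $w_1w_2$ (so this new edge has degree $2$, and the edge $uv$ is split into two edges). The resulting ideal triangulation $\tilde{\mathcal T}$ of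 $M$ is said to be obtained from $\mathcal T$ by a 0-2 move. **Theorem.** Let $\mathcal T$ be an ideal triangulation of $M$ and let $\tilde{\mathcal T}$ be obtained from $\mathcal T$ by a 0-2 move. Then for all $a\in H_2(M,\partial M;\mathbb Z/2)$ and $b\in H_1(\partial M;\mathbb Z)$, $$I^a_{\mathcal T}(b)=I^a_{\tilde{\mathcal T}}(b)\qquad\text{whenever both sides are defined.}$$ -/

import Mathlib

/-! # Ideal triangulations, Q-normal classes, the 3D-index and the 0-2 move -/

namespace Index3D

/-! ## Formal Laurent series in `t = q^{1/2}` and the tetrahedral index -/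

/-- A family of formal Laurent series is summable (its sum converges as a formal Laurent series)
if for every `D` only finitely many members have a term of degree at most `D`. -/
def LaurentSummable {α : Type*} (f : α → LaurentSeries ℤ) : Prop :=
  ∀ D : ℤ, {i | ∃ k ≤ D, (f i).coeff k ≠ 0}.Finite

theorem LaurentSummable.bddBelow {α : Type*} {f : α → LaurentSeries ℤ} (h : LaurentSummable f) :
    BddBelow (Function.support fun k : ℤ => ∑ᶠ i, (f i).coeff k) := by
  have key : BddBelow (⋃ i ∈ {i | ∃ k ≤ (0 : ℤ), (f i).coeff k ≠ 0}, (f i).coeff.support) := by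
    refine ((h 0).bddBelow_biUnion).2 fun i _ => ⟨(f i).order, fun k hk => ?_⟩
    exact HahnSeries.order_le_of_coeff_ne_zero hk
  obtain ⟨N, hN⟩ := key
  refine ⟨min N 0, fun k hk => ?_⟩
  rcases lt_or_ge 0 k with h0 | h0
  · exact (min_le_right _ _).trans h0.le
  · obtain ⟨i, hi⟩ : ∃ i, (f i).coeff k ≠ 0 := by
      by_contra! hc
      exact hk (by simp [hc])
    exact (min_le_left _ _).trans (hN (Set.mem_biUnion (show i ∈ _ from ⟨k, h0, hi⟩) hi))

open Classical in
/-- The sum of a summable family of formal Laurent series: in each degree the (finite) sum of the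
coefficients. It is used for summable families only (and is `0` otherwise). -/
noncomputable def laurentSum {α : Type*} (f : α → LaurentSeries ℤ) : LaurentSeries ℤ :=
  if h : LaurentSummable f then HahnSeries.ofSuppBddBelow (fun k => ∑ᶠ i, (f i).coeff k) h.bddBelow
  else 0

/-- `(-q^{1/2})^k`. -/
noncomputable def negHalfPow (k : ℤ) : LaurentSeries ℤ :=
  HahnSeries.single k (k.negOnePow : ℤ)

theorem negHalfPow_zero : negHalfPow 0 = 1 := by simp [negHalfPow]

theorem negHalfPow_add (k l : ℤ) : negHalfPow (k + l) = negHalfPow k * negHalfPow l := by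
  simp [negHalfPow, HahnSeries.single_mul_single, Int.negOnePow_add]

/-- The `q`-Pochhammer symbol `(q)_n = ∏_{i=1}^n (1 - q^i)` as a power series in `t = q^{1/2}`. -/
noncomputable def qPochhammer (n : ℕ) : PowerSeries ℤ :=
  ∏ i ∈ Finset.Icc 1 n, (1 - PowerSeries.X ^ (2 * i))

/-- `1 / (q)_n`; the constant coefficient of `(q)_n` is `1`. -/
noncomputable def qPochhammerInv (n : ℕ) : PowerSeries ℤ :=
  PowerSeries.invOfUnit (qPochhammer n) 1

/-- The tetrahedral index
`I_Δ(m,e) = ∑_{n ≥ max(0,-e)} (-1)^n q^{n(n+1)/2 - (n+e/2)m} / ((q)_n (q)_{n+e})`. -/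
noncomputable def tetIndex (m e : ℤ) : LaurentSeries ℤ :=
  laurentSum fun n : ℕ =>
    if 0 ≤ (n : ℤ) + e then
      HahnSeries.single ((n : ℤ) * (n + 1) - (2 * n + e) * m) ((-1 : ℤ) ^ n) *
        ((qPochhammerInv n * qPochhammerInv ((n : ℤ) + e).toNat : PowerSeries ℤ) : LaurentSeries ℤ)
    else 0

/-- The symmetric form `J_Δ(a,b,c) = (-q^{1/2})^{-b} I_Δ(b-c,a-b)` of the tetrahedral index. -/
noncomputable def tetIndexJ (a b c : ℤ) : LaurentSeries ℤ :=
  negHalfPow (-b) * tetIndex (b - c) (a - b)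

theorem tetIndexJ_add_one (a b c : ℤ) :
    tetIndexJ (a + 1) (b + 1) (c + 1) = negHalfPow (-1) * tetIndexJ a b c := by
  unfold tetIndexJ
  rw [← mul_assoc, ← negHalfPow_add]
  congr 2 <;> ring

/-! ## Combinatorics of one tetrahedron

The vertices of a tetrahedron are `0,1,2,3 : Fin 4`, the face `f` is the one opposite the vertex
`f`, and the quad types are `k : Fin 3`: the quads `01:23`, `02:13`, `03:12` for `k = 0,1,2`. -/

/-- `mate k v` is the vertex such that the edge from `v` to it faces the quad of type `k`. -/
def mate : Fin 3 → Equiv.Perm (Fin 4)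
  | 0 => Equiv.swap 0 1 * Equiv.swap 2 3
  | 1 => Equiv.swap 0 2 * Equiv.swap 1 3
  | 2 => Equiv.swap 0 3 * Equiv.swap 1 2

/-- The quad type that the edge between two distinct vertices faces. -/
def quadOf (v w : Fin 4) : Fin 3 :=
  if mate 0 v = w then 0 else if mate 1 v = w then 1 else 2

theorem mate_quadOf : ∀ v w : Fin 4, v ≠ w → mate (quadOf v w) v = w := by decide

/-- A corner `(σ, v, k)` is the tetrahedron `σ` with its vertex `v` and the quad type `k`. It stands
for each of the following, which correspond to one another:
* the edge of `σ` that leaves `v` and faces the quad of type `k`;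
* the corner on that edge of the triangle which truncates `σ` at `v`;
* the side opposite that corner in this truncation triangle, i.e. the arc near `v` in the face of
  `σ` opposite `mate k v`, oriented from the corner `(σ, v, k + 1)` to the corner `(σ, v, k + 2)`.

The orientation of `σ` makes `k, k + 1, k + 2` the cyclic order of the corners of each truncation
triangle. -/
abbrev Corner (ι : Type*) := ι × Fin 4 × Fin 3

/-! ## Triangulations -/

/-- An oriented (ideal) triangulation with set of tetrahedra `ι`: the face `f` of the tetrahedron
`σ` is glued to a face of `adj σ f`, and `perm σ f` maps the vertices of this face to those which
they are identified with, and `f` to the vertex opposite the face of `adj σ f`. Vertices are to be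
removed (or truncated). All gluings reverse orientation, no face is glued to itself. -/
structure Triangulation (ι : Type*) where
  adj : ι → Fin 4 → ι
  perm : ι → Fin 4 → Equiv.Perm (Fin 4)
  adj_adj : ∀ σ f, adj (adj σ f) (perm σ f f) = σ
  perm_perm : ∀ σ f, perm (adj σ f) (perm σ f f) = (perm σ f)⁻¹
  not_self : ∀ σ f, ¬ (adj σ f = σ ∧ perm σ f f = f)
  sign_perm : ∀ σ f, Equiv.Perm.sign (perm σ f) = -1

namespace Triangulation

variable {ι : Type*} (T : Triangulation ι)

/-- The corner of the adjacent tetrahedron obtained by following the gluing of the face `f`. For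
`f ≠ v`, `f ≠ mate k v` it is the image of the edge `v, mate k v` (as an edge leaving the image of
`v`), and for `f = mate k v` it is the image of the side `(σ, v, k)` of the truncation triangle. -/
def across (c : Corner ι) (f : Fin 4) : Corner ι :=
  (T.adj c.1 f, T.perm c.1 f c.2.1,
    quadOf (T.perm c.1 f c.2.1) (T.perm c.1 f (mate c.2.2 c.2.1)))

/-- The gluing of the sides of the truncation triangles. -/
def sideGlue (c : Corner ι) : Corner ι := T.across c (mate c.2.2 c.2.1)

/-- The set of oriented edge classes, which is also the set of ends of edges, i.e. of the vertices
of the induced triangulation of `∂M`. Since gluings reverse orientation and no face is glued to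
itself, no edge is identified with its own reverse: each edge class has exactly two orientations. -/
def OrEdge : Type _ :=
  Quot fun c d : Corner ι => ∃ f, f ≠ c.2.1 ∧ f ≠ mate c.2.2 c.2.1 ∧ d = T.across c f

/-- The class of an oriented edge of a tetrahedron. -/
def orEdge (c : Corner ι) : T.OrEdge := Quot.mk _ c

/-- The set of cusps (boundary components of `M`): classes of vertices of tetrahedra. -/
def Cusp : Type _ :=
  Quot fun x y : ι × Fin 4 => ∃ f, f ≠ x.2 ∧ y = (T.adj x.1 f, T.perm x.1 f x.2)

/-- The cusp at a vertex of a tetrahedron. -/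
def cusp (x : ι × Fin 4) : T.Cusp := Quot.mk _ x

/-- All cusps are tori: each component of `∂M` is a connected closed oriented surface which is
triangulated by `F` triangles, has `3F/2` edges, `V` vertices and Euler characteristic
`V - F/2 = 0`. -/
def TorusCusps : Prop :=
  ∀ x : T.Cusp, Nat.card {y : ι × Fin 4 // T.cusp y = x} =
    2 * Nat.card {e : T.OrEdge // ∃ σ v k, T.cusp (σ, v) = x ∧ T.orEdge (σ, v, k) = e}

/-! ### Homology

`M` is the manifold obtained by truncating the ideal vertices. Its cells are the truncated
tetrahedra, their hexagonal faces and long edges, and the cells of `∂M`, namely the truncation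
triangles, their sides and their corners. Chains are taken as chains on the disjoint union of the
tetrahedra; identifications are then imposed together with the boundaries. -/

section Homology

/-- The boundary of a side of a truncation triangle. -/
noncomputable def sideBoundary : (Corner ι →₀ ℤ) →ₗ[ℤ] (T.OrEdge →₀ ℤ) :=
  Finsupp.linearCombination ℤ fun c : Corner ι =>
    Finsupp.single (T.orEdge (c.1, c.2.1, c.2.2 + 2)) (1 : ℤ) -
      Finsupp.single (T.orEdge (c.1, c.2.1, c.2.2 + 1)) 1

/-- Cellular 1-cycles of `∂M`. -/
noncomputable def peripheralCycles : Submodule ℤ (Corner ι →₀ ℤ) := LinearMap.ker T.sideBoundary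

/-- Cellular 1-boundaries of `∂M`: spanned by the boundaries of the truncation triangles; and sides
that are glued together are identified (with opposite orientations). -/
noncomputable def peripheralBoundaries : Submodule ℤ (Corner ι →₀ ℤ) :=
  Submodule.span ℤ
    (Set.range (fun x : ι × Fin 4 => ∑ k : Fin 3, Finsupp.single (x.1, x.2, k) (1 : ℤ)) ∪
      Set.range (fun c : Corner ι => Finsupp.single c (1 : ℤ) + Finsupp.single (T.sideGlue c) 1))

/-- `H_1(∂M; ℤ)`. -/
abbrev PeripheralHomology : Type _ :=
  T.peripheralCycles ⧸ T.peripheralBoundaries.submoduleOf T.peripheralCycles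

/-- The boundary in the relative cellular chain complex of `(M, ∂M)` modulo 2 of a hexagonal face.
The edges of the face are taken with both orientations; as an edge class has two orientations, this
is the boundary mod 2 written out twice. -/
noncomputable def faceBoundary : (ι × Fin 4 →₀ ZMod 2) →ₗ[ZMod 2] (T.OrEdge →₀ ZMod 2) :=
  Finsupp.linearCombination (ZMod 2) fun x : ι × Fin 4 =>
    ∑ v : Fin 4, ∑ k : Fin 3,
      if v ≠ x.2 ∧ mate k v ≠ x.2 then Finsupp.single (T.orEdge (x.1, v, k)) (1 : ZMod 2) else 0

/-- Relative cellular 2-cycles mod 2 of `(M, ∂M)`. -/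
noncomputable def relCycles : AddSubgroup (ι × Fin 4 →₀ ZMod 2) :=
  T.faceBoundary.toAddMonoidHom.ker

/-- Relative cellular 2-boundaries mod 2 of `(M, ∂M)`: spanned by the boundaries of the tetrahedra;
and faces that are glued together are identified. -/
noncomputable def relBoundaries : AddSubgroup (ι × Fin 4 →₀ ZMod 2) :=
  AddSubgroup.closure
    (Set.range (fun σ : ι => ∑ f : Fin 4, Finsupp.single (σ, f) (1 : ZMod 2)) ∪
      Set.range (fun x : ι × Fin 4 => Finsupp.single x (1 : ZMod 2) +
        Finsupp.single (T.adj x.1 x.2, T.perm x.1 x.2 x.2) 1))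

/-- `H_2(M, ∂M; ℤ/2)`. -/
abbrev RelHomology : Type _ :=
  T.relCycles ⧸ T.relBoundaries.addSubgroupOf T.relCycles

end Homology

/-! ### Q-normal classes -/

section QNormal

open Classical in
/-- The edge solution of an edge class (given with an orientation `e`): its coordinate at a quad is
the number of edges facing this quad that belong to the class. -/
noncomputable def edgeSol (e : T.OrEdge) : ι → Fin 3 → ℤ := fun σ k =>
  ∑ v : Fin 4, if T.orEdge (σ, v, k) = e then 1 else 0

variable [Fintype ι]

/-- The group `Q(T;ℤ)` of integer solutions to the Q-matching equations: the shear parameters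
`S σ (k+2) - S σ (k+1)` along the edges facing the quads of type `k` add up to zero over each edge
class. -/
noncomputable def Q : AddSubgroup (ι → Fin 3 → ℤ) where
  carrier := {S | ∀ e, ∑ σ, ∑ k, T.edgeSol e σ k * (S σ (k + 2) - S σ (k + 1)) = 0}
  zero_mem' := by intro e; simp
  add_mem' := by
    intro S S' h h' e
    have := congrArg₂ (· + ·) (h e) (h' e)
    simp only [← Finset.sum_add_distrib, add_zero] at this
    rw [← this]
    refine Finset.sum_congr rfl fun σ _ => Finset.sum_congr rfl fun k _ => ?_
    simp only [Pi.add_apply]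
    ring
  neg_mem' := by
    intro S h e
    have := congrArg Neg.neg (h e)
    simp only [← Finset.sum_neg_distrib, neg_zero] at this
    rw [← this]
    refine Finset.sum_congr rfl fun σ _ => Finset.sum_congr rfl fun k _ => ?_
    simp only [Pi.neg_apply]
    ring

open Classical in
/-- The tetrahedral solution: all three quads of one tetrahedron. -/
noncomputable def tetSol (τ : ι) : T.Q :=
  ⟨fun σ _ => if σ = τ then 1 else 0, by intro e; simp⟩

/-- The subgroup spanned by the tetrahedral solutions. -/
noncomputable def tetSubgroup : AddSubgroup T.Q := AddSubgroup.closure (Set.range T.tetSol)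

/-- The oriented boundary edges of the twisted octagons: the octagon of a quad of type `k` in `σ`
runs, near each of the four vertices of `σ`, from the corner on the edge of shear `+1` (which faces
the quad of type `k + 1`) to the corner on the edge of shear `-1` (facing the quad of type
`k + 2`). -/
noncomputable def octagonBoundary : (ι → Fin 3 → ℤ) →+ (Corner ι →₀ ℤ) where
  toFun S := ∑ σ, ∑ k : Fin 3, ∑ v : Fin 4, Finsupp.single (σ, v, k) (S σ k)
  map_zero' := by simp
  map_add' S S' := by simp [Finset.sum_add_distrib]

/-- The twisted squares mod 2: the one of type `k` in `σ` is homologous, rel the union of the edges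
that meet the quad, to the union of the two faces of `σ` that contain the edge between `0` and
`mate k 0`. -/
noncomputable def twistedSquares : (ι → Fin 3 → ℤ) →+ (ι × Fin 4 →₀ ZMod 2) where
  toFun S := ∑ σ, ∑ k : Fin 3,
    (Finsupp.single (σ, mate (k + 1) 0) ((S σ k : ℤ) : ZMod 2) +
      Finsupp.single (σ, mate (k + 2) 0) ((S σ k : ℤ) : ZMod 2))
  map_zero' := by simp
  map_add' S S' := by
    simp only [Pi.add_apply, Int.cast_add, Finsupp.single_add, ← Finset.sum_add_distrib]
    refine Finset.sum_congr rfl fun σ _ => Finset.sum_congr rfl fun k _ => ?_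
    abel

theorem octagonBoundary_mem (S : T.Q) :
    octagonBoundary (S : ι → Fin 3 → ℤ) ∈ T.peripheralCycles := by
  classical
  rw [peripheralCycles, LinearMap.mem_ker]
  ext e
  have h := S.2 e
  simp only [octagonBoundary, AddMonoidHom.coe_mk, ZeroHom.coe_mk, map_sum, sideBoundary,
    Finsupp.linearCombination_single, Finsupp.coe_finsetSum, Finset.sum_apply, Finsupp.smul_apply,
    Finsupp.sub_apply, Finsupp.single_apply, Finsupp.coe_zero, Pi.zero_apply]
  rw [← neg_eq_zero]
  refine Eq.trans ?_ h
  rw [← Finset.sum_neg_distrib]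
  refine Finset.sum_congr rfl fun σ _ => ?_
  simp only [edgeSol, Fin.sum_univ_three, Fin.sum_univ_four, smul_eq_mul]
  simp only [Fin.isValue, Fin.reduceAdd, zero_add]
  ring

theorem twistedSquares_mem (S : T.Q) :
    twistedSquares (S : ι → Fin 3 → ℤ) ∈ T.relCycles := by
  classical
  rw [relCycles, AddMonoidHom.mem_ker, LinearMap.toAddMonoidHom_coe]
  ext e
  have h := congrArg (fun z : ℤ => (z : ZMod 2)) (S.2 e)
  simp only [Int.cast_sum, Int.cast_mul, Int.cast_sub, Int.cast_zero] at h
  simp only [twistedSquares, AddMonoidHom.coe_mk, ZeroHom.coe_mk, map_sum, map_add, faceBoundary,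
    Finsupp.linearCombination_single, Finsupp.coe_finsetSum, Finset.sum_apply, Finsupp.smul_apply,
    Finsupp.add_apply, Finsupp.coe_zero, Pi.zero_apply]
  refine Eq.trans ?_ h
  refine Finset.sum_congr rfl fun σ _ => ?_
  have two : (2 : ZMod 2) = 0 := by decide
  simp only [edgeSol, Fin.sum_univ_three, Fin.sum_univ_four, smul_eq_mul]
  simp (decide := true) [Finsupp.single_apply]
  generalize (if T.orEdge (σ, 0, 0) = e then (1 : ZMod 2) else 0) = e00
  generalize (if T.orEdge (σ, 0, 1) = e then (1 : ZMod 2) else 0) = e01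
  generalize (if T.orEdge (σ, 0, 2) = e then (1 : ZMod 2) else 0) = e02
  generalize (if T.orEdge (σ, 1, 0) = e then (1 : ZMod 2) else 0) = e10
  generalize (if T.orEdge (σ, 1, 1) = e then (1 : ZMod 2) else 0) = e11
  generalize (if T.orEdge (σ, 1, 2) = e then (1 : ZMod 2) else 0) = e12
  generalize (if T.orEdge (σ, 2, 0) = e then (1 : ZMod 2) else 0) = e20
  generalize (if T.orEdge (σ, 2, 1) = e then (1 : ZMod 2) else 0) = e21
  generalize (if T.orEdge (σ, 2, 2) = e then (1 : ZMod 2) else 0) = e22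
  generalize (if T.orEdge (σ, 3, 0) = e then (1 : ZMod 2) else 0) = e30
  generalize (if T.orEdge (σ, 3, 1) = e then (1 : ZMod 2) else 0) = e31
  generalize (if T.orEdge (σ, 3, 2) = e then (1 : ZMod 2) else 0) = e32
  linear_combination ((S.1 σ 0 : ZMod 2) * (e00 + e10 + e02 + e12 + e22 + e32) +
    (S.1 σ 1 : ZMod 2) * (e01 + e21 + e00 + e10 + e20 + e30) +
    (S.1 σ 2 : ZMod 2) * (e02 + e32 + e01 + e11 + e21 + e31)) * two

/-- The homology class `[∂S] ∈ H_1(∂M;ℤ)` of a Q-normal class. -/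
noncomputable def boundaryClass : T.Q →+ T.PeripheralHomology :=
  (Submodule.mkQ (T.peripheralBoundaries.submoduleOf T.peripheralCycles)).toAddMonoidHom.comp
    ((octagonBoundary.comp T.Q.subtype).codRestrict T.peripheralCycles T.octagonBoundary_mem)

/-- The homology class `[S]_2 ∈ H_2(M,∂M;ℤ/2)` of a Q-normal class. -/
noncomputable def surfaceClass : T.Q →+ T.RelHomology :=
  (QuotientAddGroup.mk' (T.relBoundaries.addSubgroupOf T.relCycles)).comp
    ((twistedSquares.comp T.Q.subtype).codRestrict T.relCycles T.twistedSquares_mem)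

theorem boundaryClass_tetSol (τ : ι) : T.boundaryClass (T.tetSol τ) = 0 := by
  classical
  refine (Submodule.Quotient.mk_eq_zero _).2 ?_
  rw [Submodule.submoduleOf, Submodule.mem_comap]
  change octagonBoundary (T.tetSol τ : ι → Fin 3 → ℤ) ∈ T.peripheralBoundaries
  have : octagonBoundary (T.tetSol τ : ι → Fin 3 → ℤ) =
      ∑ v : Fin 4, ∑ k : Fin 3, Finsupp.single ((τ, v, k) : Corner ι) (1 : ℤ) := by
    simp only [octagonBoundary, tetSol, AddMonoidHom.coe_mk, ZeroHom.coe_mk]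
    rw [Finset.sum_eq_single τ]
    · rw [Finset.sum_comm]
      simp
    · intro σ _ h
      simp [h]
    · simp
  rw [this]
  exact Submodule.sum_mem _ fun v _ => Submodule.subset_span (Or.inl ⟨(τ, v), rfl⟩)

theorem surfaceClass_tetSol (τ : ι) : T.surfaceClass (T.tetSol τ) = 0 := by
  classical
  refine (QuotientAddGroup.eq_zero_iff _).2 ?_
  rw [AddSubgroup.mem_addSubgroupOf]
  change twistedSquares (T.tetSol τ : ι → Fin 3 → ℤ) ∈ T.relBoundaries
  have : twistedSquares (T.tetSol τ : ι → Fin 3 → ℤ) = 0 := by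
    simp only [twistedSquares, tetSol, AddMonoidHom.coe_mk, ZeroHom.coe_mk]
    rw [Finset.sum_eq_single τ]
    · have two : ∀ x : ι × Fin 4 →₀ ZMod 2, x + x = 0 := fun x => by
        ext i
        exact CharTwo.add_self_eq_zero (x i)
      simp only [Fin.sum_univ_three, if_true, Int.cast_one, Fin.isValue, Fin.reduceAdd, zero_add]
      generalize Finsupp.single (τ, mate 0 0) (1 : ZMod 2) = x
      generalize Finsupp.single (τ, mate 1 0) (1 : ZMod 2) = y
      generalize Finsupp.single (τ, mate 2 0) (1 : ZMod 2) = z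
      have : y + z + (z + x) + (x + y) = (x + x) + (y + y) + (z + z) := by abel
      rw [this, two x, two y, two z, add_zero, add_zero]
    · intro σ _ h
      simp [h]
    · simp
  rw [this]
  exact zero_mem _

/-- The homomorphism `h : Q(T;ℤ)/𝕋 → H_2(M,∂M;ℤ/2) × H_1(∂M;ℤ)`, `[S] ↦ ([S]_2, [∂S])`. -/
noncomputable def homologyMap : T.Q ⧸ T.tetSubgroup →+ T.RelHomology × T.PeripheralHomology :=
  QuotientAddGroup.lift T.tetSubgroup (T.surfaceClass.prod T.boundaryClass) <| by
    rw [tetSubgroup, AddSubgroup.closure_le]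
    rintro _ ⟨τ, rfl⟩
    simp [AddMonoidHom.mem_ker, T.surfaceClass_tetSol, T.boundaryClass_tetSol]

end QNormal

/-! ### Peripheral curves and the formal Euler characteristic -/

/-- A simple closed oriented curve on `∂M` in normal position with respect to the induced
triangulation, given as a cyclic sequence of `len + 1` normal arcs. The `i`-th arc winds around
the corner `corner i = (σ, v, k)` of its truncation triangle, in the direction of the orientation if
`left i` (then it runs from the side `k + 2` to the side `k + 1`) and against it otherwise. It ends
where the next arc begins; `pos i` is the position of this point on the side on which the `i`-th
arc ends, measured along this side from `0` to `1`. -/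
structure NormalCurve where
  len : ℕ
  corner : Fin (len + 1) → Corner ι
  left : Fin (len + 1) → Bool
  pos : Fin (len + 1) → ℝ
  pos_mem : ∀ i, pos i ∈ Set.Ioo (0 : ℝ) 1
  /-- The side on which an arc ends is glued to the side on which the next arc begins. -/
  glue : ∀ i,
    T.sideGlue ((corner i).1, (corner i).2.1, (corner i).2.2 + if left i then 1 else 2) =
      ((corner (i + 1)).1, (corner (i + 1)).2.1,
        (corner (i + 1)).2.2 + if left (i + 1) then 2 else 1)
  /-- Two arcs around the same corner of a truncation triangle are disjoint. With `k` the corner,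
  the distance from it of the end point of the arc on the side `k + 2` is `1 - pos (i - 1)` or
  `pos i`, and that of the end point on the side `k + 1` is `1 - pos i` or `pos (i - 1)`. -/
  disjoint_same : ∀ i j, i ≠ j → corner i = corner j →
    ((if left i then 1 - pos (i - 1) else pos i) < (if left j then 1 - pos (j - 1) else pos j) ∧
      (if left i then 1 - pos i else pos (i - 1)) < (if left j then 1 - pos j else pos (j - 1))) ∨
    ((if left j then 1 - pos (j - 1) else pos j) < (if left i then 1 - pos (i - 1) else pos i) ∧
      (if left j then 1 - pos j else pos (j - 1)) < (if left i then 1 - pos i else pos (i - 1)))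
  /-- Two arcs around different corners `k` and `k + 1` of a truncation triangle are disjoint: they
  meet the common side `k + 2` in this order. -/
  disjoint_next : ∀ i j,
    corner j = ((corner i).1, (corner i).2.1, (corner i).2.2 + 1) →
      (if left i then 1 - pos (i - 1) else pos i) +
        (if left j then 1 - pos j else pos (j - 1)) < 1

namespace NormalCurve

variable {T}
variable (γ : T.NormalCurve)

/-- A cellular 1-cycle homologous to the curve, namely the curve pushed to its right: an arc around
`(σ, v, k)` with the corner on its left becomes the side `(σ, v, k)`, the other arcs become
constant. -/
noncomputable def chain : Corner ι →₀ ℤ :=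
  ∑ i, if γ.left i then Finsupp.single (γ.corner i) (1 : ℤ) else 0

/-- The curve is essential (not contractible): a simple closed curve on a torus is contractible if
and only if it is null-homologous. -/
def Essential : Prop := γ.chain ∉ T.peripheralBoundaries

open Classical in
/-- The peripheral curve solution of the curve (a row of the gluing matrix that belongs to a cusp
equation): the signed number of times that the curve winds around the edges facing each quad. -/
noncomputable def sol : ι → Fin 3 → ℤ := fun σ k =>
  ∑ i, if (γ.corner i).1 = σ ∧ (γ.corner i).2.2 = k then (if γ.left i then 1 else -1) else 0

end NormalCurve

section Index

variable [Fintype ι]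

/-- `χ` is the formal Euler characteristic: the linear function on Q-normal classes with
`χ(∑ x_i E_i + ∑ y_j T_j + ∑ (p_k M_k + q_k L_k)) = -2 ∑ x_i - ∑ y_j`, where the `E_i` are the
edge solutions, the `T_j` the tetrahedral solutions, and `M_k`, `L_k` solutions of peripheral
curves. (These classes lie in, and rationally span, the space of Q-normal classes.) -/
structure IsFormalEuler (χ : T.Q →+ ℤ) : Prop where
  edge : ∀ (e : T.OrEdge) (S : T.Q), (S : ι → Fin 3 → ℤ) = T.edgeSol e → χ S = -2
  tet : ∀ σ, χ (T.tetSol σ) = -1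
  peripheral : ∀ γ : T.NormalCurve, γ.Essential →
    ∀ S : T.Q, (S : ι → Fin 3 → ℤ) = γ.sol → χ S = 0

variable {T}

/-- `I(S) = (-q^{1/2})^{-χ(S)} ∏_σ J_Δ(a_σ, b_σ, c_σ)`. -/
noncomputable def weight (χ : T.Q →+ ℤ) (S : T.Q) : LaurentSeries ℤ :=
  negHalfPow (-χ S) * ∏ σ, tetIndexJ (S.1 σ 0) (S.1 σ 1) (S.1 σ 2)

theorem weight_add_tetSol {χ : T.Q →+ ℤ} (hχ : T.IsFormalEuler χ) (S : T.Q) (τ : ι) :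
    weight χ (S + T.tetSol τ) = weight χ S := by
  classical
  have h : ∀ σ, tetIndexJ ((S + T.tetSol τ).1 σ 0) ((S + T.tetSol τ).1 σ 1)
      ((S + T.tetSol τ).1 σ 2) =
      (if σ = τ then negHalfPow (-1) else 1) * tetIndexJ (S.1 σ 0) (S.1 σ 1) (S.1 σ 2) := by
    intro σ
    simp only [tetSol, AddSubgroup.coe_add, Pi.add_apply]
    split_ifs with hσ
    · exact tetIndexJ_add_one _ _ _
    · simp
  unfold weight
  simp only [h, Finset.prod_mul_distrib, Finset.prod_ite_eq', Finset.mem_univ, if_true, map_add,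
    hχ.tet]
  rw [← mul_assoc, ← negHalfPow_add]
  congr 2
  ring

theorem weight_add_of_mem {χ : T.Q →+ ℤ} (hχ : T.IsFormalEuler χ) {R : T.Q}
    (hR : R ∈ T.tetSubgroup) : ∀ S, weight χ (S + R) = weight χ S := by
  induction hR using AddSubgroup.closure_induction with
  | mem x hx =>
    obtain ⟨τ, rfl⟩ := hx
    exact fun S => weight_add_tetSol hχ S τ
  | zero => simp
  | add x y _ _ hx hy => exact fun S => by rw [← add_assoc, hy, hx]
  | neg x _ hx => exact fun S => by rw [← hx (S + -x), neg_add_cancel_right]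

/-- The function induced by `I` on the quotient of `Q(T;ℤ)` by the tetrahedral solutions. -/
noncomputable def weightClass {χ : T.Q →+ ℤ} (hχ : T.IsFormalEuler χ) :
    T.Q ⧸ T.tetSubgroup → LaurentSeries ℤ :=
  Quotient.lift (weight χ) fun S S' h => by
    rw [← weight_add_of_mem hχ (QuotientAddGroup.leftRel_apply.1 h), add_neg_cancel_left]

variable (T)

/-- The index `I_T^a(b) = ∑_{[S] ∈ h⁻¹(a,b)} I([S])` is defined and its value is `I`. (For `(a,b)`
outside the image of `h` this is the empty sum.) -/
def HasIndex (a : T.RelHomology) (b : T.PeripheralHomology) (I : LaurentSeries ℤ) : Prop :=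
  ∃ (χ : T.Q →+ ℤ) (hχ : T.IsFormalEuler χ),
    LaurentSummable (fun x : {x // T.homologyMap x = (a, b)} => weightClass hχ x.1) ∧
    laurentSum (fun x : {x // T.homologyMap x = (a, b)} => weightClass hχ x.1) = I

end Index

/-! ### The 0-2 move -/

/-- The tetrahedron `σ` with vertices labelled `u = p 0`, `v = p 1`, `w = p 2`, `x = p 3` contains
the edge `uv` and the faces `uvw` (opposite `x`) and `uvx` (opposite `w`). Rotating around the edge
`uv` means passing through the face `uvx` to the adjacent tetrahedron, with the labels `u`, `v` of
the edge kept, `w` now the label of the third vertex of the face just crossed, and `x` the label of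
the vertex opposite this face. -/
def rotate (φ : ι × Equiv.Perm (Fin 4)) : ι × Equiv.Perm (Fin 4) :=
  (T.adj φ.1 (φ.2 2), T.perm φ.1 (φ.2 2) * φ.2 * Equiv.swap 2 3)

/-- The face of `T` on the other side of a face of a tetrahedron. -/
def faceGlue (x : ι × Fin 4) : ι × Fin 4 := (T.adj x.1 x.2, T.perm x.1 x.2 x.2)

/-- The place of a 0-2 move: two distinct faces `F₁`, `F₂` of `T` with a common edge. `F₁` is
the face opposite `p 3` of the tetrahedron `σ`, with vertices `u = p 0`, `v = p 1`, `w₁ = p 2`;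
rotating around the edge `uv` from `F₁` on through the `steps + 1` tetrahedra on one side leads to
the face `F₂`. By the choice of the direction of `uv`, `p` can be taken to be odd. -/
structure ZeroTwoSite where
  σ : ι
  p : Equiv.Perm (Fin 4)
  sign_p : Equiv.Perm.sign p = -1
  steps : ℕ
  ne : ((T.rotate^[steps] (σ, p)).1, (T.rotate^[steps] (σ, p)).2 2) ≠ (σ, p 3)
  ne_glue : ((T.rotate^[steps] (σ, p)).1, (T.rotate^[steps] (σ, p)).2 2) ≠
    T.faceGlue (σ, p 3)

section ZeroTwo

variable {T}
variable (s : T.ZeroTwoSite)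

/-- The last of the tetrahedra met by the rotation from `F₁` to `F₂`, with labels: `F₂` is its face
opposite `s.last.2 2`, with vertices `u, v = s.last.2 0, s.last.2 1` and `w₂ = s.last.2 3`. -/
def ZeroTwoSite.last : ι × Equiv.Perm (Fin 4) := T.rotate^[s.steps] (s.σ, s.p)

/-- Opening `M` along `F₁ ∪ F₂` leaves a cavity with two copies each of `F₁` and `F₂` in its
boundary. It is filled by two tetrahedra `A` (`false`) and `B` (`true`); the vertices `0,1,2,3` of
`A` are `u,v,w₁,w₂` and those of `B` are `v,u,w₁,w₂`. `attach` says to which tetrahedron of `T` the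
faces opposite `w₁` and `w₂` are glued, and how the vertices are mapped: for `A` on the side of
`F₁ ∪ F₂` on which the rotation takes place, for `B` on the other side. -/
def ZeroTwoSite.attach : Bool → Fin 4 → ι × Equiv.Perm (Fin 4)
  | false, 2 => s.last
  | false, _ => (s.σ, s.p)
  | true, 2 => (T.adj s.last.1 (s.last.2 2),
      T.perm s.last.1 (s.last.2 2) * s.last.2 * Equiv.swap 0 1)
  | true, _ => (T.adj s.σ (s.p 3), T.perm s.σ (s.p 3) * s.p * Equiv.swap 0 1)

/-- The face of a tetrahedron of `T` to which the face `j ∈ {2,3}` of `A` or `B` is glued. -/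
def ZeroTwoSite.target (t : Bool) (j : Fin 4) : ι × Fin 4 := ((s.attach t j).1, (s.attach t j).2 j)

open Classical in
/-- The gluing after the 0-2 move: the two tetrahedra are glued to each other along the faces `0`
and `1` (those containing the new edge `w₁w₂`, which has degree 2), to the tetrahedra of `T` along
the faces `2` and `3`; all other gluings are those of `T`. The result for a face is the adjacent
tetrahedron and the map of vertices. -/
noncomputable def ZeroTwoSite.newGlue :
    ι ⊕ Bool → Fin 4 → (ι ⊕ Bool) × Equiv.Perm (Fin 4)
  | Sum.inl σ, f =>
      if (σ, f) = s.target false 2 then (Sum.inr false, (s.attach false 2).2⁻¹)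
      else if (σ, f) = s.target false 3 then (Sum.inr false, (s.attach false 3).2⁻¹)
      else if (σ, f) = s.target true 2 then (Sum.inr true, (s.attach true 2).2⁻¹)
      else if (σ, f) = s.target true 3 then (Sum.inr true, (s.attach true 3).2⁻¹)
      else (Sum.inl (T.adj σ f), T.perm σ f)
  | Sum.inr t, f =>
      if f = 0 ∨ f = 1 then (Sum.inr (!t), Equiv.swap 0 1)
      else (Sum.inl (s.attach t f).1, (s.attach t f).2)

theorem faceGlue_faceGlue (x : ι × Fin 4) : T.faceGlue (T.faceGlue x) = x := by
  have h1 := T.adj_adj x.1 x.2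
  have h2 := T.perm_perm x.1 x.2
  simp only [faceGlue, h1, h2]
  simp

theorem faceGlue_ne (x : ι × Fin 4) : T.faceGlue x ≠ x := by
  intro h
  exact T.not_self x.1 x.2 ⟨congrArg Prod.fst h, congrArg Prod.snd h⟩

theorem ZeroTwoSite.target_true (j : Fin 4) (hj : j = 2 ∨ j = 3) :
    s.target true j = T.faceGlue (s.target false j) := by
  rcases hj with rfl | rfl <;>
  simp [ZeroTwoSite.target, ZeroTwoSite.attach, faceGlue, Equiv.swap_apply_of_ne_of_ne]

theorem ZeroTwoSite.target_false_ne : s.target false 2 ≠ s.target false 3 := s.ne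

theorem ZeroTwoSite.target_false_ne_glue : s.target false 2 ≠ T.faceGlue (s.target false 3) :=
  s.ne_glue

theorem sign_rotate (φ : ι × Equiv.Perm (Fin 4)) :
    Equiv.Perm.sign (T.rotate φ).2 = Equiv.Perm.sign φ.2 := by
  simp [rotate, T.sign_perm, Equiv.Perm.sign_swap (show (2 : Fin 4) ≠ 3 by decide)]

theorem ZeroTwoSite.sign_last : Equiv.Perm.sign s.last.2 = -1 := by
  unfold ZeroTwoSite.last
  generalize s.steps = n
  induction n with
  | zero => exact s.sign_p
  | succ n ih => rw [Function.iterate_succ_apply', sign_rotate, ih]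

theorem ZeroTwoSite.sign_attach (t : Bool) (j : Fin 4) :
    Equiv.Perm.sign (s.attach t j).2 = -1 := by
  have h1 := s.sign_last
  have h2 := s.sign_p
  have h3 : Equiv.Perm.sign (Equiv.swap (0 : Fin 4) 1) = -1 := Equiv.Perm.sign_swap (by decide)
  cases t <;> fin_cases j <;>
    simp [ZeroTwoSite.attach, h1, h2, h3, T.sign_perm]

/-- The four faces of tetrahedra of `T` that are glued to `A` and `B` are distinct. -/
theorem ZeroTwoSite.target_inj (t t' : Bool) (j j' : Fin 4) (hj : j = 2 ∨ j = 3)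
    (hj' : j' = 2 ∨ j' = 3) (h : s.target t j = s.target t' j') : t = t' ∧ j = j' := by
  have n1 := s.target_false_ne
  have n2 := s.target_false_ne_glue
  have e2 := s.target_true 2 (Or.inl rfl)
  have e3 := s.target_true 3 (Or.inr rfl)
  have g2 := faceGlue_ne (T := T) (s.target false 2)
  have g3 := faceGlue_ne (T := T) (s.target false 3)
  have i2 := faceGlue_faceGlue (T := T) (s.target false 2)
  have i3 := faceGlue_faceGlue (T := T) (s.target false 3)
  rcases hj with rfl | rfl <;> rcases hj' with rfl | rfl <;> cases t <;> cases t' <;> grind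

theorem ZeroTwoSite.newGlue_target (t : Bool) (j : Fin 4) (hj : j = 2 ∨ j = 3) :
    s.newGlue (Sum.inl (s.target t j).1) (s.target t j).2 =
      (Sum.inr t, (s.attach t j).2⁻¹) := by
  have key := s.target_inj t
  unfold ZeroTwoSite.newGlue
  simp only [Prod.mk.eta]
  rcases hj with rfl | rfl <;> cases t <;> simp only [if_true] <;> grind

theorem ZeroTwoSite.newGlue_old (σ : ι) (f : Fin 4)
    (h : ∀ t j, (j = 2 ∨ j = 3) → (σ, f) ≠ s.target t j) :
    s.newGlue (Sum.inl σ) f = (Sum.inl (T.adj σ f), T.perm σ f) := by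
  unfold ZeroTwoSite.newGlue
  simp [h]

theorem ZeroTwoSite.newGlue_new (t : Bool) (j : Fin 4) (hj : j = 2 ∨ j = 3) :
    s.newGlue (Sum.inr t) j = (Sum.inl (s.target t j).1, (s.attach t j).2) := by
  rcases hj with rfl | rfl <;> simp [ZeroTwoSite.newGlue, ZeroTwoSite.target]

theorem ZeroTwoSite.newGlue_pillow (t : Bool) (j : Fin 4) (hj : j = 0 ∨ j = 1) :
    s.newGlue (Sum.inr t) j = (Sum.inr (!t), Equiv.swap 0 1) := by
  simp [ZeroTwoSite.newGlue, hj]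

theorem ZeroTwoSite.target_faceGlue (t : Bool) (j : Fin 4) (hj : j = 2 ∨ j = 3) :
    T.faceGlue (s.target t j) = s.target (!t) j := by
  cases t
  · exact (s.target_true j hj).symm
  · rw [s.target_true j hj, faceGlue_faceGlue]
    rfl

/-- The new gluing is an involution on the faces, without fixed points, and reverses
orientation. -/
theorem ZeroTwoSite.newGlue_spec (x : ι ⊕ Bool) (f : Fin 4) :
    s.newGlue (s.newGlue x f).1 ((s.newGlue x f).2 f) = (x, (s.newGlue x f).2⁻¹) ∧
      ¬ ((s.newGlue x f).1 = x ∧ (s.newGlue x f).2 f = f) ∧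
      Equiv.Perm.sign (s.newGlue x f).2 = -1 := by
  rcases x with σ | t
  · by_cases h : ∃ t j, (j = 2 ∨ j = 3) ∧ (σ, f) = s.target t j
    · obtain ⟨t, j, hj, h⟩ := h
      obtain ⟨rfl, rfl⟩ := Prod.mk.inj h
      have e := s.newGlue_target t j hj
      simp only [ZeroTwoSite.target] at e
      rw [e]
      have hf : (s.attach t j).2⁻¹ ((s.attach t j).2 j) = j := by simp
      simp only [hf, s.newGlue_new t j hj, inv_inv, true_and, reduceCtorEq, false_and,
        not_false_eq_true, Equiv.Perm.sign_inv, s.sign_attach]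
      exact ⟨rfl, trivial⟩
    · push Not at h
      rw [s.newGlue_old σ f h]
      have h' : ∀ t j, (j = 2 ∨ j = 3) → (T.adj σ f, T.perm σ f f) ≠ s.target t j := by
        intro t j hj e
        refine h (!t) j hj ?_
        rw [← s.target_faceGlue t j hj, ← e]
        exact (faceGlue_faceGlue (T := T) (σ, f)).symm
      dsimp only
      rw [s.newGlue_old _ _ h', T.adj_adj, T.perm_perm]
      refine ⟨rfl, ?_, T.sign_perm σ f⟩
      rintro ⟨h1, h2⟩
      exact T.not_self σ f ⟨Sum.inl_injective h1, h2⟩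
  · by_cases hf : f = 0 ∨ f = 1
    · rw [s.newGlue_pillow t f hf]
      have hf' : Equiv.swap (0 : Fin 4) 1 f = 0 ∨ Equiv.swap (0 : Fin 4) 1 f = 1 := by
        rcases hf with rfl | rfl <;> simp
      dsimp only
      rw [s.newGlue_pillow _ _ hf']
      refine ⟨by simp, by cases t <;> simp, Equiv.Perm.sign_swap (by decide)⟩
    · have hf' : f = 2 ∨ f = 3 := by revert hf; revert f; decide
      rw [s.newGlue_new t f hf']
      refine ⟨s.newGlue_target t f hf', by simp, s.sign_attach t f⟩

/-- The triangulation obtained by the 0-2 move. -/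
noncomputable def ZeroTwoSite.result : Triangulation (ι ⊕ Bool) where
  adj x f := (s.newGlue x f).1
  perm x f := (s.newGlue x f).2
  adj_adj x f := congrArg Prod.fst (s.newGlue_spec x f).1
  perm_perm x f := congrArg Prod.snd (s.newGlue_spec x f).1
  not_self x f := (s.newGlue_spec x f).2.1
  sign_perm x f := (s.newGlue_spec x f).2.2

/-- The classes `a` of `T` and `a'` of the triangulation after the move are the same class of
`H_2(M,∂M;ℤ/2)`: both are represented by one and the same union `z` of faces of the common
tetrahedra. (Each class has such representatives, and this relation is the isomorphism of the two
cellular homology groups.) -/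
def ZeroTwoSite.SameRel (a : T.RelHomology) (a' : s.result.RelHomology) : Prop :=
  ∃ (z : ι × Fin 4 →₀ ZMod 2) (hz : z ∈ T.relCycles)
    (hz' : z.mapDomain (Prod.map Sum.inl id) ∈ s.result.relCycles),
    a = QuotientAddGroup.mk ⟨z, hz⟩ ∧ a' = QuotientAddGroup.mk ⟨_, hz'⟩

/-- The classes `b` of `T` and `b'` of the triangulation after the move are the same class of
`H_1(∂M;ℤ)`: both are represented by one and the same 1-chain `z` of sides of truncation triangles
of the common tetrahedra. (Each class has such representatives, and this relation is the isomorphism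
of the two cellular homology groups.) -/
def ZeroTwoSite.SamePeripheral (b : T.PeripheralHomology) (b' : s.result.PeripheralHomology) : Prop :=
  ∃ (z : Corner ι →₀ ℤ) (hz : z ∈ T.peripheralCycles)
    (hz' : z.mapDomain (Prod.map Sum.inl id) ∈ s.result.peripheralCycles),
    b = Submodule.Quotient.mk ⟨z, hz⟩ ∧ b' = Submodule.Quotient.mk ⟨_, hz'⟩

end ZeroTwo

end Triangulation

end Index3D

/-! Call the two new tetrahedra `A` and `B`. Let a class of the new triangulation have coordinates
`(a,b,c)` in `A` and `(a',b',c')` in `B`. The new edge `w₁w₂` has degree 2, and its matching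
equation reads `c - b + (c' - b') = 0`. Adding `e` times the edge solution of this edge only
replaces `a, a'` by `a + e, a' + e` and contributes a factor `q^e`. The index after the move is
therefore a sum of inner sums over `e`. These are evaluated by the quadratic identity `∑_e q^e
I_Δ(m,e) I_Δ(m,e+c) = δ_{c,0}` (`tetIndex_quadratic`, `tetIndexJ_quadratic`): the inner sum is a
monomial if the `defect` `(a - b) - (a' - c')` is zero, and it vanishes otherwise.

If the defect is zero, the shears of `A` and `B` cancel along the edges that they share, so the
pillow can be collapsed and the class restricts to a Q-normal class of `T` (`restrict_mem`).
Conversely every class of `T` lifts, and a class of defect zero is determined by its restriction up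
to the tetrahedral solutions of `A` and `B` and multiples of the new edge solution (`eq_lift_add`).
The surviving inner sums thus correspond to the classes of `T` modulo tetrahedral solutions. It
remains to compare Euler characteristics and homology classes.

The equality of Euler characteristics (`euler_lift`) is checked on edge, tetrahedral and peripheral
curve solutions. That these span rationally (`eq_zero_of_solutions`) is a form of Neumann-Zagier
duality: a functional that vanishes on all of them is given by the shears of some `U` which has no
periods along curves; hence a multiple of `U` has a potential on `∂M`, and the matching equations
annihilate it. A curve that crosses the opened faces is lifted by inserting one arc in `A` and one
in `B`.

Homology classes are compared through cocycles with values in arbitrary groups. Cocycles of `T`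
extend over the pillow. Cocycles after the move restrict once their gaps, the sums over the two
copies of an opened face, are zero. The gaps do not disturb the homology class of a cycle, since
their boundaries are independent; this rests on the fact that the two parts of the split edge lie in
different edge classes (`orEdge_split_ne`), which is seen by rotating around one of them.

For `m ≤ 0` the quadratic identity follows by expanding both factors into series with summation
indices `n`, `n'` and putting `N = e + c + n + n'`: for fixed `N` the sum factors into two sums of
the form `∑_n (-1)^n q^{n(n-1)/2} / ((q)_n (q)_{N-n}) = δ_{N,0}`. The symmetry `I_Δ(m,e) =
(-q^{1/2})^m I_Δ(-m,e+m)` gives the case `m > 0`. -/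

namespace Index3D

/-! ## Summable families of formal Laurent series -/

section LaurentSum

variable {α β γ : Type*}

/-- The union of the supports is well-ordered in `ℤ`, hence bounded below by some `b`; only the
finitely many degrees between `b` and `D` matter, and each of them meets finitely many members. -/
theorem laurentSummable_coe (s : HahnSeries.SummableFamily ℤ ℤ α) : LaurentSummable s := by
  intro D
  obtain ⟨b, hb⟩ : BddBelow (⋃ a, (s a).support) := by
    rcases Set.eq_empty_or_nonempty (⋃ a, (s a).support) with h | h
    · rw [h]; exact bddBelow_empty
    · exact ⟨s.isPWO_iUnion_support.isWF.min h, fun x hx => Set.IsWF.min_le _ h hx⟩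
  refine (((Set.finite_Icc b D).biUnion fun k _ => s.finite_co_support k)).subset ?_
  rintro i ⟨k, hk, hi⟩
  exact Set.mem_biUnion (Set.mem_Icc.2 ⟨hb (Set.mem_iUnion.2 ⟨i, hi⟩), hk⟩) hi

/-- A summable family of Laurent series as a `HahnSeries.SummableFamily`. -/
def LaurentSummable.family {f : α → LaurentSeries ℤ} (h : LaurentSummable f) :
    HahnSeries.SummableFamily ℤ ℤ α where
  toFun := f
  isPWO_iUnion_support' := by
    obtain ⟨b, hb⟩ : BddBelow (⋃ i ∈ {i | ∃ k ≤ (0 : ℤ), (f i).coeff k ≠ 0}, (f i).support) :=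
      ((h 0).bddBelow_biUnion).2 fun i _ =>
        ⟨(f i).order, fun k hk => HahnSeries.order_le_of_coeff_ne_zero hk⟩
    have : BddBelow (⋃ i, (f i).support) := by
      refine ⟨min b 0, ?_⟩
      rintro k hk
      obtain ⟨i, hi⟩ := Set.mem_iUnion.1 hk
      rcases lt_or_ge 0 k with h0 | h0
      · exact (min_le_right _ _).trans h0.le
      · exact (min_le_left _ _).trans (hb (Set.mem_biUnion (show i ∈ _ from ⟨k, h0, hi⟩) hi))
    exact this.isWF.isPWO
  finite_co_support' k := (h k).subset fun _ hi => ⟨k, le_rfl, hi⟩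

theorem coeff_laurentSum {f : α → LaurentSeries ℤ} (h : LaurentSummable f) (k : ℤ) :
    (laurentSum f).coeff k = ∑ᶠ i, (f i).coeff k := by
  simp [laurentSum, h]

theorem laurentSum_coe (s : HahnSeries.SummableFamily ℤ ℤ α) : laurentSum s = s.hsum := by
  ext k
  rw [coeff_laurentSum (laurentSummable_coe s), HahnSeries.SummableFamily.coeff_hsum]

theorem LaurentSummable.hsum_family {f : α → LaurentSeries ℤ} (h : LaurentSummable f) :
    h.family.hsum = laurentSum f := (laurentSum_coe h.family).symm

theorem LaurentSummable.comp_injective {f : α → LaurentSeries ℤ} (h : LaurentSummable f)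
    {g : β → α} (hg : Function.Injective g) : LaurentSummable (f ∘ g) := fun D =>
  Set.Finite.preimage (f := g) hg.injOn (h D)

theorem LaurentSummable.of_comp_equiv {f : α → LaurentSeries ℤ} (e : β ≃ α)
    (h : LaurentSummable (f ∘ e)) : LaurentSummable f := by
  have := h.comp_injective e.symm.injective
  rwa [Function.comp_assoc, e.self_comp_symm, Function.comp_id] at this

theorem laurentSummable_comp_equiv {f : α → LaurentSeries ℤ} (e : β ≃ α) :
    LaurentSummable (f ∘ e) ↔ LaurentSummable f :=
  ⟨LaurentSummable.of_comp_equiv e, fun h => h.comp_injective e.injective⟩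

theorem laurentSum_comp_equiv (f : α → LaurentSeries ℤ) (e : β ≃ α) :
    laurentSum (f ∘ e) = laurentSum f := by
  by_cases h : LaurentSummable f
  · ext k
    rw [coeff_laurentSum h, coeff_laurentSum ((laurentSummable_comp_equiv e).2 h)]
    exact finsum_comp_equiv e (f := fun i => (f i).coeff k)
  · rw [laurentSum, laurentSum, dif_neg h, dif_neg (mt (laurentSummable_comp_equiv e).1 h)]

theorem laurentSum_comp_injective {f : α → LaurentSeries ℤ} {g : β → α}
    (hg : Function.Injective g) (h : LaurentSummable f)
    (h0 : ∀ i, i ∉ Set.range g → f i = 0) : laurentSum (f ∘ g) = laurentSum f := by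
  ext k
  rw [coeff_laurentSum h, coeff_laurentSum (h.comp_injective hg)]
  simp only [Function.comp_apply]
  rw [← finsum_mem_range (f := fun i => (f i).coeff k) hg, ← finsum_mem_univ fun i => (f i).coeff k]
  refine finsum_mem_inter_support_eq' _ _ _ fun i hi => ?_
  simp only [Set.mem_univ, iff_true]
  by_contra hr
  simp [h0 i hr] at hi

theorem LaurentSummable.mul {f : α → LaurentSeries ℤ} {g : β → LaurentSeries ℤ}
    (hf : LaurentSummable f) (hg : LaurentSummable g) :
    LaurentSummable fun p : α × β => f p.1 * g p.2 :=
  laurentSummable_coe (hf.family.mul hg.family)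

theorem LaurentSummable.laurentSum_mul {f : α → LaurentSeries ℤ} {g : β → LaurentSeries ℤ}
    (hf : LaurentSummable f) (hg : LaurentSummable g) :
    laurentSum (fun p : α × β => f p.1 * g p.2) = laurentSum f * laurentSum g := by
  rw [← hf.hsum_family, ← hg.hsum_family, ← HahnSeries.SummableFamily.hsum_mul, ← laurentSum_coe]
  rfl

theorem LaurentSummable.const_mul (x : LaurentSeries ℤ) {f : α → LaurentSeries ℤ}
    (hf : LaurentSummable f) : LaurentSummable fun i => x * f i :=
  laurentSummable_coe (x • hf.family)

theorem LaurentSummable.laurentSum_const_mul (x : LaurentSeries ℤ) {f : α → LaurentSeries ℤ}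
    (hf : LaurentSummable f) : laurentSum (fun i => x * f i) = x * laurentSum f := by
  rw [← hf.hsum_family]
  exact (laurentSum_coe (x • hf.family)).trans HahnSeries.SummableFamily.hsum_smul

theorem LaurentSummable.laurentSum_sub {f g : α → LaurentSeries ℤ}
    (hf : LaurentSummable f) (hg : LaurentSummable g) :
    laurentSum (fun i => f i - g i) = laurentSum f - laurentSum g := by
  rw [← hf.hsum_family, ← hg.hsum_family, ← HahnSeries.SummableFamily.hsum_sub, ← laurentSum_coe]
  rfl

/-- A nonzero coefficient of an inner sum forces a nonzero coefficient, in the same degree, of one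
of its terms. -/
theorem LaurentSummable.fst {f : α × β → LaurentSeries ℤ} (hf : LaurentSummable f) :
    LaurentSummable fun a => laurentSum fun b => f (a, b) := by
  intro D
  refine ((hf D).image Prod.fst).subset ?_
  rintro a ⟨k, hk, ha⟩
  have hb := coeff_laurentSum (hf.comp_injective (Prod.mk_right_injective a)) k
  replace ha := hb.symm.trans_ne ha
  obtain ⟨b, hb⟩ : ∃ b, (f (a, b)).coeff k ≠ 0 := by
    by_contra! hc
    exact ha (finsum_eq_zero_of_forall_eq_zero hc)
  exact ⟨(a, b), ⟨k, hk, hb⟩, rfl⟩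

/-- Fubini: in each degree only finitely many pairs contribute. -/
theorem LaurentSummable.laurentSum_prod {f : α × β → LaurentSeries ℤ} (hf : LaurentSummable f) :
    laurentSum (fun a => laurentSum fun b => f (a, b)) = laurentSum f := by
  ext k
  rw [coeff_laurentSum hf, coeff_laurentSum hf.fst,
    finsum_curry _ ((hf k).subset fun _ hi => ⟨k, le_rfl, hi⟩)]
  exact finsum_congr fun a => coeff_laurentSum (hf.comp_injective (Prod.mk_right_injective a)) k

theorem laurentSum_zero : laurentSum (fun _ : α => (0 : LaurentSeries ℤ)) = 0 :=
  (laurentSum_coe (0 : HahnSeries.SummableFamily ℤ ℤ α)).trans HahnSeries.SummableFamily.hsum_zero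

theorem laurentSummable_of_finite {f : α → LaurentSeries ℤ} (h : {i | f i ≠ 0}.Finite) :
    LaurentSummable f := fun D => h.subset <| by
  rintro i ⟨k, -, hi⟩ h0
  simp [h0] at hi

theorem laurentSum_eq_single {f : α → LaurentSeries ℤ} (a : α) (h : ∀ i, i ≠ a → f i = 0) :
    laurentSum f = f a := by
  have hs : LaurentSummable f := laurentSummable_of_finite <|
    (Set.finite_singleton a).subset fun i hi => by
      by_contra hc
      exact hi (h i hc)
  ext k
  rw [coeff_laurentSum hs]
  exact finsum_eq_single _ a fun i hi => by simp [h i hi]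

/-- The criterion for explicit families, whose members are a monomial of degree `d i` times a power
series. -/
theorem laurentSummable_of_le {f : α → LaurentSeries ℤ} (d : α → ℤ)
    (hd : ∀ i k, (f i).coeff k ≠ 0 → d i ≤ k) (hf : ∀ D, {i | f i ≠ 0 ∧ d i ≤ D}.Finite) :
    LaurentSummable f := fun D => (hf D).subset <| by
  rintro i ⟨k, hk, hi⟩
  exact ⟨fun h => by simp [h] at hi, (hd i k hi).trans hk⟩

end LaurentSum

end Index3D

namespace Index3D

/-! ## Identities for the tetrahedral index -/

/-- The signed monomial `(-1)^n t^k` in `t = q^{1/2}`. -/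
noncomputable def signedMonomial (k n : ℤ) : LaurentSeries ℤ :=
  HahnSeries.single k (n.negOnePow : ℤ)

theorem signedMonomial_mul (k l m n : ℤ) :
    signedMonomial k m * signedMonomial l n = signedMonomial (k + l) (m + n) := by
  simp [signedMonomial, HahnSeries.single_mul_single, Int.negOnePow_add]

theorem signedMonomial_zero : signedMonomial 0 0 = 1 := by simp [signedMonomial]

theorem signedMonomial_sub_one (k n : ℤ) : signedMonomial k (n - 1) = -signedMonomial k n := by
  simp [signedMonomial, Int.negOnePow_sub]

theorem signedMonomial_eq (k l m n : ℤ) (h : k = l) (h' : Even (m - n)) :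
    signedMonomial k m = signedMonomial l n := by
  rw [signedMonomial, signedMonomial, h, Int.negOnePow_eq_iff _ _ |>.2 h']

theorem negHalfPow_eq (k : ℤ) : negHalfPow k = signedMonomial k k := rfl

theorem coeff_signedMonomial_mul (k n : ℤ) (x : LaurentSeries ℤ) (d : ℤ) :
    (signedMonomial k n * x).coeff d = (n.negOnePow : ℤ) * x.coeff (d - k) := by
  rw [signedMonomial, HahnSeries.coeff_single_mul]

/-- The Laurent series `1 / (q)_k`, zero for negative `k`. -/
noncomputable def invPochhammer (k : ℤ) : LaurentSeries ℤ :=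
  if 0 ≤ k then ((qPochhammerInv k.toNat : PowerSeries ℤ) : LaurentSeries ℤ) else 0

theorem invPochhammer_of_neg {k : ℤ} (h : k < 0) : invPochhammer k = 0 := if_neg h.not_ge

theorem constantCoeff_qPochhammer (n : ℕ) : PowerSeries.constantCoeff (qPochhammer n) = 1 := by
  rw [qPochhammer, map_prod]
  refine Finset.prod_eq_one fun i hi => ?_
  have : 2 * i ≠ 0 := by have := (Finset.mem_Icc.1 hi).1; omega
  simp [this]

theorem qPochhammer_mul_inv (n : ℕ) : qPochhammer n * qPochhammerInv n = 1 :=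
  PowerSeries.mul_invOfUnit _ _ (by simp [constantCoeff_qPochhammer])

theorem qPochhammerInv_zero : qPochhammerInv 0 = 1 := by
  simpa [qPochhammer] using qPochhammer_mul_inv 0

theorem one_sub_mul_qPochhammerInv (n : ℕ) :
    (1 - PowerSeries.X ^ (2 * (n + 1))) * qPochhammerInv (n + 1) = qPochhammerInv n := by
  have h1 := qPochhammer_mul_inv (n + 1)
  have h2 := qPochhammer_mul_inv n
  rw [qPochhammer, Finset.prod_Icc_succ_top (by omega), ← qPochhammer] at h1
  linear_combination (qPochhammerInv n) * h1 -
    ((1 - PowerSeries.X ^ (2 * (n + 1))) * qPochhammerInv (n + 1)) * h2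

theorem invPochhammer_zero : invPochhammer 0 = 1 := by
  simp [invPochhammer, qPochhammerInv_zero]

/-- With `1/(q)_k = 0` for `k < 0` the recursion holds for every integer: at `k = 0` the factor `1 -
q^0` vanishes. The relations below therefore hold term by term over all of `ℤ`, without boundary
terms. -/
theorem one_sub_mul_invPochhammer (k : ℤ) :
    (1 - signedMonomial (2 * k) 0) * invPochhammer k = invPochhammer (k - 1) := by
  rcases lt_trichotomy k 0 with h | rfl | h
  · rw [invPochhammer_of_neg h, invPochhammer_of_neg (by omega), mul_zero]
  · rw [invPochhammer_of_neg (show (0 : ℤ) - 1 < 0 by omega), mul_zero, signedMonomial_zero]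
    simp
  · obtain ⟨n, rfl⟩ : ∃ n : ℕ, k = (n + 1 : ℕ) := ⟨(k - 1).toNat, by omega⟩
    have h1 : invPochhammer ((n + 1 : ℕ) : ℤ) =
        ((qPochhammerInv (n + 1) : PowerSeries ℤ) : LaurentSeries ℤ) := by
      rw [invPochhammer, if_pos (by omega), Int.toNat_natCast]
    have h2 : invPochhammer (((n + 1 : ℕ) : ℤ) - 1) =
        ((qPochhammerInv n : PowerSeries ℤ) : LaurentSeries ℤ) := by
      rw [invPochhammer, if_pos (by omega)]
      congr 2
      omega
    rw [h1, h2, ← one_sub_mul_qPochhammerInv n]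
    have h3 : ((PowerSeries.X ^ (2 * (n + 1)) : PowerSeries ℤ) : LaurentSeries ℤ) =
        signedMonomial (2 * ((n + 1 : ℕ) : ℤ)) 0 := by
      rw [PowerSeries.coe_pow, PowerSeries.coe_X, HahnSeries.single_pow, signedMonomial]
      simp
      try ring_nf
    rw [PowerSeries.coe_mul, PowerSeries.coe_sub, PowerSeries.coe_one, h3]

theorem coeff_powerSeries_of_neg (p : PowerSeries ℤ) {d : ℤ} (hd : d < 0) :
    (p : LaurentSeries ℤ).coeff d = 0 := by
  simp [PowerSeries.coeff_coe, hd]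

theorem invPochhammer_mul (k l : ℤ) :
    ∃ p : PowerSeries ℤ, invPochhammer k * invPochhammer l = (p : LaurentSeries ℤ) := by
  unfold invPochhammer
  split_ifs
  · exact ⟨_, (PowerSeries.coe_mul _ _).symm⟩
  all_goals exact ⟨0, by simp⟩

/-- The summands of the tetrahedral index, indexed by all integers. -/
noncomputable def tetTerm (m e n : ℤ) : LaurentSeries ℤ :=
  signedMonomial (n * (n + 1) - (2 * n + e) * m) n * (invPochhammer n * invPochhammer (n + e))

theorem tetTerm_of_neg {m e n : ℤ} (h : n < 0 ∨ n + e < 0) : tetTerm m e n = 0 := by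
  unfold tetTerm
  rcases h with h | h <;> simp [invPochhammer_of_neg h]

theorem le_of_coeff_signedMonomial_mul (d s k : ℤ) (p : PowerSeries ℤ)
    (h : (signedMonomial d s * (p : LaurentSeries ℤ)).coeff k ≠ 0) : d ≤ k := by
  by_contra hc
  rw [coeff_signedMonomial_mul, coeff_powerSeries_of_neg _ (by omega), mul_zero] at h
  exact h rfl

theorem le_of_coeff_tetTerm {m e n k : ℤ} (h : (tetTerm m e n).coeff k ≠ 0) :
    n * (n + 1) - (2 * n + e) * m ≤ k := by
  obtain ⟨p, hp⟩ := invPochhammer_mul n (n + e)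
  rw [tetTerm, hp] at h
  exact le_of_coeff_signedMonomial_mul _ _ _ _ h

theorem tetTerm_summable (m e : ℤ) : LaurentSummable (tetTerm m e) := by
  refine laurentSummable_of_le (fun n => n * (n + 1) - (2 * n + e) * m)
    (fun i k h => le_of_coeff_tetTerm h) fun D => ?_
  refine (Set.finite_Icc 0 (|D| + 2 * |m| + |e * m| + 1)).subset ?_
  rintro n ⟨h0, h⟩
  have h1 : 0 ≤ n := by
    by_contra hc
    exact h0 (tetTerm_of_neg (Or.inl (not_le.1 hc)))
  refine ⟨h1, ?_⟩
  by_contra! hn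
  have a1 := le_abs_self D
  have a2 := le_abs_self m
  have a3 := le_abs_self (e * m)
  have a4 := abs_nonneg D
  have a5 := abs_nonneg m
  have a6 := abs_nonneg (e * m)
  have : n * 1 ≤ n * (n + 1 - 2 * m) := mul_le_mul_of_nonneg_left (by linarith) h1
  nlinarith

theorem tetIndex_eq (m e : ℤ) : tetIndex m e = laurentSum (tetTerm m e) := by
  have hinj : Function.Injective (fun n : ℕ => (n : ℤ)) := Nat.cast_injective
  rw [← laurentSum_comp_injective hinj (tetTerm_summable m e)]
  · unfold tetIndex
    congr 1
    funext n
    simp only [Function.comp_apply]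
    split_ifs with h
    · rw [tetTerm, signedMonomial, invPochhammer, invPochhammer, if_pos h, if_pos (by omega),
        PowerSeries.coe_mul, Int.toNat_natCast]
      simp [Int.negOnePow_def]
    · exact (tetTerm_of_neg (Or.inr (not_le.1 h))).symm
  · intro i hi
    refine tetTerm_of_neg (Or.inl ?_)
    by_contra hc
    exact hi ⟨i.toNat, by simpa using hc⟩

/-- The difference of the terms for `m` and `m - 1` carries a factor `1 - q^n`. It lowers `1/(q)_n`
to `1/(q)_{n-1}`, and the result is a term with `n` shifted down and `e` shifted up. -/
theorem tetTerm_rel_shift (m e n : ℤ) : signedMonomial e 0 * tetTerm m e n =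
    tetTerm (m - 1) e n - signedMonomial (1 - m) 0 * tetTerm (m - 1) (e + 1) (n - 1) := by
  unfold tetTerm
  rw [← one_sub_mul_invPochhammer n, show n - 1 + (e + 1) = n + e by ring, signedMonomial_sub_one]
  have h1 : signedMonomial e 0 * signedMonomial (n * (n + 1) - (2 * n + e) * m) n =
      signedMonomial (n * (n + 1) - (2 * n + e) * m + e) n := by
    rw [signedMonomial_mul]; congr 1 <;> ring
  have h2 : signedMonomial (1 - m) 0 *
      signedMonomial ((n - 1) * (n - 1 + 1) - (2 * (n - 1) + (e + 1)) * (m - 1)) n =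
      signedMonomial (n * (n + 1) - (2 * n + e) * m + e) n := by
    rw [signedMonomial_mul]; congr 1 <;> ring
  have h3 : signedMonomial (n * (n + 1) - (2 * n + e) * m + e) n * signedMonomial (2 * n) 0 =
      signedMonomial (n * (n + 1) - (2 * n + e) * (m - 1)) n := by
    rw [signedMonomial_mul]; congr 1 <;> ring
  linear_combination (invPochhammer n * invPochhammer (n + e)) * h1 -
    ((1 - signedMonomial (2 * n) 0) * invPochhammer n * invPochhammer (n + e)) * h2 +
    (invPochhammer n * invPochhammer (n + e)) * h3

/-- Here the factor `1 - q^{n+e}` is absorbed by `1/(q)_{n+e}`, which lowers `e` and keeps `n`. -/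
theorem tetTerm_rel (m e n : ℤ) : tetTerm (m - 1) e n =
    signedMonomial (-e) 0 * tetTerm m e n - signedMonomial (-m - e) 0 * tetTerm m (e - 1) n := by
  unfold tetTerm
  rw [show n + (e - 1) = n + e - 1 by ring, ← one_sub_mul_invPochhammer (n + e)]
  have h1 : signedMonomial (-e) 0 * signedMonomial (n * (n + 1) - (2 * n + e) * m) n =
      signedMonomial (n * (n + 1) - (2 * n + e) * m - e) n := by
    rw [signedMonomial_mul]; congr 1 <;> ring
  have h2 : signedMonomial (-m - e) 0 *
      signedMonomial (n * (n + 1) - (2 * n + (e - 1)) * m) n =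
      signedMonomial (n * (n + 1) - (2 * n + e) * m - e) n := by
    rw [signedMonomial_mul]; congr 1 <;> ring
  have h3 : signedMonomial (n * (n + 1) - (2 * n + e) * m - e) n *
      signedMonomial (2 * (n + e)) 0 =
      signedMonomial (n * (n + 1) - (2 * n + e) * (m - 1)) n := by
    rw [signedMonomial_mul]; congr 1 <;> ring
  linear_combination -(invPochhammer n * invPochhammer (n + e)) * h1 +
    ((1 - signedMonomial (2 * (n + e)) 0) * invPochhammer n * invPochhammer (n + e)) * h2 -
    (invPochhammer n * invPochhammer (n + e)) * h3

theorem tetIndex_rel_shift (m e : ℤ) : signedMonomial e 0 * tetIndex m e =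
    tetIndex (m - 1) e - signedMonomial (1 - m) 0 * tetIndex (m - 1) (e + 1) := by
  simp only [tetIndex_eq]
  have hs : LaurentSummable fun n => tetTerm (m - 1) (e + 1) (n - 1) :=
    (tetTerm_summable (m - 1) (e + 1)).comp_injective (Equiv.subRight (1 : ℤ)).injective
  rw [← laurentSum_comp_equiv (tetTerm (m - 1) (e + 1)) (Equiv.subRight (1 : ℤ)),
    ← (tetTerm_summable m e).laurentSum_const_mul]
  change _ = _ - _ * laurentSum fun n => tetTerm (m - 1) (e + 1) (n - 1)
  rw [← hs.laurentSum_const_mul, ← (tetTerm_summable (m - 1) e).laurentSum_sub (hs.const_mul _)]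
  exact congrArg laurentSum (funext fun n => tetTerm_rel_shift m e n)

theorem tetIndex_rel (m e : ℤ) : tetIndex (m - 1) e =
    signedMonomial (-e) 0 * tetIndex m e - signedMonomial (-m - e) 0 * tetIndex m (e - 1) := by
  simp only [tetIndex_eq]
  rw [← (tetTerm_summable m e).laurentSum_const_mul,
    ← (tetTerm_summable m (e - 1)).laurentSum_const_mul,
    ← ((tetTerm_summable m e).const_mul _).laurentSum_sub ((tetTerm_summable m (e - 1)).const_mul _)]
  exact congrArg laurentSum (funext fun n => tetTerm_rel m e n)

theorem signedMonomial_cancel (k n : ℤ) {x y : LaurentSeries ℤ}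
    (h : signedMonomial k n * x = signedMonomial k n * y) : x = y := by
  have := congrArg (signedMonomial (-k) (-n) * ·) h
  simpa only [← mul_assoc, signedMonomial_mul, neg_add_cancel, signedMonomial_zero, one_mul]
    using this

/-- The symmetry `I_Δ(m,e) = (-q^{1/2})^m I_Δ(-m,e+m)` for natural `m`. -/
theorem tetIndex_natCast (m : ℕ) (e : ℤ) :
    tetIndex m e = negHalfPow m * tetIndex (-m) (e + m) := by
  induction m generalizing e with
  | zero => simp [negHalfPow_zero]
  | succ m ih =>
    -- The two recurrences play mirrored roles: the first reduces `m + 1` to `m` on the left of the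
    -- symmetry, the second reduces `-(m + 1)` to `-m` on the right. By the induction hypothesis
    -- both sides become combinations of the same two values `x`, `y`.
    have h1 := tetIndex_rel_shift ((m + 1 : ℕ) : ℤ) e
    have h2 := tetIndex_rel (-(m : ℤ)) (e + (m + 1 : ℕ))
    rw [show ((m + 1 : ℕ) : ℤ) - 1 = m by push_cast; ring, ih, ih] at h1
    rw [show -(m : ℤ) - 1 = -((m + 1 : ℕ) : ℤ) by push_cast; ring] at h2
    apply signedMonomial_cancel e 0
    rw [h1, h2]
    simp only [negHalfPow_eq]
    rw [show e + 1 + (m : ℤ) = e + (m + 1 : ℕ) by push_cast; ring,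
      show e + ((m + 1 : ℕ) : ℤ) - 1 = e + m by push_cast; ring]
    generalize tetIndex (-(m : ℤ)) (e + m) = x
    generalize tetIndex (-(m : ℤ)) (e + (m + 1 : ℕ)) = y
    have g1 : signedMonomial e 0 * (signedMonomial (m + 1 : ℕ) (m + 1 : ℕ) *
        signedMonomial (-(e + (m + 1 : ℕ))) 0) = - signedMonomial 0 m := by
      rw [← signedMonomial_sub_one, signedMonomial_mul, signedMonomial_mul]
      refine signedMonomial_eq _ _ _ _ (by ring) ⟨1, by push_cast; ring⟩
    have g2 : signedMonomial e 0 * (signedMonomial (m + 1 : ℕ) (m + 1 : ℕ) *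
        signedMonomial (- -(m : ℤ) - (e + (m + 1 : ℕ))) 0) = - signedMonomial m m := by
      rw [← signedMonomial_sub_one, signedMonomial_mul, signedMonomial_mul]
      refine signedMonomial_eq _ _ _ _ (by ring) ⟨1, by push_cast; ring⟩
    have g3 : signedMonomial (1 - (m + 1 : ℕ)) 0 * signedMonomial m m = signedMonomial 0 m := by
      rw [signedMonomial_mul]
      congr 1 <;> (push_cast; ring)
    linear_combination x * g2 - y * g1 - y * g3

/-- The symmetry `I_Δ(m,e) = (-q^{1/2})^m I_Δ(-m,e+m)`. -/
theorem tetIndex_neg (m e : ℤ) : tetIndex m e = negHalfPow m * tetIndex (-m) (e + m) := by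
  obtain ⟨n, rfl | rfl⟩ := m.eq_nat_or_neg
  · exact tetIndex_natCast n e
  · have := tetIndex_natCast n (e + -n)
    rw [neg_neg, this, ← mul_assoc, ← negHalfPow_add, neg_add_cancel, negHalfPow_zero, one_mul]
    congr 1
    ring

end Index3D

namespace Index3D

/-! ## The quadratic identity -/

/-- The summands of `∑ (-1)^n q^{n(n-1)/2} / ((q)_n (q)_{N-n})`. -/
noncomputable def eulerTerm (N n : ℤ) : LaurentSeries ℤ :=
  signedMonomial (n * (n - 1)) n * (invPochhammer n * invPochhammer (N - n))

theorem eulerTerm_of_neg {N n : ℤ} (h : n < 0 ∨ N < n) : eulerTerm N n = 0 := by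
  unfold eulerTerm
  rcases h with h | h
  · simp [invPochhammer_of_neg h]
  · simp [invPochhammer_of_neg (show N - n < 0 by omega)]

theorem eulerTerm_summable (N : ℤ) : LaurentSummable (eulerTerm N) :=
  laurentSummable_of_finite <| (Set.finite_Icc 0 N).subset fun n hn => by
    by_contra hc
    rw [Set.mem_Icc, not_and_or, not_le, not_le] at hc
    exact hn (eulerTerm_of_neg hc)

/-- Split `1 - q^N = (1 - q^{N-n}) + q^{N-n} (1 - q^n)`; each bracket is absorbed by one of the two
Pochhammer denominators. -/
theorem eulerTerm_rel (N n : ℤ) : (1 - signedMonomial (2 * N) 0) * eulerTerm N n =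
    eulerTerm (N - 1) n - signedMonomial (2 * (N - 1)) 0 * eulerTerm (N - 1) (n - 1) := by
  unfold eulerTerm
  rw [show N - 1 - n = N - n - 1 by ring, show N - 1 - (n - 1) = N - n by ring,
    ← one_sub_mul_invPochhammer n, ← one_sub_mul_invPochhammer (N - n), signedMonomial_sub_one]
  have h1 : signedMonomial (2 * (N - 1)) 0 * signedMonomial ((n - 1) * (n - 1 - 1)) n =
      signedMonomial (n * (n - 1)) n * signedMonomial (2 * (N - n)) 0 := by
    rw [signedMonomial_mul, signedMonomial_mul]; congr 1 <;> ring
  have h2 : signedMonomial (2 * (N - n)) 0 * signedMonomial (2 * n) 0 =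
      signedMonomial (2 * N) 0 := by
    rw [signedMonomial_mul]; congr 1; ring
  linear_combination (-(1 - signedMonomial (2 * n) 0) * invPochhammer n * invPochhammer (N - n)) *
    h1 + (signedMonomial (n * (n - 1)) n * invPochhammer n * invPochhammer (N - n)) * h2

theorem laurentSum_eulerTerm_rel (N : ℤ) :
    (1 - signedMonomial (2 * N) 0) * laurentSum (eulerTerm N) =
      (1 - signedMonomial (2 * (N - 1)) 0) * laurentSum (eulerTerm (N - 1)) := by
  have hs : LaurentSummable fun n => eulerTerm (N - 1) (n - 1) :=
    (eulerTerm_summable (N - 1)).comp_injective (Equiv.subRight (1 : ℤ)).injective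
  have he : laurentSum (fun n => eulerTerm (N - 1) (n - 1)) = laurentSum (eulerTerm (N - 1)) :=
    laurentSum_comp_equiv (eulerTerm (N - 1)) (Equiv.subRight (1 : ℤ))
  rw [← (eulerTerm_summable N).laurentSum_const_mul, funext (eulerTerm_rel N),
    (eulerTerm_summable (N - 1)).laurentSum_sub (hs.const_mul _), hs.laurentSum_const_mul, he]
  ring

theorem one_sub_signedMonomial_ne_zero {k : ℤ} (hk : k ≠ 0) : 1 - signedMonomial k 0 ≠ 0 := by
  intro h
  have := congrArg (fun x : LaurentSeries ℤ => x.coeff 0) h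
  simp [signedMonomial, HahnSeries.coeff_single_of_ne hk.symm] at this

/-- A case of the finite `q`-binomial theorem. By the recursion `(1 - q^N) E_N = (1 - q^{N-1})
E_{N-1}`, the sum `E_1` is killed by the factor `1 - q^0` on the right, and the vanishing passes on
to all larger `N`. -/
theorem laurentSum_eulerTerm (N : ℤ) : laurentSum (eulerTerm N) = if N = 0 then 1 else 0 := by
  have h0 : laurentSum (eulerTerm 0) = 1 := by
    rw [laurentSum_eq_single 0 fun n hn => eulerTerm_of_neg (by omega)]
    simp [eulerTerm, signedMonomial_zero, invPochhammer_zero]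
  rcases lt_or_ge N 0 with h | h
  · rw [if_neg h.ne]
    have : eulerTerm N = fun _ => 0 := funext fun n => eulerTerm_of_neg (by omega)
    rw [this, laurentSum_zero]
  · obtain ⟨n, rfl⟩ := Int.eq_ofNat_of_zero_le h
    cases n with
    | zero => simpa using h0
    | succ n =>
      rw [if_neg (by omega)]
      induction n with
      | zero =>
        have := laurentSum_eulerTerm_rel 1
        simp only [sub_self, mul_zero, signedMonomial_zero, zero_mul] at this
        simpa using (mul_eq_zero.1 this).resolve_left (one_sub_signedMonomial_ne_zero (by decide))
      | succ n ih =>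
        have := laurentSum_eulerTerm_rel ((n + 1 + 1 : ℕ) : ℤ)
        rw [show ((n + 1 + 1 : ℕ) : ℤ) - 1 = (n + 1 : ℕ) by push_cast; ring, ih (by omega),
          mul_zero] at this
        exact (mul_eq_zero.1 this).resolve_left (one_sub_signedMonomial_ne_zero (by omega))

/-- The triple family of the quadratic identity, regrouped. -/
theorem tetTerm_mul_tetTerm (M c N n n' : ℤ) :
    signedMonomial (2 * (N - c - n - n')) 0 *
        (tetTerm (-M) (N - c - n - n') n * tetTerm (-M) (N - c - n - n' + c) n') =
      (signedMonomial (N * M) 0 * eulerTerm N n) *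
        (signedMonomial ((N - c) * (M + 2)) 0 * eulerTerm (N - c) n') := by
  unfold tetTerm eulerTerm
  -- With `e = N - c - n - n'` the denominators regroup crosswise: `(q)_{n'+e+c} = (q)_{N-n}` joins
  -- `(q)_n`, and `(q)_{n+e} = (q)_{N-c-n'}` joins `(q)_{n'}`.
  rw [show n + (N - c - n - n') = N - c - n' by ring,
    show n' + (N - c - n - n' + c) = N - n by ring]
  generalize hE : N - c - n - n' = e
  have h : signedMonomial (2 * e) 0 * (signedMonomial (n * (n + 1) - (2 * n + e) * -M) n *
        signedMonomial (n' * (n' + 1) - (2 * n' + (e + c)) * -M) n') =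
      signedMonomial (N * M) 0 * signedMonomial (n * (n - 1)) n *
        (signedMonomial ((N - c) * (M + 2)) 0 * signedMonomial (n' * (n' - 1)) n') := by
    simp only [signedMonomial_mul]
    subst hE
    congr 1 <;> ring
  linear_combination (invPochhammer n * invPochhammer (N - c - n') *
    (invPochhammer n' * invPochhammer (N - n))) * h

theorem le_of_coeff_eulerTerm_mul {M N c n n' k : ℤ}
    (h : ((signedMonomial (N * M) 0 * eulerTerm N n) *
        (signedMonomial ((N - c) * (M + 2)) 0 * eulerTerm (N - c) n')).coeff k ≠ 0) :
    N * M + n * (n - 1) + (N - c) * (M + 2) + n' * (n' - 1) ≤ k := by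
  obtain ⟨p, hp⟩ := invPochhammer_mul n (N - n)
  obtain ⟨p', hp'⟩ := invPochhammer_mul n' (N - c - n')
  have : (signedMonomial (N * M) 0 * eulerTerm N n) *
      (signedMonomial ((N - c) * (M + 2)) 0 * eulerTerm (N - c) n') =
      signedMonomial (N * M + n * (n - 1) + (N - c) * (M + 2) + n' * (n' - 1)) (n + n') *
        ((p * p' : PowerSeries ℤ) : LaurentSeries ℤ) := by
    rw [eulerTerm, eulerTerm, hp, hp', PowerSeries.coe_mul]
    have : signedMonomial (N * M) 0 * signedMonomial (n * (n - 1)) n *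
        (signedMonomial ((N - c) * (M + 2)) 0 * signedMonomial (n' * (n' - 1)) n') =
        signedMonomial (N * M + n * (n - 1) + (N - c) * (M + 2) + n' * (n' - 1)) (n + n') := by
      simp only [signedMonomial_mul]
      congr 1 <;> ring
    rw [← this]
    ring
  rw [this] at h
  exact le_of_coeff_signedMonomial_mul _ _ _ _ h

/-- The change of variables in the quadratic identity. -/
def quadEquiv (c : ℤ) : ℤ × ℤ × ℤ ≃ ℤ × ℤ × ℤ where
  toFun x := (x.1 - c - x.2.1 - x.2.2, x.2)
  invFun x := (x.1 + c + x.2.1 + x.2.2, x.2)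
  left_inv x := by ext <;> [(simp; ring); simp; simp]
  right_inv x := by ext <;> [(simp; ring); simp; simp]

/-- A nonzero term has `0 ≤ n ≤ N` and `0 ≤ n' ≤ N - c`, and for `M ≥ 0` its exponent is at least `2
(N - c)`. This bounds `N` and then `n` and `n'`. The sign of `M` enters here, which is why the
quadratic identity is first proved for `m ≤ 0`. -/
theorem eulerTerm_mul_summable {M : ℤ} (hM : 0 ≤ M) (c : ℤ) :
    LaurentSummable fun x : ℤ × ℤ × ℤ => (signedMonomial (x.1 * M) 0 * eulerTerm x.1 x.2.1) *
        (signedMonomial ((x.1 - c) * (M + 2)) 0 * eulerTerm (x.1 - c) x.2.2) := by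
  refine laurentSummable_of_le (fun x => x.1 * M + x.2.1 * (x.2.1 - 1) + (x.1 - c) * (M + 2) +
    x.2.2 * (x.2.2 - 1)) (fun x k h => le_of_coeff_eulerTerm_mul h) fun D => ?_
  refine ((Set.finite_Icc 0 (|c| + |D|)).prod
    ((Set.finite_Icc 0 (|c| + |D|)).prod (Set.finite_Icc 0 (|c| + |D| + |c|)))).subset ?_
  rintro ⟨N, n, n'⟩ ⟨h0, h⟩
  have h1 : 0 ≤ n ∧ n ≤ N := by
    by_contra hc
    rw [not_and_or, not_le, not_le] at hc
    exact h0 (by simp [eulerTerm_of_neg hc])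
  have h2 : 0 ≤ n' ∧ n' ≤ N - c := by
    by_contra hc
    rw [not_and_or, not_le, not_le] at hc
    exact h0 (by simp [eulerTerm_of_neg hc])
  have key : ∀ a : ℤ, 0 ≤ a → 0 ≤ a * (a - 1) := fun a ha => by
    rcases ha.eq_or_lt with rfl | ha
    · simp
    · exact mul_nonneg ha.le (by omega)
  have k1 := key n h1.1
  have k2 := key n' h2.1
  have k3 : 0 ≤ N * M := mul_nonneg (h1.1.trans h1.2) hM
  have k4 : 0 ≤ (N - c) * M := mul_nonneg (h2.1.trans h2.2) hM
  have k5 : (N - c) * (M + 2) = (N - c) * M + 2 * (N - c) := by ring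
  dsimp only at h
  have a1 := le_abs_self c
  have a2 := le_abs_self D
  have a3 := neg_abs_le c
  have : N ≤ |c| + |D| := by omega
  refine ⟨⟨?_, ?_⟩, ⟨?_, ?_⟩, ⟨?_, ?_⟩⟩ <;> dsimp only <;> omega

/-- The quadratic identity of the tetrahedral index for `m ≤ 0`. -/
theorem tetIndex_quadratic_nonpos {M : ℤ} (hM : 0 ≤ M) (c : ℤ) :
    LaurentSummable (fun e : ℤ => signedMonomial (2 * e) 0 *
      (tetIndex (-M) e * tetIndex (-M) (e + c))) ∧
    laurentSum (fun e : ℤ => signedMonomial (2 * e) 0 *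
      (tetIndex (-M) e * tetIndex (-M) (e + c))) = if c = 0 then 1 else 0 := by
  set G : ℤ × ℤ × ℤ → LaurentSeries ℤ := fun x =>
    signedMonomial (2 * x.1) 0 * (tetTerm (-M) x.1 x.2.1 * tetTerm (-M) (x.1 + c) x.2.2) with hG
  have hGe : G ∘ quadEquiv c = fun x : ℤ × ℤ × ℤ =>
      (signedMonomial (x.1 * M) 0 * eulerTerm x.1 x.2.1) *
        (signedMonomial ((x.1 - c) * (M + 2)) 0 * eulerTerm (x.1 - c) x.2.2) := by
    funext x
    exact tetTerm_mul_tetTerm M c x.1 x.2.1 x.2.2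
  have hs : LaurentSummable G := by
    rw [← laurentSummable_comp_equiv (quadEquiv c), hGe]
    exact eulerTerm_mul_summable hM c
  have hfst : (fun e : ℤ => signedMonomial (2 * e) 0 *
      (tetIndex (-M) e * tetIndex (-M) (e + c))) = fun e => laurentSum fun b => G (e, b) := by
    funext e
    rw [tetIndex_eq, tetIndex_eq,
      ← (tetTerm_summable (-M) e).laurentSum_mul (tetTerm_summable (-M) (e + c)),
      ← ((tetTerm_summable (-M) e).mul (tetTerm_summable (-M) (e + c))).laurentSum_const_mul]
  rw [hfst]
  refine ⟨hs.fst, ?_⟩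
  rw [hs.laurentSum_prod, ← laurentSum_comp_equiv G (quadEquiv c), hGe,
    ← (eulerTerm_mul_summable hM c).laurentSum_prod]
  -- For fixed `N` the sums over `n` and `n'` are independent; their product vanishes unless `N = 0`
  -- and `N = c`.
  have hN : ∀ N : ℤ, (laurentSum fun b : ℤ × ℤ =>
      (signedMonomial (N * M) 0 * eulerTerm N b.1) *
        (signedMonomial ((N - c) * (M + 2)) 0 * eulerTerm (N - c) b.2)) =
      (signedMonomial (N * M) 0 * if N = 0 then 1 else 0) *
        (signedMonomial ((N - c) * (M + 2)) 0 * if N - c = 0 then 1 else 0) := by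
    intro N
    rw [((eulerTerm_summable N).const_mul _).laurentSum_mul
      ((eulerTerm_summable (N - c)).const_mul _), (eulerTerm_summable N).laurentSum_const_mul,
      (eulerTerm_summable (N - c)).laurentSum_const_mul, laurentSum_eulerTerm, laurentSum_eulerTerm]
  simp only [hN]
  rw [laurentSum_eq_single 0 fun N hN => by simp [hN]]
  by_cases hc : c = 0
  · simp [hc, signedMonomial_zero]
  · simp [hc]

/-- The quadratic identity of the tetrahedral index. -/
theorem tetIndex_quadratic (m c : ℤ) :
    LaurentSummable (fun e : ℤ => signedMonomial (2 * e) 0 * (tetIndex m e * tetIndex m (e + c))) ∧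
    laurentSum (fun e : ℤ => signedMonomial (2 * e) 0 * (tetIndex m e * tetIndex m (e + c))) =
      if c = 0 then 1 else 0 := by
  rcases le_total m 0 with h | h
  · have := tetIndex_quadratic_nonpos (neg_nonneg.2 h) c
    rwa [neg_neg] at this
  -- The symmetry is applied to both factors. It shifts `e` by `m`, and the two prefactors multiply
  -- to `q^m`, which is what turns `q^e` into `q^{e+m}`.
  · have key := tetIndex_quadratic_nonpos h c
    have he : (fun e : ℤ => signedMonomial (2 * e) 0 * (tetIndex m e * tetIndex m (e + c))) =
        (fun e : ℤ => signedMonomial (2 * e) 0 * (tetIndex (-m) e * tetIndex (-m) (e + c))) ∘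
          Equiv.addRight m := by
      funext e
      simp only [Function.comp_apply, Equiv.coe_addRight]
      rw [tetIndex_neg m e, tetIndex_neg m (e + c), show e + c + m = e + m + c by ring]
      have : signedMonomial (2 * (e + m)) 0 =
          signedMonomial (2 * e) 0 * (negHalfPow m * negHalfPow m) := by
        simp only [negHalfPow_eq, signedMonomial_mul]
        exact signedMonomial_eq _ _ _ _ (by ring) ⟨-m, by ring⟩
      rw [this]
      ring
    rw [he, laurentSummable_comp_equiv, laurentSum_comp_equiv]
    exact key

/-- The sum over the multiples of the new edge solution of a 0-2 move. -/
theorem tetIndexJ_quadratic (a b c a' b' c' : ℤ) (h : c - b + (c' - b') = 0) :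
    LaurentSummable (fun e : ℤ => negHalfPow (2 * e) *
      (tetIndexJ (a + e) b c * tetIndexJ (a' + e) b' c')) ∧
    laurentSum (fun e : ℤ => negHalfPow (2 * e) *
      (tetIndexJ (a + e) b c * tetIndexJ (a' + e) b' c')) =
      if a - b = a' - c' then negHalfPow (b - c' - 2 * a) else 0 := by
  obtain ⟨hs, hq⟩ := tetIndex_quadratic (b - c) (a' - c' - (a - b))
  have he : (fun e : ℤ => negHalfPow (2 * e) *
      (tetIndexJ (a + e) b c * tetIndexJ (a' + e) b' c')) =
      fun e : ℤ => negHalfPow (b - c' - 2 * a) *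
        ((fun e : ℤ => signedMonomial (2 * e) 0 * (tetIndex (b - c) e *
          tetIndex (b - c) (e + (a' - c' - (a - b))))) ∘ Equiv.addRight (a - b)) e := by
    funext e
    simp only [Function.comp_apply, Equiv.coe_addRight, tetIndexJ]
    -- The hypothesis says `b' - c' = -(b - c)`, so the symmetry gives both factors the same first
    -- argument.
    rw [tetIndex_neg (b' - c') (a' + e - b'), show -(b' - c') = b - c by omega,
      show a + e - b = e + (a - b) by ring,
      show a' + e - b' + (b' - c') = e + (a - b) + (a' - c' - (a - b)) by ring]
    have : negHalfPow (2 * e) * (negHalfPow (-b) * (negHalfPow (-b') * negHalfPow (b' - c'))) =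
        negHalfPow (b - c' - 2 * a) * signedMonomial (2 * (e + (a - b))) 0 := by
      simp only [negHalfPow_eq, signedMonomial_mul]
      refine signedMonomial_eq _ _ _ _ (by ring) ⟨e + a - b, by ring⟩
    linear_combination (tetIndex (b - c) (e + (a - b)) *
      tetIndex (b - c) (e + (a - b) + (a' - c' - (a - b)))) * this
  have hs' := hs.comp_injective (Equiv.addRight (a - b)).injective
  rw [he]
  refine ⟨hs'.const_mul _, ?_⟩
  rw [hs'.laurentSum_const_mul, laurentSum_comp_equiv, hq]
  by_cases hc : a - b = a' - c'
  · rw [if_pos hc, if_pos (by omega), mul_one]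
  · rw [if_neg hc, if_neg (by omega), mul_zero]

end Index3D

namespace Index3D

/-! ## Oriented edges and sides of a tetrahedron -/

theorem mate_ne : ∀ (k : Fin 3) (v : Fin 4), mate k v ≠ v := by decide

theorem quadOf_mate : ∀ (k : Fin 3) (v : Fin 4), quadOf v (mate k v) = k := by decide

theorem quadOf_comm : ∀ v w : Fin 4, quadOf v w = quadOf w v := by decide

theorem mate_injective : ∀ (v : Fin 4) (k l : Fin 3), mate k v = mate l v → k = l := by decide

theorem fin3_add_one_ne : ∀ k : Fin 3, k + 1 ≠ k := by decide

theorem fin3_add_two_add_one : ∀ k : Fin 3, k + 2 + 1 = k := by decide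

theorem fin3_add_one_add_two : ∀ k : Fin 3, k + 1 + 2 = k := by decide

theorem sum_mates {M : Type*} [AddCommMonoid M] (h : Fin 4 → M) (k : Fin 3) (v : Fin 4) :
    ∑ w, h w = h v + h (mate k v) + h (mate (k + 1) v) + h (mate (k + 2) v) := by
  rw [Fin.sum_univ_four]
  fin_cases k <;> fin_cases v <;> simp (decide := true) [mate, Equiv.swap_apply_def] <;> abel

/-- The quad types of the edges at a vertex, mapped by an odd permutation, reverse their cyclic
order. -/
theorem quadOf_odd (π : Equiv.Perm (Fin 4)) (hπ : Equiv.Perm.sign π = -1) (k : Fin 3) (v : Fin 4) :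
    quadOf (π v) (π (mate (k + 1) v)) = quadOf (π v) (π (mate k v)) + 2 := by
  revert π k v
  decide +kernel

variable {ι : Type*}

/-- The oriented edge of `σ` from `x` to `y`, and also the side near `x` in the face opposite
`y`. -/
def edge (σ : ι) (x y : Fin 4) : Corner ι := (σ, x, quadOf x y)

theorem edge_mate (σ : ι) (v : Fin 4) (k : Fin 3) : edge σ v (mate k v) = (σ, v, k) := by
  rw [edge, quadOf_mate]

theorem corner_eq_edge (c : Corner ι) : c = edge c.1 c.2.1 (mate c.2.2 c.2.1) := by
  rw [edge_mate]

theorem edge_inj {σ τ : ι} {x y x' y' : Fin 4} (h : x ≠ y) (h' : x' ≠ y') :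
    edge σ x y = edge τ x' y' ↔ σ = τ ∧ x = x' ∧ y = y' := by
  constructor
  · intro he
    obtain ⟨h1, h2⟩ := Prod.mk.inj he
    obtain ⟨h2, h3⟩ := Prod.mk.inj h2
    refine ⟨h1, h2, ?_⟩
    rw [← mate_quadOf x y h, ← mate_quadOf x' y' h', h2, ← h3, h2]
  · rintro ⟨rfl, rfl, rfl⟩
    rfl

/-- The same edge with the opposite orientation. -/
def revEdge (c : Corner ι) : Corner ι := (c.1, mate c.2.2 c.2.1, c.2.2)

theorem revEdge_edge (σ : ι) {x y : Fin 4} (h : x ≠ y) : revEdge (edge σ x y) = edge σ y x := by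
  simp only [revEdge, edge, mate_quadOf x y h, quadOf_comm]

namespace Triangulation

variable (T : Triangulation ι)

theorem across_edge (σ : ι) {x y : Fin 4} (h : x ≠ y) (f : Fin 4) :
    T.across (edge σ x y) f = edge (T.adj σ f) (T.perm σ f x) (T.perm σ f y) := by
  simp only [across, edge, mate_quadOf x y h]

theorem sideGlue_edge (σ : ι) {x f : Fin 4} (h : x ≠ f) :
    T.sideGlue (edge σ x f) = edge (T.adj σ f) (T.perm σ f x) (T.perm σ f f) := by
  rw [sideGlue]
  have : mate (edge σ x f).2.2 (edge σ x f).2.1 = f := mate_quadOf x f h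
  rw [this, across_edge T σ h]

theorem sideGlue_sideGlue (c : Corner ι) : T.sideGlue (T.sideGlue c) = c := by
  rw [corner_eq_edge c]
  have h := (mate_ne c.2.2 c.2.1).symm
  rw [sideGlue_edge T _ h, sideGlue_edge T _ ((T.perm _ _).injective.ne h), T.adj_adj, T.perm_perm]
  simp

/-- A function on oriented edges of tetrahedra that only depends on the edge class. -/
def EdgeInvariant {X : Type*} (f : Corner ι → X) : Prop :=
  ∀ σ x y g, x ≠ y → g ≠ x → g ≠ y →
    f (edge (T.adj σ g) (T.perm σ g x) (T.perm σ g y)) = f (edge σ x y)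

variable {T} {X : Type*}

theorem EdgeInvariant.across {f : Corner ι → X} (hf : T.EdgeInvariant f) {c : Corner ι} {g : Fin 4}
    (h1 : g ≠ c.2.1) (h2 : g ≠ mate c.2.2 c.2.1) : f (T.across c g) = f c := by
  rw [corner_eq_edge c, across_edge T _ (mate_ne _ _).symm]
  exact hf _ _ _ _ (mate_ne _ _).symm h1 h2

/-- An invariant function as a function on edge classes. -/
def EdgeInvariant.lift {f : Corner ι → X} (hf : T.EdgeInvariant f) : T.OrEdge → X :=
  Quot.lift f <| by
    rintro c _ ⟨g, h1, h2, rfl⟩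
    exact (hf.across h1 h2).symm

theorem EdgeInvariant.lift_orEdge {f : Corner ι → X} (hf : T.EdgeInvariant f) (c : Corner ι) :
    hf.lift (T.orEdge c) = f c := rfl

variable (T) in
theorem edgeInvariant_orEdge : T.EdgeInvariant T.orEdge := by
  intro σ x y g h h1 h2
  rw [← across_edge T σ h]
  refine (Quot.sound ⟨g, h1, ?_, rfl⟩).symm
  rwa [show mate (edge σ x y).2.2 (edge σ x y).2.1 = y from mate_quadOf x y h]

theorem EdgeInvariant.comp {f : Corner ι → X} (hf : T.EdgeInvariant f) {Y : Type*} (F : X → Y) :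
    T.EdgeInvariant (F ∘ f) := fun σ x y g h h1 h2 => congrArg F (hf σ x y g h h1 h2)

theorem EdgeInvariant.eq_of_orEdge_eq {f : Corner ι → X} (hf : T.EdgeInvariant f) {c d : Corner ι}
    (h : T.orEdge c = T.orEdge d) : f c = f d := by
  rw [← hf.lift_orEdge, h, hf.lift_orEdge]

theorem EdgeInvariant.rev {f : Corner ι → X} (hf : T.EdgeInvariant f) :
    T.EdgeInvariant fun c => f (revEdge c) := by
  intro σ x y g h h1 h2
  simp only [revEdge_edge _ h, revEdge_edge _ ((T.perm σ g).injective.ne h)]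
  exact hf σ y x g h.symm h2 h1

theorem orEdge_revEdge {c d : Corner ι} (h : T.orEdge c = T.orEdge d) :
    T.orEdge (revEdge c) = T.orEdge (revEdge d) :=
  T.edgeInvariant_orEdge.rev.eq_of_orEdge_eq h

/-- The corner of a truncation triangle where a side begins. -/
def sideStart (c : Corner ι) : Corner ι := (c.1, c.2.1, c.2.2 + 1)

/-- The corner of a truncation triangle where a side ends. -/
def sideEnd (c : Corner ι) : Corner ι := (c.1, c.2.1, c.2.2 + 2)

theorem sideEnd_sideGlue (c : Corner ι) : sideEnd (T.sideGlue c) =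
    edge (T.adj c.1 (mate c.2.2 c.2.1)) (T.perm c.1 (mate c.2.2 c.2.1) c.2.1)
      (T.perm c.1 (mate c.2.2 c.2.1) (mate (c.2.2 + 1) c.2.1)) := by
  have := quadOf_odd _ (T.sign_perm c.1 (mate c.2.2 c.2.1)) c.2.2 c.2.1
  simp only [sideEnd, sideGlue, Triangulation.across, edge, this]

/-- Seen at an end of an edge, passing through a face containing the edge means crossing a side of
the truncation triangle at one of its two corners. Gluings reverse orientation, so they match the
start of a side with the end of the glued side. -/
theorem edgeInvariant_iff {f : Corner ι → X} :
    T.EdgeInvariant f ↔ ∀ c, f (sideEnd (T.sideGlue c)) = f (sideStart c) := by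
  constructor
  · intro hf c
    rw [sideEnd_sideGlue, hf _ _ _ _ (mate_ne _ _).symm (mate_ne _ _)
      fun h => fin3_add_one_ne _ (mate_injective _ _ _ h.symm), edge_mate]
    rfl
  · intro hf
    have hf' : ∀ c, f (sideStart (T.sideGlue c)) = f (sideEnd c) := fun c => by
      rw [← hf, sideGlue_sideGlue]
    have key : ∀ x g y : Fin 4, x ≠ y → g ≠ x → g ≠ y →
        quadOf x y = quadOf x g + 1 ∨ quadOf x y = quadOf x g + 2 := by decide
    intro σ x y g h h1 h2
    rcases key x g y h h1 h2 with hq | hq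
    · have e1 : sideStart (edge σ x g) = edge σ x y := by simp [sideStart, edge, hq]
      have e2 := sideEnd_sideGlue (T := T) (edge σ x g)
      have e3 : mate (edge σ x g).2.2 (edge σ x g).2.1 = g := mate_quadOf x g h1.symm
      have e4 : mate ((edge σ x g).2.2 + 1) (edge σ x g).2.1 = y := by
        simp only [edge, ← hq]
        exact mate_quadOf x y h
      rw [e3, e4] at e2
      rw [← e1, ← hf, e2]
      rfl
    · have e1 : sideEnd (edge σ x g) = edge σ x y := by simp [sideEnd, edge, hq]
      have hx := sideGlue_edge T σ h1.symm
      rw [← e1, ← hf']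
      congr 1
      have q3 := quadOf_odd _ (T.sign_perm σ g) (quadOf x g + 2) x
      rw [show quadOf x g + 2 + 1 = quadOf x g from fin3_add_two_add_one _, ← hq,
        mate_quadOf x g h1.symm, mate_quadOf x y h] at q3
      rw [hx]
      simp only [sideStart, edge, q3]
      rw [fin3_add_two_add_one]

theorem EdgeInvariant.sideEnd_glue {f : Corner ι → X} (hf : T.EdgeInvariant f) (c : Corner ι) :
    f (sideEnd (T.sideGlue c)) = f (sideStart c) := edgeInvariant_iff.1 hf c

theorem EdgeInvariant.sideStart_glue {f : Corner ι → X} (hf : T.EdgeInvariant f) (c : Corner ι) :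
    f (sideStart (T.sideGlue c)) = f (sideEnd c) := by
  rw [← hf.sideEnd_glue, sideGlue_sideGlue]

instance [Finite ι] : Finite T.OrEdge := Quot.finite _

/-! ### Pairings -/

/-- The shear parameters of a class, along the edges facing each quad. -/
def shear (S : ι → Fin 3 → ℤ) : ι → Fin 3 → ℤ := fun σ k => S σ (k + 2) - S σ (k + 1)

/-- The sum of the values of a function at the oriented edges facing each quad. -/
def edgeSum (f : Corner ι → ℤ) : ι → Fin 3 → ℤ := fun σ k => ∑ v, f (σ, v, k)

theorem sum_edgeSol [Fintype T.OrEdge] (F : T.OrEdge → ℤ) (σ : ι) (k : Fin 3) :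
    ∑ e, F e * T.edgeSol e σ k = edgeSum (fun c => F (T.orEdge c)) σ k := by
  classical
  simp only [edgeSol, edgeSum, Finset.mul_sum]
  rw [Finset.sum_comm]
  refine Finset.sum_congr rfl fun v _ => ?_
  simp

variable [Fintype ι]

/-- The standard pairing. -/
def dot (A S : ι → Fin 3 → ℤ) : ℤ := ∑ σ, ∑ k, A σ k * S σ k

theorem dot_add_right (A S S' : ι → Fin 3 → ℤ) : dot A (S + S') = dot A S + dot A S' := by
  simp [dot, mul_add, Finset.sum_add_distrib]

theorem dot_sub_left (A A' S : ι → Fin 3 → ℤ) : dot (A - A') S = dot A S - dot A' S := by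
  simp [dot, sub_mul, Finset.sum_sub_distrib]

theorem dot_smul_left (m : ℤ) (A S : ι → Fin 3 → ℤ) : dot (m • A) S = m * dot A S := by
  simp [dot, Finset.mul_sum, mul_assoc]

theorem dot_comm (A S : ι → Fin 3 → ℤ) : dot A S = dot S A := by
  simp [dot, mul_comm]

/-- The shear is the difference of the two cyclic shifts of the quad types, which are adjoint to one
another. The pairing `dot A (shear S)` is therefore skew: it is the Neumann-Zagier form. -/
theorem dot_shear (A S : ι → Fin 3 → ℤ) : dot A (shear S) = -dot (shear A) S := by
  simp only [dot, shear, ← Finset.sum_neg_distrib]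
  refine Finset.sum_congr rfl fun σ _ => ?_
  simp only [Fin.sum_univ_three, Fin.isValue, Fin.reduceAdd, zero_add]
  ring

theorem dot_const_shear (m : ι → ℤ) (S : ι → Fin 3 → ℤ) : dot (fun σ _ => m σ) (shear S) = 0 := by
  rw [dot_shear]
  simp [dot, shear]

/-- Invariant functions are combinations of indicator functions of edge classes. This form allows
the matching equations to be tested with any convenient invariant function. -/
theorem mem_Q_iff {S : ι → Fin 3 → ℤ} :
    S ∈ T.Q ↔ ∀ f : Corner ι → ℤ, T.EdgeInvariant f → dot (edgeSum f) (shear S) = 0 := by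
  classical
  have : Fintype T.OrEdge := Fintype.ofFinite _
  constructor
  · intro hS f hf
    have : edgeSum f = fun σ k => ∑ e, hf.lift e * T.edgeSol e σ k := by
      funext σ k
      exact (sum_edgeSol hf.lift σ k).symm
    rw [this]
    have hz : ∑ e, hf.lift e * (∑ σ, ∑ k, T.edgeSol e σ k * (S σ (k + 2) - S σ (k + 1))) = 0 :=
      Finset.sum_eq_zero fun e _ => by rw [hS e, mul_zero]
    rw [← hz]
    simp only [dot, shear, Finset.sum_mul, Finset.mul_sum]
    symm
    rw [Finset.sum_comm]
    refine Finset.sum_congr rfl fun σ _ => ?_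
    rw [Finset.sum_comm]
    refine Finset.sum_congr rfl fun k _ => Finset.sum_congr rfl fun e _ => ?_
    ring
  · intro h e
    exact h (fun c => if T.orEdge c = e then 1 else 0)
      (T.edgeInvariant_orEdge.comp fun x => if x = e then (1 : ℤ) else 0)

end Triangulation

end Index3D

namespace Index3D

namespace Triangulation

variable {ι : Type*} {T : Triangulation ι}

/-! ### Functions on sides modulo functions on triangles -/

/-- A function on sides which, up to a function on truncation triangles, takes the same values at
sides that are glued together. -/
def GlueBoundary (T : Triangulation ι) (R : Type*) [CommRing R] : Submodule R (Corner ι → R) where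
  carrier := {y | ∃ n : ι × Fin 4 → R, ∀ c : Corner ι,
    y c - n (c.1, c.2.1) = y (T.sideGlue c) - n ((T.sideGlue c).1, (T.sideGlue c).2.1)}
  zero_mem' := ⟨0, fun _ => rfl⟩
  add_mem' := by
    rintro y y' ⟨n, h⟩ ⟨n', h'⟩
    refine ⟨n + n', fun c => ?_⟩
    simp only [Pi.add_apply]
    linear_combination h c + h' c
  smul_mem' := by
    rintro r y ⟨n, h⟩
    refine ⟨r • n, fun c => ?_⟩
    simp only [Pi.smul_apply, smul_eq_mul]
    linear_combination r * h c

open Classical in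
theorem triangle_mem_glueBoundary (R : Type*) [CommRing R] (x : ι × Fin 4) :
    (∑ k : Fin 3, Pi.single (x.1, x.2, k) 1 : Corner ι → R) ∈ T.GlueBoundary R := by
  have h : ∀ c : Corner ι, (∑ k : Fin 3, Pi.single (x.1, x.2, k) 1 : Corner ι → R) c =
      if (c.1, c.2.1) = x then 1 else 0 := by
    rintro ⟨σ, v, k⟩
    obtain ⟨τ, w⟩ := x
    by_cases hx : (σ, v) = (τ, w)
    · obtain ⟨rfl, rfl⟩ := Prod.mk.inj hx
      simp [Finset.sum_apply, Pi.single_apply]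
    · rw [if_neg hx, Finset.sum_apply]
      refine Finset.sum_eq_zero fun l _ => Pi.single_eq_of_ne (fun he => hx ?_) _
      simp only [Prod.mk.injEq] at he
      rw [he.1, he.2.1]
  refine ⟨fun t => if t = x then 1 else 0, fun c => ?_⟩
  rw [h, h, sub_self, sub_self]

open Classical in
theorem glue_mem_glueBoundary (R : Type*) [CommRing R] (c : Corner ι) :
    (Pi.single c 1 + Pi.single (T.sideGlue c) 1 : Corner ι → R) ∈ T.GlueBoundary R := by
  refine ⟨0, fun d => ?_⟩
  have h1 : T.sideGlue d = c ↔ d = T.sideGlue c :=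
    ⟨fun h => by rw [← h, sideGlue_sideGlue], fun h => by rw [h, sideGlue_sideGlue]⟩
  have h2 : T.sideGlue d = T.sideGlue c ↔ d = c :=
    ⟨fun h => by rw [← T.sideGlue_sideGlue d, h, sideGlue_sideGlue], fun h => by rw [h]⟩
  simp only [Pi.add_apply, Pi.single_apply, h1, h2, Pi.zero_apply, sub_zero]
  exact add_comm _ _

/-- Of the two kinds of generators, the boundary of a triangle is a function of the triangle alone,
and the sum of two glued sides takes equal values on glued sides. -/
theorem mem_glueBoundary_of_mem {y : Corner ι →₀ ℤ} (hy : y ∈ T.peripheralBoundaries) :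
    (y : Corner ι → ℤ) ∈ T.GlueBoundary ℤ := by
  classical
  let φ : (Corner ι →₀ ℤ) →ₗ[ℤ] (Corner ι → ℤ) := Finsupp.lcoeFun
  change y ∈ (T.GlueBoundary ℤ).comap φ
  refine Submodule.span_le.2 ?_ hy
  rintro _ (⟨x, rfl⟩ | ⟨c, rfl⟩)
  · have := triangle_mem_glueBoundary (T := T) ℤ x
    simp only [Submodule.comap_coe, Set.mem_preimage, SetLike.mem_coe, map_sum]
    convert this using 3 with k
    simp [φ, Finsupp.single_eq_pi_single]
  · have := glue_mem_glueBoundary (T := T) ℤ c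
    simp only [Submodule.comap_coe, Set.mem_preimage, SetLike.mem_coe, map_add]
    convert this using 2 <;> simp [φ, Finsupp.single_eq_pi_single]

/-- Cocycles on the sides of the truncation triangles. -/
structure IsFlow (T : Triangulation ι) {M : Type*} [AddCommGroup M] (z : Corner ι → M) : Prop where
  glue : ∀ c, z (T.sideGlue c) = -z c
  sum : ∀ σ v, ∑ k, z (σ, v, k) = 0

/-- Duality over `ℚ`: a vector outside the subspace is separated from it by a functional. Its values
on the standard basis, with denominators cleared, form a flow, because the functional kills
triangles and pairs of glued sides. The factor `d` clears the denominators of the function on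
triangles. -/
theorem mem_glueBoundary_of_flow [Fintype ι] {y : Corner ι → ℤ}
    (h : ∀ z, T.IsFlow z → ∑ c, z c * y c = 0) :
    ∃ d : ℤ, d ≠ 0 ∧ d • y ∈ T.GlueBoundary ℤ := by
  classical
  have hQ : (fun c => (y c : ℚ)) ∈ T.GlueBoundary ℚ := by
    by_contra hy
    obtain ⟨f, hf, hle⟩ := Submodule.exists_le_ker_of_notMem hy
    let z : Corner ι → ℚ := fun c => f (Pi.single c 1)
    have hz : ∀ w : Corner ι → ℚ, f w = ∑ c, z c * w c := by
      intro w
      conv_lhs => rw [← Finset.univ_sum_single w]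
      rw [map_sum]
      refine Finset.sum_congr rfl fun c _ => ?_
      have : (Pi.single c (w c) : Corner ι → ℚ) = w c • Pi.single c 1 := by
        rw [← Pi.single_smul, smul_eq_mul, mul_one]
      rw [this, map_smul, smul_eq_mul, mul_comm]
    obtain ⟨b, hb⟩ := IsLocalization.exist_integer_multiples_of_finite (nonZeroDivisors ℤ) z
    choose m hm using hb
    have hm' : ∀ c, (m c : ℚ) = (b : ℤ) * z c := fun c => by
      have := hm c
      simpa using this
    have hflow : T.IsFlow m := by
      constructor
      · intro c
        have := hle (glue_mem_glueBoundary (T := T) ℚ c)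
        rw [LinearMap.mem_ker, map_add] at this
        have h' : (m (T.sideGlue c) : ℚ) = -(m c : ℚ) := by
          rw [hm', hm']
          change z c + z (T.sideGlue c) = 0 at this
          linear_combination ((b : ℤ) : ℚ) * this
        exact_mod_cast h'
      · intro σ v
        have := hle (triangle_mem_glueBoundary (T := T) ℚ (σ, v))
        rw [LinearMap.mem_ker, map_sum] at this
        have h' : (∑ k, (m (σ, v, k) : ℚ)) = 0 := by
          simp only [hm']
          rw [← Finset.mul_sum]
          exact mul_eq_zero_of_right _ this
        exact_mod_cast h'
    have h0 := h m hflow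
    have h1 : (((b : ℤ) : ℚ)) * ∑ c, z c * (y c : ℚ) = 0 := by
      rw [Finset.mul_sum]
      have : ((∑ c, m c * y c : ℤ) : ℚ) = 0 := by rw [h0]; rfl
      push_cast at this
      rw [← this]
      exact Finset.sum_congr rfl fun c _ => by rw [hm']; ring
    have hb0 : ((b : ℤ) : ℚ) ≠ 0 := by
      exact_mod_cast nonZeroDivisors.coe_ne_zero b
    rw [← hz] at h1
    exact hf ((mul_eq_zero.1 h1).resolve_left hb0)
  obtain ⟨n, hn⟩ := hQ
  obtain ⟨b, hb⟩ := IsLocalization.exist_integer_multiples_of_finite (nonZeroDivisors ℤ) n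
  choose m hm using hb
  have hm' : ∀ c, (m c : ℚ) = (b : ℤ) * n c := fun c => by
    have := hm c
    simpa using this
  refine ⟨b, nonZeroDivisors.coe_ne_zero b, m, fun c => ?_⟩
  have := hn c
  simp only [Pi.smul_apply, smul_eq_mul]
  have h' : (((b : ℤ) * y c - m (c.1, c.2.1) : ℤ) : ℚ) =
      (((b : ℤ) * y (T.sideGlue c) - m ((T.sideGlue c).1, (T.sideGlue c).2.1) : ℤ) : ℚ) := by
    push_cast
    rw [hm', hm']
    linear_combination ((b : ℤ) : ℚ) * this
  exact_mod_cast h'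

/-! ### Classes with trivial boundary are combinations of edge solutions -/

/-- If the face opposite `g` contains the edge `xz`, then the quad types facing `xz`, `xg`, `zg` are
all three. So the function at `xz` is the sum of the values of `y - n` at the sides near `x` and `z`
in that face, and these are preserved by the gluing of the face. -/
theorem edgeInvariant_of_glue {y : ι → Fin 3 → ℤ} {n : ι × Fin 4 → ℤ}
    (h : ∀ c : Corner ι, y c.1 c.2.2 - n (c.1, c.2.1) =
      y (T.sideGlue c).1 (T.sideGlue c).2.2 - n ((T.sideGlue c).1, (T.sideGlue c).2.1)) :
    T.EdgeInvariant fun c => ∑ k, y c.1 k - y c.1 c.2.2 - n (c.1, c.2.1) -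
      n (c.1, mate c.2.2 c.2.1) := by
  have key : ∀ x z g : Fin 4, x ≠ z → g ≠ x → g ≠ z → ∀ u : Fin 3 → ℤ,
      ∑ k, u k - u (quadOf x z) = u (quadOf x g) + u (quadOf z g) := by
    intro x z g h1 h2 h3 u
    have : ∀ x z g : Fin 4, x ≠ z → g ≠ x → g ≠ z →
        quadOf x z = quadOf x g + 1 ∧ quadOf z g = quadOf x g + 2 ∨
        quadOf x z = quadOf x g + 2 ∧ quadOf z g = quadOf x g + 1 := by decide
    have hs : ∀ k, ∑ l, u l = u k + u (k + 1) + u (k + 2) := by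
      intro k
      rw [Fin.sum_univ_three]
      fin_cases k <;> simp <;> ring
    rw [hs (quadOf x g)]
    rcases this x z g h1 h2 h3 with ⟨e1, e2⟩ | ⟨e1, e2⟩ <;> rw [e1, e2] <;> ring
  intro σ x z g h1 h2 h3
  have hx := h (edge σ x g)
  have hz := h (edge σ z g)
  rw [sideGlue_edge T σ h2.symm] at hx
  rw [sideGlue_edge T σ h3.symm] at hz
  have hπ := (T.perm σ g).injective
  simp only [edge, mate_quadOf x z h1, mate_quadOf _ _ (hπ.ne h1)] at hx hz ⊢
  rw [key x z g h1 h2 h3, key _ _ _ (hπ.ne h1) (hπ.ne h2) (hπ.ne h3)]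
  linear_combination -hx - hz

/-- Summed over the four oriented edges facing a quad, the invariant function of
`edgeInvariant_of_glue` is `-4 d U` plus a constant on each tetrahedron. Constants pair to zero with
shears, and invariant functions do so by the matching equations. -/
theorem dot_shear_eq_zero_of_glueBoundary [Fintype ι] {U S : ι → Fin 3 → ℤ} {d : ℤ} (hd : d ≠ 0)
    (hU : (d • fun c : Corner ι => U c.1 c.2.2) ∈ T.GlueBoundary ℤ) (hS : S ∈ T.Q) :
    dot U (shear S) = 0 := by
  obtain ⟨n, hn⟩ := hU
  have hinv := edgeInvariant_of_glue (T := T) (y := fun σ k => d * U σ k) (n := n) hn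
  have h0 := mem_Q_iff.1 hS _ hinv
  have he : edgeSum (fun c : Corner ι => ∑ k, d * U c.1 k - d * U c.1 c.2.2 - n (c.1, c.2.1) -
      n (c.1, mate c.2.2 c.2.1)) =
      (fun σ _ => 4 * ∑ k, d * U σ k - 2 * ∑ v, n (σ, v)) - (4 * d) • U := by
    funext σ k
    have h1 : ∑ v, n (σ, mate k v) = ∑ v, n (σ, v) := Equiv.sum_comp (mate k) fun v => n (σ, v)
    simp only [edgeSum, Pi.sub_apply, Pi.smul_apply, smul_eq_mul]
    rw [Finset.sum_sub_distrib, Finset.sum_sub_distrib, h1]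
    simp
    ring
  rw [he, dot_sub_left, dot_const_shear, dot_smul_left] at h0
  have : 4 * d ≠ 0 := by positivity
  simpa [this] using h0

/-! ### Edge sums are null-homologous -/

/-- The sum of an invariant function over the edges at an ideal vertex, both orientations taken. -/
def starSum (f : Corner ι → ℤ) (x : ι × Fin 4) : ℤ :=
  ∑ k, (f (x.1, x.2, k) + f (revEdge (x.1, x.2, k)))

/-- The edge `vg` occurs in both sums and cancels. What is left only involves edges of the face
opposite `g`, so it is unchanged by gluing this face. -/
theorem edgeSum_sub_starSum (f : Corner ι → ℤ) (σ : ι) (v g w x : Fin 4) (h1 : v ≠ g) (h2 : v ≠ w)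
    (h3 : v ≠ x) (h4 : g ≠ w) (h5 : g ≠ x) (h6 : w ≠ x) :
    edgeSum f σ (quadOf v g) - starSum f (σ, v) =
      f (edge σ w x) + f (edge σ x w) - f (edge σ v w) - f (edge σ w v) - f (edge σ v x) -
        f (edge σ x v) := by
  have key : ∀ v g w x : Fin 4, v ≠ g → v ≠ w → v ≠ x → g ≠ w → g ≠ x → w ≠ x →
      quadOf w x = quadOf v g ∧ mate (quadOf v g) v = g ∧
      (mate (quadOf v g + 1) v = w ∧ mate (quadOf v g + 2) v = x ∧
        quadOf v w = quadOf v g + 1 ∧ quadOf v x = quadOf v g + 2 ∨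
      mate (quadOf v g + 1) v = x ∧ mate (quadOf v g + 2) v = w ∧
        quadOf v x = quadOf v g + 1 ∧ quadOf v w = quadOf v g + 2) := by decide
  obtain ⟨e1, e2, h⟩ := key v g w x h1 h2 h3 h4 h5 h6
  have hs : ∀ (k : Fin 3) (u : Fin 3 → ℤ), ∑ l, u l = u k + u (k + 1) + u (k + 2) := by
    intro k u
    rw [Fin.sum_univ_three]
    fin_cases k <;> simp <;> ring
  rw [edgeSum, sum_mates _ (quadOf v g) v, starSum, hs (quadOf v g)]
  rcases h with ⟨e3, e4, e5, e6⟩ | ⟨e3, e4, e5, e6⟩ <;>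
    simp only [revEdge, e2, e3, e4, edge, e1, e5, e6, quadOf_comm x w, quadOf_comm w v,
      quadOf_comm x v] <;> ring

theorem EdgeInvariant.edgeSum_glue {f : Corner ι → ℤ} (hf : T.EdgeInvariant f) (c : Corner ι) :
    edgeSum f c.1 c.2.2 - starSum f (c.1, c.2.1) =
      edgeSum f (T.sideGlue c).1 (T.sideGlue c).2.2 -
        starSum f ((T.sideGlue c).1, (T.sideGlue c).2.1) := by
  obtain ⟨g, w, x, h1, h2, h3, h4, h5, h6, hg⟩ : ∃ g w x : Fin 4, c.2.1 ≠ g ∧ c.2.1 ≠ w ∧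
      c.2.1 ≠ x ∧ g ≠ w ∧ g ≠ x ∧ w ≠ x ∧ quadOf c.2.1 g = c.2.2 := by
    generalize c.2.1 = v
    generalize c.2.2 = k
    revert v k
    decide
  have hc : c = edge c.1 c.2.1 g := by rw [edge, hg]
  have hπ := (T.perm c.1 g).injective
  have e1 := edgeSum_sub_starSum f c.1 c.2.1 g w x h1 h2 h3 h4 h5 h6
  have e2 := edgeSum_sub_starSum f (T.adj c.1 g) _ _ _ _ (hπ.ne h1) (hπ.ne h2) (hπ.ne h3)
    (hπ.ne h4) (hπ.ne h5) (hπ.ne h6)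
  have hgl : T.sideGlue c = edge (T.adj c.1 g) (T.perm c.1 g c.2.1) (T.perm c.1 g g) := by
    conv_lhs => rw [hc]
    exact sideGlue_edge T _ h1
  rw [hgl]
  rw [hg] at e1
  rw [e1]
  simp only [edge] at e2 ⊢
  rw [e2]
  have k1 := hf c.1 w x g h6 h4 h5
  have k2 := hf c.1 x w g h6.symm h5 h4
  have k3 := hf c.1 c.2.1 w g h2 h1.symm h4
  have k4 := hf c.1 w c.2.1 g h2.symm h4 h1.symm
  have k5 := hf c.1 c.2.1 x g h3 h1.symm h5
  have k6 := hf c.1 x c.2.1 g h3.symm h5 h1.symm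
  simp only [edge] at k1 k2 k3 k4 k5 k6
  rw [k1, k2, k3, k4, k5, k6]

theorem sum_corner [Fintype ι] (f : Corner ι → ℤ) : ∑ c, f c = ∑ σ, ∑ k, ∑ v, f (σ, v, k) := by
  rw [Fintype.sum_prod_type]
  refine Finset.sum_congr rfl fun σ _ => ?_
  rw [Fintype.sum_prod_type, Finset.sum_comm]

/-- The orthogonality of edge equations. The edge sum of `h`, corrected by the star sums, is a
function `y` that agrees on glued sides. Summation by parts turns the pairing with `f` into `∑
(f(start) - f(end)) y` over all sides, and gluing exchanges starts and ends, so this is zero. -/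
theorem edgeSum_mem_Q [Fintype ι] {h : Corner ι → ℤ} (hh : T.EdgeInvariant h) :
    edgeSum h ∈ T.Q := by
  refine mem_Q_iff.2 fun f hf => ?_
  set y : Corner ι → ℤ := fun c => edgeSum h c.1 c.2.2 - starSum h (c.1, c.2.1) with hy
  have hyg : ∀ c, y (T.sideGlue c) = y c := fun c => (hh.edgeSum_glue c).symm
  have e1 : dot (edgeSum f) (shear (edgeSum h)) = ∑ c, f c * (y (sideEnd c) - y (sideStart c)) := by
    rw [sum_corner]
    simp only [dot, edgeSum, Finset.sum_mul]
    refine Finset.sum_congr rfl fun σ _ => Finset.sum_congr rfl fun k _ =>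
      Finset.sum_congr rfl fun v _ => ?_
    simp only [hy, shear, sideEnd, sideStart, edgeSum]
    ring
  have e2 : ∑ c, f c * y (sideEnd c) = ∑ c, f (sideStart c) * y c := by
    have hb : Function.Bijective (sideStart : Corner ι → Corner ι) :=
      Function.bijective_iff_has_inverse.2 ⟨sideEnd, fun c => by
        simp [sideStart, sideEnd, fin3_add_one_add_two], fun c => by
        simp [sideStart, sideEnd, fin3_add_two_add_one]⟩
    rw [← Equiv.sum_comp (Equiv.ofBijective _ hb) fun c => f c * y (sideEnd c)]
    refine Finset.sum_congr rfl fun c _ => ?_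
    simp [sideStart, sideEnd, fin3_add_one_add_two]
  have e3 : ∑ c, f c * y (sideStart c) = ∑ c, f (sideEnd c) * y c := by
    have hb : Function.Bijective (sideEnd : Corner ι → Corner ι) :=
      Function.bijective_iff_has_inverse.2 ⟨sideStart, fun c => by
        simp [sideStart, sideEnd, fin3_add_two_add_one], fun c => by
        simp [sideStart, sideEnd, fin3_add_one_add_two]⟩
    rw [← Equiv.sum_comp (Equiv.ofBijective _ hb) fun c => f c * y (sideStart c)]
    refine Finset.sum_congr rfl fun c _ => ?_
    simp [sideStart, sideEnd, fin3_add_two_add_one]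
  have e4 : ∑ c, f (sideStart c) * y c = ∑ c, f (sideEnd c) * y c := by
    rw [← Equiv.sum_comp (Function.Involutive.toPerm _ T.sideGlue_sideGlue)
      fun c => f (sideEnd c) * y c]
    refine Finset.sum_congr rfl fun c _ => ?_
    change f (sideStart c) * y c = f (sideEnd (T.sideGlue c)) * y (T.sideGlue c)
    rw [hyg, hf.sideEnd_glue]
  rw [e1]
  simp only [mul_sub, Finset.sum_sub_distrib]
  rw [e2, e3, e4, sub_self]

theorem edgeSol_eq_edgeSum [DecidableEq T.OrEdge] (e : T.OrEdge) :
    T.edgeSol e = edgeSum fun c => if T.orEdge c = e then 1 else 0 := by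
  funext σ k
  simp only [edgeSol, edgeSum]
  congr! 3

/-- `IsFormalEuler` prescribes `χ` on elements of `T.Q` that are edge solutions; membership makes
this clause applicable to every edge class. -/
theorem edgeSol_mem_Q [Fintype ι] (e : T.OrEdge) : T.edgeSol e ∈ T.Q := by
  classical
  rw [edgeSol_eq_edgeSum]
  exact edgeSum_mem_Q (T.edgeInvariant_orEdge.comp fun x => if x = e then (1 : ℤ) else 0)

end Triangulation

end Index3D

namespace Index3D

namespace Triangulation

variable {ι : Type*} {T : Triangulation ι}

/-! ### Normal curves -/

namespace NormalCurve

variable (γ : T.NormalCurve)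

/-- The truncation triangle of an arc. -/
def triangle (i : Fin (γ.len + 1)) : ι × Fin 4 := ((γ.corner i).1, (γ.corner i).2.1)

/-- The side on which an arc ends. -/
def outSide (i : Fin (γ.len + 1)) : Corner ι :=
  ((γ.corner i).1, (γ.corner i).2.1, (γ.corner i).2.2 + if γ.left i then 1 else 2)

/-- The side on which an arc begins. -/
def inSide (i : Fin (γ.len + 1)) : Corner ι :=
  ((γ.corner i).1, (γ.corner i).2.1, (γ.corner i).2.2 + if γ.left i then 2 else 1)

theorem sideGlue_outSide (i : Fin (γ.len + 1)) : T.sideGlue (γ.outSide i) = γ.inSide (i + 1) :=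
  γ.glue i

/-- The sign of an arc. -/
def arcSign (i : Fin (γ.len + 1)) : ℤ := if γ.left i then 1 else -1

theorem dot_sol [Fintype ι] (R : ι → Fin 3 → ℤ) :
    dot R γ.sol = ∑ i, γ.arcSign i * R (γ.corner i).1 (γ.corner i).2.2 := by
  classical
  simp only [dot, sol, Finset.mul_sum]
  rw [Finset.sum_congr rfl fun σ _ => Finset.sum_comm, Finset.sum_comm]
  refine Finset.sum_congr rfl fun i _ => ?_
  rw [Finset.sum_eq_single (γ.corner i).1, Finset.sum_eq_single (γ.corner i).2.2]
  · simp [arcSign, mul_comm]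
  · intro k _ hk
    simp [hk.symm]
  · simp
  · intro σ _ hσ
    simp [hσ.symm]
  · simp

/-- An arc with the corner `k` on its left runs from the side `k + 2` to the side `k + 1`, and the
shear of `U` at `k` is `U (k + 2) - U (k + 1)`; for arcs turning right both signs change. -/
theorem dot_shear_sol [Fintype ι] (U : ι → Fin 3 → ℤ) :
    dot (shear U) γ.sol = ∑ i, (U (γ.inSide i).1 (γ.inSide i).2.2 -
      U (γ.outSide i).1 (γ.outSide i).2.2) := by
  rw [dot_sol]
  refine Finset.sum_congr rfl fun i _ => ?_
  simp only [arcSign, inSide, outSide, shear]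
  cases γ.left i <;> simp

theorem sum_inSide {M : Type*} [AddCommMonoid M] (y : Corner ι → M) :
    ∑ i, y (γ.inSide i) = ∑ i, y (T.sideGlue (γ.outSide i)) := by
  rw [← Equiv.sum_comp (Equiv.addRight (1 : Fin (γ.len + 1))) fun i => y (γ.inSide i)]
  refine Finset.sum_congr rfl fun i _ => ?_
  rw [sideGlue_outSide]
  rfl

/-- By `edgeSum_glue`, the change of an edge sum across a crossed side is the change of the star sum
from one triangle to the next. These changes telescope around the closed curve. -/
theorem sol_mem_Q [Fintype ι] : γ.sol ∈ T.Q := by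
  refine mem_Q_iff.2 fun f hf => ?_
  rw [dot_shear, dot_shear_sol, neg_eq_zero, Finset.sum_sub_distrib,
    sum_inSide γ fun c => edgeSum f c.1 c.2.2, ← Finset.sum_sub_distrib]
  have h1 : ∀ i, edgeSum f (T.sideGlue (γ.outSide i)).1 (T.sideGlue (γ.outSide i)).2.2 -
      edgeSum f (γ.outSide i).1 (γ.outSide i).2.2 =
      starSum f (γ.triangle (i + 1)) - starSum f (γ.triangle i) := by
    intro i
    have := hf.edgeSum_glue (γ.outSide i)
    rw [sideGlue_outSide] at this ⊢
    simp only [triangle]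
    simp only [inSide, outSide] at this ⊢
    linear_combination -this
  simp only [h1, Finset.sum_sub_distrib]
  rw [sub_eq_zero]
  exact Equiv.sum_comp (Equiv.addRight (1 : Fin (γ.len + 1))) fun i => starSum f (γ.triangle i)

theorem chain_apply (c : Corner ι) [DecidableEq (Corner ι)] :
    γ.chain c = ∑ i, if γ.left i = true ∧ γ.corner i = c then 1 else 0 := by
  rw [chain, Finsupp.finsetSum_apply]
  refine Finset.sum_congr rfl fun i _ => ?_
  cases γ.left i <;> simp [Finsupp.single_apply]

open Classical in
/-- The sum of the signs of the arcs around a corner. -/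
noncomputable def winding (c : Corner ι) : ℤ := ∑ i, if γ.corner i = c then γ.arcSign i else 0

open Classical in
/-- The number of arcs in a truncation triangle with their corner on the left. -/
noncomputable def leftCount (x : ι × Fin 4) : ℤ :=
  ∑ i, if γ.left i = true ∧ γ.triangle i = x then 1 else 0

theorem edgeSum_winding : edgeSum γ.winding = γ.sol := by
  classical
  funext σ k
  simp only [edgeSum, winding, sol]
  rw [Finset.sum_comm]
  refine Finset.sum_congr rfl fun i _ => ?_
  by_cases h : (γ.corner i).1 = σ ∧ (γ.corner i).2.2 = k
  · obtain ⟨rfl, rfl⟩ := h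
    rw [Finset.sum_eq_single (γ.corner i).2.1]
    · simp [arcSign]
    · intro v _ hv
      rw [if_neg]
      intro he
      exact hv (congrArg (fun c : Corner ι => c.2.1) he).symm
    · simp
  · rw [if_neg h]
    refine Finset.sum_eq_zero fun v _ => if_neg fun he => h ?_
    rw [he]
    exact ⟨rfl, rfl⟩

/-- Checked arc by arc. Together with `winding_sideEnd` this compares the winding numbers at the two
ends of a side with the crossings of that side. The crossings out through a side are the crossings
in through the glued side, so they drop out when the two identities are combined. -/
theorem winding_sideStart [DecidableEq (Corner ι)] (c : Corner ι) :
    γ.winding (sideStart c) - γ.leftCount (c.1, c.2.1) =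
      -γ.chain c - ∑ i, if γ.outSide i = c then 1 else 0 := by
  classical
  rw [chain_apply, winding, leftCount, ← Finset.sum_sub_distrib, ← Finset.sum_neg_distrib,
    ← Finset.sum_sub_distrib]
  refine Finset.sum_congr rfl fun i _ => ?_
  obtain ⟨σ, v, k⟩ := c
  rcases hc : γ.corner i with ⟨τ, w, l⟩
  simp only [sideStart, outSide, triangle, arcSign, hc, Prod.mk.injEq]
  by_cases h1 : τ = σ
  · by_cases h2 : w = v
    · simp only [h1, h2, true_and]
      clear hc
      cases γ.left i <;> revert k l <;> decide
    · simp [h2]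
  · simp [h1]

theorem winding_sideEnd [DecidableEq (Corner ι)] (c : Corner ι) :
    γ.winding (sideEnd c) - γ.leftCount (c.1, c.2.1) =
      -γ.chain c - ∑ i, if γ.inSide i = c then 1 else 0 := by
  classical
  rw [chain_apply, winding, leftCount, ← Finset.sum_sub_distrib, ← Finset.sum_neg_distrib,
    ← Finset.sum_sub_distrib]
  refine Finset.sum_congr rfl fun i _ => ?_
  obtain ⟨σ, v, k⟩ := c
  rcases hc : γ.corner i with ⟨τ, w, l⟩
  simp only [sideEnd, inSide, triangle, arcSign, hc, Prod.mk.injEq]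
  by_cases h1 : τ = σ
  · by_cases h2 : w = v
    · simp only [h1, h2, true_and]
      clear hc
      cases γ.left i <;> revert k l <;> decide
    · simp [h2]
  · simp [h1]

/-- The solution of a null-homologous curve is a combination of edge solutions and tetrahedral
solutions. -/
theorem exists_of_not_essential (h : ¬ γ.Essential) : ∃ g : Corner ι → ℤ, T.EdgeInvariant g ∧
    ∃ m : ι → ℤ, γ.sol = fun σ k => edgeSum g σ k - m σ := by
  classical
  obtain ⟨n, hn⟩ := mem_glueBoundary_of_mem (not_not.1 h)
  -- The winding numbers fail to be invariant by the chain of the curve and by a correction per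
  -- triangle. The function `n`, which exhibits the chain as a boundary, compensates the former and
  -- `leftCount` the latter.
  refine ⟨fun c => n (c.1, c.2.1) + γ.winding c - γ.leftCount (c.1, c.2.1), ?_,
    fun σ => ∑ v, (n (σ, v) - γ.leftCount (σ, v)), ?_⟩
  · refine edgeInvariant_iff.2 fun c => ?_
    have h1 := γ.winding_sideStart c
    have h2 := γ.winding_sideEnd (T.sideGlue c)
    have h3 : (∑ i, if γ.inSide i = T.sideGlue c then (1 : ℤ) else 0) =
        ∑ i, if γ.outSide i = c then 1 else 0 := by
      rw [γ.sum_inSide fun d => if d = T.sideGlue c then (1 : ℤ) else 0]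
      refine Finset.sum_congr rfl fun i _ => ?_
      congr 1
      refine propext ⟨fun e => ?_, fun e => by rw [e]⟩
      rw [← T.sideGlue_sideGlue (γ.outSide i), e, sideGlue_sideGlue]
    have h4 := hn c
    simp only [sideEnd, sideStart] at h1 h2 ⊢
    linear_combination h2 - h1 + h4 - h3
  · funext σ k
    rw [← γ.edgeSum_winding]
    simp only [edgeSum, Finset.sum_sub_distrib, Finset.sum_add_distrib]
    ring

end NormalCurve

/-! ### Circulations are sums of simple curves -/

/-- Follow the flow: a triangle entered through a side of positive value has a negative value on the
entry side, so some other side has a positive value. In the finite set of triangles this walk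
becomes periodic, and one minimal period visits no triangle twice. The disjointness conditions are
then vacuous, and the crossing points can all be midpoints. -/
theorem exists_normalCurve_of_flow [Finite ι] {z : Corner ι → ℤ} (hz : T.IsFlow z)
    (h0 : ∃ c, 0 < z c) : ∃ γ : T.NormalCurve, Function.Injective γ.triangle ∧
      ∀ i, 0 < z (γ.outSide i) := by
  classical
  let X := {t : ι × Fin 4 // ∃ k, 0 < z (t.1, t.2, k)}
  choose out hout using fun t : X => t.2
  have hnext : ∀ t : X, ∃ k, 0 < z ((T.sideGlue (t.1.1, t.1.2, out t)).1,
      (T.sideGlue (t.1.1, t.1.2, out t)).2.1, k) := by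
    intro t
    by_contra! hc
    have h1 := hz.glue (t.1.1, t.1.2, out t)
    have h2 := hz.sum (T.sideGlue (t.1.1, t.1.2, out t)).1 (T.sideGlue (t.1.1, t.1.2, out t)).2.1
    have h3 := hout t
    have h4 : ∑ k, z ((T.sideGlue (t.1.1, t.1.2, out t)).1,
        (T.sideGlue (t.1.1, t.1.2, out t)).2.1, k) < ∑ k : Fin 3, 0 := by
      refine Finset.sum_lt_sum (fun k _ => hc k)
        ⟨(T.sideGlue (t.1.1, t.1.2, out t)).2.2, Finset.mem_univ _, ?_⟩
      simp only [Prod.mk.eta]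
      omega
    simp only [Finset.sum_const_zero] at h4
    omega
  let f : X → X := fun t => ⟨((T.sideGlue (t.1.1, t.1.2, out t)).1,
    (T.sideGlue (t.1.1, t.1.2, out t)).2.1), hnext t⟩
  obtain ⟨c0, hc0⟩ := h0
  let t0 : X := ⟨(c0.1, c0.2.1), c0.2.2, hc0⟩
  obtain ⟨t, ht⟩ : ∃ t : X, t ∈ Function.periodicPts f := by
    obtain ⟨m, n, hmn, he⟩ := Finite.exists_ne_map_eq_of_infinite fun n : ℕ => f^[n] t0
    wlog hlt : m < n generalizing m n
    · exact this n m hmn.symm he.symm (by omega)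
    · refine ⟨f^[m] t0, n - m, by omega, ?_⟩
      rw [Function.IsPeriodicPt, Function.IsFixedPt, ← Function.iterate_add_apply,
        show n - m + m = n by omega]
      exact he.symm
  have hpos := Function.minimalPeriod_pos_of_mem_periodicPts ht
  obtain ⟨N, hN⟩ : ∃ N, Function.minimalPeriod f t = N + 1 :=
    ⟨Function.minimalPeriod f t - 1, by omega⟩
  let p : Fin (N + 1) → X := fun i => f^[i.val] t
  have hp : ∀ i, p (i + 1) = f (p i) := by
    intro i
    change f^[(i + 1).val] t = f (f^[i.val] t)
    rw [← Function.iterate_succ_apply' f, ← Function.iterate_mod_minimalPeriod_eq (n := i.val + 1),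
      hN, Fin.val_add, Fin.val_one', Nat.add_mod_mod]
  have hinj : Function.Injective p := by
    intro i j hij
    exact Fin.ext (Function.iterate_injOn_Iio_minimalPeriod
      (by rw [Set.mem_Iio, hN]; exact i.2) (by rw [Set.mem_Iio, hN]; exact j.2) hij)
  let kout : Fin (N + 1) → Fin 3 := fun i => out (p i)
  let entry : Fin (N + 1) → Corner ι := fun i =>
    T.sideGlue ((p (i - 1)).1.1, (p (i - 1)).1.2, kout (i - 1))
  have hentry : ∀ i, ((entry i).1, (entry i).2.1) = (p i).1 := by
    intro i
    have := hp (i - 1)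
    rw [sub_add_cancel] at this
    rw [this]
  have hne : ∀ i, (entry i).2.2 ≠ kout i := by
    intro i he
    have h1 : 0 < z ((p i).1.1, (p i).1.2, kout i) := hout (p i)
    have h2 : 0 < z ((p (i - 1)).1.1, (p (i - 1)).1.2, kout (i - 1)) := hout (p (i - 1))
    have h3 := hz.glue ((p (i - 1)).1.1, (p (i - 1)).1.2, kout (i - 1))
    change z (entry i) = _ at h3
    have h4 : entry i = ((p i).1.1, (p i).1.2, kout i) := by
      rw [← he, ← hentry i]
    rw [h4] at h3
    omega
  let left : Fin (N + 1) → Bool := fun i => decide ((entry i).2.2 = kout i + 1)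
  let corner : Fin (N + 1) → Corner ι := fun i =>
    ((p i).1.1, (p i).1.2, if left i then kout i + 2 else kout i + 1)
  have hcout : ∀ i, (corner i).2.2 + (if left i then 1 else 2) = kout i := by
    intro i
    simp only [corner]
    cases left i
    · simp [fin3_add_one_add_two]
    · simp [fin3_add_two_add_one]
  have hcin : ∀ i, (corner i).2.2 + (if left i then 2 else 1) = (entry i).2.2 := by
    intro i
    have key : ∀ a b : Fin 3, a ≠ b →
        (if decide (a = b + 1) then b + 2 else b + 1) +
          (if decide (a = b + 1) then 2 else 1) = a := by decide
    exact key _ _ (hne i)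
  have htri : ∀ i j, ((corner i).1, (corner i).2.1) = ((corner j).1, (corner j).2.1) → i = j :=
    fun i j h => hinj (Subtype.ext h)
  refine ⟨{
    len := N
    corner := corner
    left := left
    pos := fun _ => 1 / 2
    pos_mem := fun _ => by norm_num
    glue := fun i => ?_
    disjoint_same := fun i j hij h => absurd (htri i j (by rw [h])) hij
    disjoint_next := fun i j h => ?_ }, fun i j h => htri i j h, fun i => ?_⟩
  · rw [hcout, hcin]
    have h1 : entry (i + 1) = T.sideGlue ((p i).1.1, (p i).1.2, kout i) := by
      simp only [entry, add_sub_cancel_right]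
    have h2 := hentry (i + 1)
    change T.sideGlue ((p i).1.1, (p i).1.2, kout i) =
      ((p (i + 1)).1.1, (p (i + 1)).1.2, (entry (i + 1)).2.2)
    rw [← h1, ← h2]
  · have hij := htri i j (by rw [h])
    subst hij
    exact absurd (congrArg (fun c : Corner ι => c.2.2) h).symm (fin3_add_one_ne _)
  · simp only [NormalCurve.outSide, hcout]
    exact hout (p i)

theorem NormalCurve.outSide_injective (γ : T.NormalCurve) (h : Function.Injective γ.triangle) :
    Function.Injective γ.outSide := fun i j hij => h <| by
  simp only [NormalCurve.triangle]
  have h1 := congrArg (fun c : Corner ι => (c.1, c.2.1)) hij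
  exact h1

/-- Induction on the total absolute value of `z`: subtracting the unit flow along a curve that
follows the positive values of `z` strictly decreases it. A flow without positive values is zero,
since it changes sign under gluing. -/
theorem flow_pairing_eq_zero [Fintype ι] {y : Corner ι → ℤ}
    (hy : ∀ γ : T.NormalCurve, Function.Injective γ.triangle →
      ∑ i, (y (γ.outSide i) - y (T.sideGlue (γ.outSide i))) = 0)
    {z : Corner ι → ℤ} (hz : T.IsFlow z) : ∑ c, z c * y c = 0 := by
  classical
  induction hn : ∑ c, (z c).natAbs using Nat.strong_induction_on generalizing z with
  | _ n ih =>
    by_cases h0 : ∃ c, 0 < z c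
    · obtain ⟨γ, hγ, hpos⟩ := exists_normalCurve_of_flow hz h0
      have hinj := γ.outSide_injective hγ
      let u : Corner ι → ℤ := fun c => ∑ i, if γ.outSide i = c then 1 else 0
      have hu : ∀ c, u c = if ∃ i, γ.outSide i = c then 1 else 0 := by
        intro c
        split_ifs with h
        · obtain ⟨i, rfl⟩ := h
          simp only [u]
          rw [Finset.sum_eq_single i] <;> simp +contextual [hinj.eq_iff]
        · push Not at h
          exact Finset.sum_eq_zero fun i _ => if_neg (h i)
      have hsw : ∀ c d, T.sideGlue c = d ↔ c = T.sideGlue d := fun c d =>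
        ⟨fun h => by rw [← h, sideGlue_sideGlue], fun h => by rw [h, sideGlue_sideGlue]⟩
      have huin : ∀ c, u (T.sideGlue c) = ∑ i, if γ.inSide i = c then 1 else 0 := by
        intro c
        rw [γ.sum_inSide fun d => if d = c then (1 : ℤ) else 0]
        simp only [hsw, u]
      have htri : ∀ (w : Fin (γ.len + 1) → Corner ι), (∀ i, ((w i).1, (w i).2.1) = γ.triangle i) →
          ∀ σ v, (∑ k, ∑ i, if w i = (σ, v, k) then (1 : ℤ) else 0) =
            ∑ i, if γ.triangle i = (σ, v) then 1 else 0 := by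
        intro w hw σ v
        rw [Finset.sum_comm]
        refine Finset.sum_congr rfl fun i _ => ?_
        rw [← hw i]
        rcases w i with ⟨τ, x, l⟩
        by_cases he : τ = σ ∧ x = v
        · obtain ⟨rfl, rfl⟩ := he
          simp
        · rw [if_neg (by simpa using he)]
          refine Finset.sum_eq_zero fun k _ => if_neg fun h => he ?_
          simp only [Prod.mk.injEq] at h
          exact ⟨h.1, h.2.1⟩
      have hflow : T.IsFlow fun c => z c - (u c - u (T.sideGlue c)) := by
        constructor
        · intro c
          simp only [sideGlue_sideGlue, hz.glue]
          ring
        · intro σ v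
          simp only [Finset.sum_sub_distrib, huin, hz.sum]
          simp only [u]
          rw [htri γ.outSide (fun _ => rfl), htri γ.inSide (fun _ => rfl)]
          ring
      have hle : ∀ c, (z c - (u c - u (T.sideGlue c))).natAbs ≤ (z c).natAbs ∧
          ((∃ i, γ.outSide i = c) → (z c - (u c - u (T.sideGlue c))).natAbs < (z c).natAbs) := by
        intro c
        have h1 : (∃ i, γ.outSide i = c) → 0 < z c := by
          rintro ⟨i, rfl⟩
          exact hpos i
        have h2 : (∃ i, γ.outSide i = T.sideGlue c) → z c < 0 := by
          rintro ⟨i, hi⟩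
          have := hpos i
          rw [hi, hz.glue] at this
          omega
        rw [hu, hu]
        split_ifs with a b b
        · have := h1 a
          have := h2 b
          omega
        · have := h1 a
          omega
        · have := h2 b
          exact ⟨by omega, fun h => absurd h a⟩
        · exact ⟨by omega, fun h => absurd h a⟩
      have hlt : ∑ c, (z c - (u c - u (T.sideGlue c))).natAbs < n := by
        rw [← hn]
        exact Finset.sum_lt_sum (fun c _ => (hle c).1)
          ⟨γ.outSide 0, Finset.mem_univ _, (hle _).2 ⟨0, rfl⟩⟩
      have h3 := ih _ hlt hflow rfl
      have h4 : ∑ c, u c * y c = ∑ i, y (γ.outSide i) := by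
        simp only [u, Finset.sum_mul]
        rw [Finset.sum_comm]
        simp
      have h5 : ∑ c, u (T.sideGlue c) * y c = ∑ i, y (T.sideGlue (γ.outSide i)) := by
        rw [← γ.sum_inSide]
        simp only [huin, Finset.sum_mul]
        rw [Finset.sum_comm]
        simp
      have h6 := hy γ hγ
      rw [Finset.sum_sub_distrib, ← h4, ← h5] at h6
      simp only [sub_mul, Finset.sum_sub_distrib] at h3
      linarith
    · push Not at h0
      refine Finset.sum_eq_zero fun c _ => ?_
      have h1 := hz.glue c
      have h2 := h0 (T.sideGlue c)
      have h3 := h0 c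
      rw [show z c = 0 by omega, zero_mul]

end Triangulation

end Index3D

namespace Index3D

namespace Triangulation

variable {ι : Type*} [Fintype ι] {T : Triangulation ι}

/-! ### Spanning of the Q-normal classes -/

/-- The matching equations as a linear map. -/
noncomputable def matching (T : Triangulation ι) : (ι → Fin 3 → ℤ) →ₗ[ℤ] (T.OrEdge → ℤ) where
  toFun S e := dot (T.edgeSol e) (shear S)
  map_add' S S' := by
    funext e
    rw [Pi.add_apply, ← dot_add_right]
    congr 1
    funext σ k
    simp only [shear, Pi.add_apply]
    ring
  map_smul' r S := by
    funext e
    rw [Pi.smul_apply, RingHom.id_apply, smul_eq_mul, dot_comm _ (shear S), ← dot_smul_left,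
      dot_comm]
    congr 1
    funext σ k
    simp only [shear, Pi.smul_apply, smul_eq_mul]
    ring

theorem mem_Q_iff_matching {S : ι → Fin 3 → ℤ} : S ∈ T.Q ↔ T.matching S = 0 :=
  ⟨fun h => funext fun e => h e, fun h e => congrFun h e⟩

/-- The image of the matching map lies in a free `ℤ`-module of finite rank, so it is projective. Its
kernel `Q` is therefore a direct summand, and functionals extend integrally to the whole lattice. -/
theorem exists_dot_eq (θ : T.Q →+ ℤ) : ∃ R : ι → Fin 3 → ℤ, ∀ S : T.Q, θ S = dot R S := by
  classical
  obtain ⟨s, hs⟩ := Module.projective_lifting_property T.matching.rangeRestrict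
    (LinearMap.id : LinearMap.range T.matching →ₗ[ℤ] _) T.matching.surjective_rangeRestrict
  let ρ : (ι → Fin 3 → ℤ) →+ T.Q :=
    ((LinearMap.id - s.comp T.matching.rangeRestrict).toAddMonoidHom).codRestrict T.Q <| by
      intro S
      rw [mem_Q_iff_matching]
      have h1 := LinearMap.congr_fun hs (T.matching.rangeRestrict S)
      have h2 := congrArg Subtype.val h1
      simp only [LinearMap.comp_apply, LinearMap.id_apply, LinearMap.codRestrict_apply] at h2
      simp only [LinearMap.toAddMonoidHom_coe, LinearMap.sub_apply, LinearMap.id_apply,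
        LinearMap.comp_apply, map_sub]
      rw [sub_eq_zero]
      exact h2.symm
  have hρ : ∀ S : T.Q, ρ S = S := by
    intro S
    apply Subtype.ext
    have h0 : T.matching.rangeRestrict S = 0 := Subtype.ext (mem_Q_iff_matching.1 S.2)
    change (S : ι → Fin 3 → ℤ) - s (T.matching.rangeRestrict S) = S
    rw [h0, map_zero, sub_zero]
  refine ⟨fun σ k => θ (ρ (Pi.single σ (Pi.single k 1))), fun S => ?_⟩
  have hS : (S : ι → Fin 3 → ℤ) = ∑ σ, ∑ k, S.1 σ k • Pi.single σ (Pi.single k (1 : ℤ)) := by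
    funext τ l
    simp only [Finset.sum_apply, Pi.smul_apply]
    rw [Finset.sum_eq_single τ, Finset.sum_eq_single l]
    · simp
    · intro k _ hk
      simp [Pi.single_eq_of_ne hk.symm]
    · simp
    · intro σ _ hσ
      simp [Pi.single_eq_of_ne hσ.symm]
    · simp
  conv_lhs => rw [← hρ S, hS]
  simp only [map_sum, map_zsmul, dot, smul_eq_mul, mul_comm]

/-- The Q-normal classes are rationally spanned by the edge solutions, the tetrahedral solutions
and the solutions of essential normal curves that meet each truncation triangle at most once. -/
theorem eq_zero_of_solutions (θ : T.Q →+ ℤ)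
    (hedge : ∀ (e : T.OrEdge) (S : T.Q), (S : ι → Fin 3 → ℤ) = T.edgeSol e → θ S = 0)
    (htet : ∀ σ, θ (T.tetSol σ) = 0)
    (hcurve : ∀ γ : T.NormalCurve, Function.Injective γ.triangle → γ.Essential →
      ∀ S : T.Q, (S : ι → Fin 3 → ℤ) = γ.sol → θ S = 0) : θ = 0 := by
  classical
  have : Fintype T.OrEdge := Fintype.ofFinite _
  obtain ⟨R, hR⟩ := exists_dot_eq θ
  have hsum : ∀ σ, R σ 0 + R σ 1 + R σ 2 = 0 := by
    intro σ
    have h1 := htet σ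
    rw [hR, dot, Finset.sum_eq_single σ] at h1
    · simpa [tetSol, Fin.sum_univ_three] using h1
    · intro τ _ hτ
      simp [tetSol, hτ]
    · simp
  -- The vanishing on tetrahedral solutions means that the three coordinates of `R` in each
  -- tetrahedron sum to zero, and such triples are exactly the shears.
  obtain ⟨U, rfl⟩ : ∃ U, shear U = R := by
    refine ⟨fun σ => ![0, R σ 2, -R σ 1], ?_⟩
    funext σ k
    have := hsum σ
    fin_cases k
    · simp [shear]
      omega
    · simp [shear]
    · simp [shear]
  have hE : ∀ f : Corner ι → ℤ, T.EdgeInvariant f → dot (shear U) (edgeSum f) = 0 := by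
    intro f hf
    have h1 : edgeSum f = fun σ k => ∑ e, hf.lift e * T.edgeSol e σ k := by
      funext σ k
      exact (sum_edgeSol hf.lift σ k).symm
    have h2 : ∀ e, dot (shear U) (T.edgeSol e) = 0 := fun e => by
      rw [← hedge e ⟨_, T.edgeSol_mem_Q e⟩ rfl, hR]
    have h3 : (⟨_, edgeSum_mem_Q hf⟩ : T.Q) = ∑ e, hf.lift e • ⟨_, T.edgeSol_mem_Q e⟩ := by
      apply Subtype.ext
      rw [AddSubgroup.val_finsetSum]
      simp only [AddSubgroup.coe_zsmul]
      rw [h1]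
      funext σ k
      simp [Finset.sum_apply]
    have h4 := hR ⟨_, edgeSum_mem_Q hf⟩
    rw [h3, map_sum] at h4
    rw [← h3] at h4
    rw [← h4]
    exact Finset.sum_eq_zero fun e _ => by rw [map_zsmul, hR, h2, smul_zero]
  -- Solutions of inessential curves are combinations of edge and tetrahedral solutions, so the
  -- functional vanishes on them as well.
  have hγ : ∀ γ : T.NormalCurve, Function.Injective γ.triangle → dot (shear U) γ.sol = 0 := by
    intro γ hinj
    by_cases hess : γ.Essential
    · rw [← hcurve γ hinj hess ⟨_, γ.sol_mem_Q⟩ rfl, hR]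
    · obtain ⟨g, hg, m, hm⟩ := γ.exists_of_not_essential hess
      have : γ.sol + (fun σ _ => m σ) = edgeSum g := by
        rw [hm]
        funext σ k
        simp
      have h1 := hE g hg
      rw [← this, dot_add_right, dot_comm _ fun σ _ => m σ, dot_const_shear, add_zero] at h1
      exact h1
  -- All periods of `U` along curves vanish, hence so does its pairing with every flow; a multiple
  -- of `U` then has a potential.
  obtain ⟨d, hd, hU⟩ := mem_glueBoundary_of_flow (T := T) (y := fun c => U c.1 c.2.2)
    fun z hz => flow_pairing_eq_zero (fun γ hinj => by
      have h1 := hγ γ hinj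
      rw [γ.dot_shear_sol, Finset.sum_sub_distrib, γ.sum_inSide fun c => U c.1 c.2.2] at h1
      rw [Finset.sum_sub_distrib]
      linarith) hz
  ext S
  have := dot_shear_eq_zero_of_glueBoundary hd hU S.2
  rw [dot_shear, neg_eq_zero] at this
  rw [hR, this]
  rfl

end Triangulation

end Index3D

namespace Index3D

namespace Triangulation

variable {ι : Type*} {T : Triangulation ι}

/-! ## Edge classes after a 0-2 move -/

theorem perm_inv_apply {α : Type*} (π : Equiv.Perm α) (x : α) : π⁻¹ (π x) = x :=
  π.symm_apply_apply x

namespace ZeroTwoSite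

variable (s : T.ZeroTwoSite)

theorem attach_not (t : Bool) (j : Fin 4) (hj : j = 2 ∨ j = 3) :
    s.attach (!t) j = (T.adj (s.target t j).1 (s.target t j).2,
      T.perm (s.target t j).1 (s.target t j).2 * (s.attach t j).2 * Equiv.swap 0 1) := by
  have key : ∀ j, j = 2 ∨ j = 3 → s.attach true j =
      (T.adj (s.target false j).1 (s.target false j).2,
      T.perm (s.target false j).1 (s.target false j).2 * (s.attach false j).2 * Equiv.swap 0 1) := by
    rintro j (rfl | rfl) <;> rfl
  cases t
  · exact key j hj
  · have h1 := key j hj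
    have h2 := s.target_true j hj
    simp only [faceGlue] at h2
    have h3 := T.adj_adj (s.target false j).1 (s.target false j).2
    have h4 := T.perm_perm (s.target false j).1 (s.target false j).2
    rw [h2]
    simp only [h1, h3, h4, Bool.not_true]
    refine Prod.ext rfl ?_
    simp only [mul_assoc, Equiv.swap_mul_self, mul_one, inv_mul_cancel_left]

theorem result_target (t : Bool) (j : Fin 4) (hj : j = 2 ∨ j = 3) :
    s.result.adj (Sum.inl (s.target t j).1) (s.target t j).2 = Sum.inr t ∧
      s.result.perm (Sum.inl (s.target t j).1) (s.target t j).2 = (s.attach t j).2⁻¹ :=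
  ⟨congrArg Prod.fst (s.newGlue_target t j hj), congrArg Prod.snd (s.newGlue_target t j hj)⟩

theorem result_old (σ : ι) (f : Fin 4) (h : ∀ t j, (j = 2 ∨ j = 3) → (σ, f) ≠ s.target t j) :
    s.result.adj (Sum.inl σ) f = Sum.inl (T.adj σ f) ∧
      s.result.perm (Sum.inl σ) f = T.perm σ f :=
  ⟨congrArg Prod.fst (s.newGlue_old σ f h), congrArg Prod.snd (s.newGlue_old σ f h)⟩

theorem result_new (t : Bool) (j : Fin 4) (hj : j = 2 ∨ j = 3) :
    s.result.adj (Sum.inr t) j = Sum.inl (s.attach t j).1 ∧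
      s.result.perm (Sum.inr t) j = (s.attach t j).2 :=
  ⟨congrArg Prod.fst (s.newGlue_new t j hj), congrArg Prod.snd (s.newGlue_new t j hj)⟩

theorem result_pillow (t : Bool) (j : Fin 4) (hj : j = 0 ∨ j = 1) :
    s.result.adj (Sum.inr t) j = Sum.inr (!t) ∧
      s.result.perm (Sum.inr t) j = Equiv.swap 0 1 :=
  ⟨congrArg Prod.fst (s.newGlue_pillow t j hj), congrArg Prod.snd (s.newGlue_pillow t j hj)⟩

/-- A corner of `T` as a corner of the triangulation after the move. -/
def inlCorner (c : Corner ι) : Corner (ι ⊕ Bool) := (Sum.inl c.1, c.2)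

variable {s} {X : Type*}

theorem edge_attach {f : Corner (ι ⊕ Bool) → X} (hf : s.result.EdgeInvariant f) (t : Bool)
    {j x y : Fin 4} (hj : j = 2 ∨ j = 3) (hxy : x ≠ y) (hx : j ≠ x) (hy : j ≠ y) :
    f (edge (Sum.inl (s.attach t j).1) ((s.attach t j).2 x) ((s.attach t j).2 y)) =
      f (edge (Sum.inr t) x y) := by
  have h := hf (Sum.inr t) x y j hxy hx hy
  rwa [(s.result_new t j hj).1, (s.result_new t j hj).2] at h

theorem edge_pillow {f : Corner (ι ⊕ Bool) → X} (hf : s.result.EdgeInvariant f) (t : Bool)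
    {j x y : Fin 4} (hj : j = 0 ∨ j = 1) (hxy : x ≠ y) (hx : j ≠ x) (hy : j ≠ y) :
    f (edge (Sum.inr (!t)) (Equiv.swap 0 1 x) (Equiv.swap 0 1 y)) = f (edge (Sum.inr t) x y) := by
  have h := hf (Sum.inr t) x y j hxy hx hy
  rwa [(s.result_pillow t j hj).1, (s.result_pillow t j hj).2] at h

theorem edge_attach_not {f : Corner ι → X} (hf : T.EdgeInvariant f) (t : Bool)
    {j x y : Fin 4} (hj : j = 2 ∨ j = 3) (hxy : x ≠ y) (hx : j ≠ x) (hy : j ≠ y) :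
    f (edge (s.attach (!t) j).1 ((s.attach (!t) j).2 (Equiv.swap 0 1 x))
      ((s.attach (!t) j).2 (Equiv.swap 0 1 y))) =
      f (edge (s.attach t j).1 ((s.attach t j).2 x) ((s.attach t j).2 y)) := by
  rw [s.attach_not t j hj]
  simp only [Equiv.Perm.mul_apply, Equiv.swap_apply_self]
  have hi := (s.attach t j).2.injective
  exact hf (s.attach t j).1 _ _ ((s.attach t j).2 j) (hi.ne hxy) (hi.ne hx) (hi.ne hy)

theorem swap_cases : ∀ x y : Fin 4, x ≠ y →
    (∃ h : Fin 4, (h = 0 ∨ h = 1) ∧ h ≠ x ∧ h ≠ y) ∨ (x = 0 ∧ y = 1) ∨ (x = 1 ∧ y = 0) := by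
  decide

theorem swap_ne (j x : Fin 4) (hj : j = 2 ∨ j = 3) (h : j ≠ x) : j ≠ Equiv.swap 0 1 x := by
  revert j x
  decide

/-- An invariant function after the move which takes the same values at both parts of the split
edge restricts to an invariant function. -/
theorem edgeInvariant_restrict {f : Corner (ι ⊕ Bool) → X} (hf : s.result.EdgeInvariant f)
    (h1 : f (edge (Sum.inr false) 0 1) = f (edge (Sum.inr true) 1 0))
    (h2 : f (edge (Sum.inr false) 1 0) = f (edge (Sum.inr true) 0 1)) :
    T.EdgeInvariant fun c => f (inlCorner c) := by
  intro σ x y g hxy hx hy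
  change f (edge (Sum.inl (T.adj σ g)) _ _) = f (edge (Sum.inl σ) _ _)
  by_cases h : ∃ t j, (j = 2 ∨ j = 3) ∧ (σ, g) = s.target t j
  · obtain ⟨t, j, hj, he⟩ := h
    obtain ⟨rfl, rfl⟩ := Prod.mk.inj he
    obtain ⟨x, rfl⟩ := (s.attach t j).2.surjective x
    obtain ⟨y, rfl⟩ := (s.attach t j).2.surjective y
    have hi := (s.attach t j).2.injective
    replace hxy := hi.ne_iff.1 hxy
    replace hx := hi.ne_iff.1 hx
    replace hy := hi.ne_iff.1 hy
    have e1 := edge_attach hf t hj hxy hx hy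
    have e2 := edge_attach hf (!t) hj ((Equiv.swap (0 : Fin 4) 1).injective.ne hxy)
      (swap_ne j x hj hx) (swap_ne j y hj hy)
    rw [s.attach_not t j hj] at e2
    simp only [Equiv.Perm.mul_apply, Equiv.swap_apply_self] at e2
    simp only [target] at e2 ⊢
    rw [e2, e1]
    -- An edge of a new tetrahedron other than `uv` lies in a pillow face, through which it is
    -- identified with its counterpart. The edge `uv` lies in none; here the assumed equality at the
    -- two parts is used.
    rcases swap_cases x y hxy with ⟨k, hk, hkx, hky⟩ | ⟨rfl, rfl⟩ | ⟨rfl, rfl⟩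
    · exact edge_pillow hf t hk hxy hkx hky
    · cases t <;> simp [h1, h2]
    · cases t <;> simp [h1, h2]
  · push Not at h
    have := hf (Sum.inl σ) x y g hxy hx hy
    rwa [(s.result_old σ g h).1, (s.result_old σ g h).2] at this

/-- The face of a new tetrahedron that contains an edge other than `w₁w₂` and is glued to a
tetrahedron of `T`. -/
def oldFace (x y : Fin 4) : Fin 4 := if x = 2 ∨ y = 2 then 3 else 2

theorem oldFace_spec : ∀ x y : Fin 4, x ≠ y → ¬ ((x = 2 ∨ x = 3) ∧ (y = 2 ∨ y = 3)) →
    (oldFace x y = 2 ∨ oldFace x y = 3) ∧ oldFace x y ≠ x ∧ oldFace x y ≠ y := by decide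

theorem eq_oldFace : ∀ j x y : Fin 4, (j = 2 ∨ j = 3) → x ≠ y → j ≠ x → j ≠ y →
    ¬ ((x = 2 ∨ x = 3) ∧ (y = 2 ∨ y = 3)) ∧
    (j = oldFace x y ∨ (x = 0 ∧ y = 1 ∨ x = 1 ∧ y = 0) ∧ j = 3 ∧ oldFace x y = 2) := by
  decide

theorem edgeInvariant_rotate {f : Corner ι → X} (hf : T.EdgeInvariant f)
    (φ : ι × Equiv.Perm (Fin 4)) (n : ℕ) :
    f (edge (T.rotate^[n] φ).1 ((T.rotate^[n] φ).2 0) ((T.rotate^[n] φ).2 1)) =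
      f (edge φ.1 (φ.2 0) (φ.2 1)) := by
  induction n with
  | zero => rfl
  | succ n ih =>
    rw [Function.iterate_succ_apply', ← ih]
    generalize T.rotate^[n] φ = ψ
    have hi := ψ.2.injective
    have := hf ψ.1 (ψ.2 0) (ψ.2 1) (ψ.2 2) (hi.ne (by decide)) (hi.ne (by decide))
      (hi.ne (by decide))
    rw [← this]
    simp only [rotate, Equiv.Perm.mul_apply]
    rfl

/-- The rotation from `F₁` to `F₂` keeps the edge `uv`. Hence the choice made in `oldFace` for this
edge, which lies in both faces, does not matter. -/
theorem attach_two_three {f : Corner ι → X} (hf : T.EdgeInvariant f) (t : Bool) :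
    f (edge (s.attach t 2).1 ((s.attach t 2).2 0) ((s.attach t 2).2 1)) =
      f (edge (s.attach t 3).1 ((s.attach t 3).2 0) ((s.attach t 3).2 1)) ∧
    f (edge (s.attach t 2).1 ((s.attach t 2).2 1) ((s.attach t 2).2 0)) =
      f (edge (s.attach t 3).1 ((s.attach t 3).2 1) ((s.attach t 3).2 0)) := by
  have key : ∀ {f : Corner ι → X}, T.EdgeInvariant f →
      f (edge (s.attach false 2).1 ((s.attach false 2).2 0) ((s.attach false 2).2 1)) =
      f (edge (s.attach false 3).1 ((s.attach false 3).2 0) ((s.attach false 3).2 1)) :=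
    fun hf => edgeInvariant_rotate hf (s.σ, s.p) s.steps
  have key2 : f (edge (s.attach false 2).1 ((s.attach false 2).2 1) ((s.attach false 2).2 0)) =
      f (edge (s.attach false 3).1 ((s.attach false 3).2 1) ((s.attach false 3).2 0)) := by
    have := key hf.rev
    rwa [revEdge_edge _ ((s.attach false 2).2.injective.ne (by decide)),
      revEdge_edge _ ((s.attach false 3).2.injective.ne (by decide))] at this
  cases t
  · exact ⟨key hf, key2⟩
  · have h2 := edge_attach_not (s := s) hf false (j := 2) (x := 0) (y := 1) (by decide) (by decide)
      (by decide) (by decide)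
    have h3 := edge_attach_not (s := s) hf false (j := 3) (x := 0) (y := 1) (by decide) (by decide)
      (by decide) (by decide)
    have h4 := edge_attach_not (s := s) hf false (j := 2) (x := 1) (y := 0) (by decide) (by decide)
      (by decide) (by decide)
    have h5 := edge_attach_not (s := s) hf false (j := 3) (x := 1) (y := 0) (by decide) (by decide)
      (by decide) (by decide)
    simp only [Equiv.swap_apply_left, Equiv.swap_apply_right, Bool.not_false] at h2 h3 h4 h5
    rw [h2, h3, h4, h5]
    exact ⟨key2, key hf⟩

theorem edge_attach_oldFace {f : Corner ι → X} (hf : T.EdgeInvariant f) (t : Bool)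
    {j x y : Fin 4} (hj : j = 2 ∨ j = 3) (hxy : x ≠ y) (hx : j ≠ x) (hy : j ≠ y) :
    f (edge (s.attach t (oldFace x y)).1 ((s.attach t (oldFace x y)).2 x)
      ((s.attach t (oldFace x y)).2 y)) =
      f (edge (s.attach t j).1 ((s.attach t j).2 x) ((s.attach t j).2 y)) := by
  rcases (eq_oldFace j x y hj hxy hx hy).2 with h | ⟨⟨rfl, rfl⟩ | ⟨rfl, rfl⟩, rfl, h⟩
  · rw [← h]
  · rw [h]
    exact (attach_two_three hf t).1
  · rw [h]
    exact (attach_two_three hf t).2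

variable (s) in
/-- The extension of an invariant function to the triangulation after the move, with a given value
at the new edge. -/
def extend (f : Corner ι → X) (d : X) : Corner (ι ⊕ Bool) → X
  | (Sum.inl σ, v, k) => f (σ, v, k)
  | (Sum.inr t, v, k) =>
    if (v = 2 ∨ v = 3) ∧ (mate k v = 2 ∨ mate k v = 3) then d
    else f (edge (s.attach t (oldFace v (mate k v))).1 ((s.attach t (oldFace v (mate k v))).2 v)
      ((s.attach t (oldFace v (mate k v))).2 (mate k v)))

theorem extend_inr (f : Corner ι → X) (d : X) (t : Bool) {x y : Fin 4} (h : x ≠ y) :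
    s.extend f d (edge (Sum.inr t) x y) = if (x = 2 ∨ x = 3) ∧ (y = 2 ∨ y = 3) then d
    else f (edge (s.attach t (oldFace x y)).1 ((s.attach t (oldFace x y)).2 x)
      ((s.attach t (oldFace x y)).2 y)) := by
  simp only [edge, extend, mate_quadOf x y h]

theorem extend_inr_of_face {f : Corner ι → X} (hf : T.EdgeInvariant f) (d : X) (t : Bool)
    {j x y : Fin 4} (hj : j = 2 ∨ j = 3) (hxy : x ≠ y) (hx : j ≠ x) (hy : j ≠ y) :
    s.extend f d (edge (Sum.inr t) x y) =
      f (edge (s.attach t j).1 ((s.attach t j).2 x) ((s.attach t j).2 y)) := by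
  rw [extend_inr f d t hxy, if_neg (eq_oldFace j x y hj hxy hx hy).1,
    edge_attach_oldFace hf t hj hxy hx hy]

theorem edgeInvariant_extend {f : Corner ι → X} (hf : T.EdgeInvariant f) (d : X) :
    s.result.EdgeInvariant (s.extend f d) := by
  intro τ x y g hxy hx hy
  rcases τ with σ | t
  · by_cases h : ∃ t j, (j = 2 ∨ j = 3) ∧ (σ, g) = s.target t j
    · obtain ⟨t, j, hj, he⟩ := h
      obtain ⟨rfl, rfl⟩ := Prod.mk.inj he
      obtain ⟨x, rfl⟩ := (s.attach t j).2.surjective x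
      obtain ⟨y, rfl⟩ := (s.attach t j).2.surjective y
      have hi := (s.attach t j).2.injective
      have e1 := s.result_target t j hj
      simp only [target] at e1
      rw [e1.1, e1.2, perm_inv_apply, perm_inv_apply, extend_inr_of_face hf d t hj (hi.ne_iff.1 hxy) (hi.ne_iff.1 hx)
        (hi.ne_iff.1 hy)]
      rfl
    · push Not at h
      rw [(s.result_old σ g h).1, (s.result_old σ g h).2]
      exact hf σ x y g hxy hx hy
  · by_cases hg : g = 2 ∨ g = 3
    · rw [(s.result_new t g hg).1, (s.result_new t g hg).2,
        extend_inr_of_face hf d t hg hxy hx hy]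
      rfl
    · have hg' : g = 0 ∨ g = 1 := by clear hx hy; revert g; decide
      rw [(s.result_pillow t g hg').1, (s.result_pillow t g hg').2]
      have hsw := (Equiv.swap (0 : Fin 4) 1).injective
      rw [extend_inr f d _ hxy, extend_inr f d _ (hsw.ne hxy)]
      have k1 : ∀ x : Fin 4, (Equiv.swap 0 1 x = 2 ∨ Equiv.swap 0 1 x = 3) ↔ (x = 2 ∨ x = 3) := by
        decide
      have k2 : ∀ x y : Fin 4, oldFace (Equiv.swap 0 1 x) (Equiv.swap 0 1 y) = oldFace x y := by
        decide
      simp only [k1, k2]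
      split_ifs with hd
      · rfl
      · obtain ⟨a1, a2, a3⟩ := oldFace_spec x y hxy hd
        exact edge_attach_not hf t a1 hxy a2 a3

end ZeroTwoSite

/-! ### The two parts of the split edge -/

theorem rotate_injective : Function.Injective T.rotate := by
  refine Function.LeftInverse.injective (g := fun φ => (T.adj φ.1 (φ.2 3),
    T.perm φ.1 (φ.2 3) * φ.2 * Equiv.swap 2 3)) fun φ => ?_
  have h1 := T.adj_adj φ.1 (φ.2 2)
  have h2 := T.perm_perm φ.1 (φ.2 2)
  simp only [rotate, Equiv.Perm.mul_apply, Equiv.swap_apply_right, h1, h2]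
  refine Prod.ext rfl ?_
  simp only [mul_assoc, Equiv.swap_mul_self, mul_one, inv_mul_cancel_left]

/-- The edge class of a flag consists of the edges met by rotating the flag. -/
theorem edgeInvariant_orbit [Finite ι] (φ : ι × Equiv.Perm (Fin 4)) :
    T.EdgeInvariant fun c => ∃ m, edge (T.rotate^[m] φ).1 ((T.rotate^[m] φ).2 0)
      ((T.rotate^[m] φ).2 1) = c := by
  have hper : ∃ N, 0 < N ∧ T.rotate^[N] φ = φ := by
    have hp := rotate_injective (T := T) |>.mem_periodicPts φ
    exact hp
  have key : ∀ σ x y g, x ≠ y → g ≠ x → g ≠ y →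
      (∃ m, edge (T.rotate^[m] φ).1 ((T.rotate^[m] φ).2 0) ((T.rotate^[m] φ).2 1) = edge σ x y) →
      ∃ m, edge (T.rotate^[m] φ).1 ((T.rotate^[m] φ).2 0) ((T.rotate^[m] φ).2 1) =
        edge (T.adj σ g) (T.perm σ g x) (T.perm σ g y) := by
    rintro σ x y g hxy hx hy ⟨m, hm⟩
    have hi := (T.rotate^[m] φ).2.injective
    rw [edge_inj (hi.ne (by decide)) hxy] at hm
    obtain ⟨rfl, rfl, rfl⟩ := hm
    obtain ⟨i, rfl⟩ := (T.rotate^[m] φ).2.surjective g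
    rw [hi.ne_iff] at hx hy
    have hi' : i = 2 ∨ i = 3 := by revert hx hy; revert i; decide
    rcases hi' with rfl | rfl
    · refine ⟨m + 1, ?_⟩
      rw [Function.iterate_succ_apply']
      rfl
    -- Crossing the other face rotates backwards, which is the `(N - 1)`-st power of the rotation on
    -- this orbit.
    · obtain ⟨N, hN, hφ⟩ := hper
      refine ⟨m + (N - 1), ?_⟩
      have h1 : T.rotate (T.rotate^[m + (N - 1)] φ) = T.rotate^[m] φ := by
        rw [← Function.iterate_succ_apply' T.rotate, show (m + (N - 1)).succ = m + N by omega,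
          Function.iterate_add_apply, hφ]
      generalize T.rotate^[m + (N - 1)] φ = ψ at h1 ⊢
      rw [← h1]
      have h2 := T.adj_adj ψ.1 (ψ.2 2)
      have h3 := T.perm_perm ψ.1 (ψ.2 2)
      simp only [rotate, Equiv.Perm.mul_apply, Equiv.swap_apply_right, h2, h3]
      rw [Equiv.swap_apply_of_ne_of_ne (by decide) (by decide),
        Equiv.swap_apply_of_ne_of_ne (by decide) (by decide), perm_inv_apply,
        perm_inv_apply]
  intro σ x y g hxy hx hy
  refine propext ⟨fun h => ?_, key σ x y g hxy hx hy⟩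
  have hi := (T.perm σ g).injective
  have := key _ _ _ (T.perm σ g g) (hi.ne hxy) (hi.ne hx) (hi.ne hy) h
  rwa [T.adj_adj, T.perm_perm, perm_inv_apply, perm_inv_apply] at this

/-- The flag with the edge reversed. -/
def reverseFlag (φ : ι × Equiv.Perm (Fin 4)) : ι × Equiv.Perm (Fin 4) :=
  (φ.1, φ.2 * (Equiv.swap 0 1 * Equiv.swap 2 3))

theorem reverseFlag_reverseFlag (φ : ι × Equiv.Perm (Fin 4)) :
    reverseFlag (reverseFlag φ) = φ := by
  have : (Equiv.swap 0 1 * Equiv.swap 2 3) * (Equiv.swap 0 1 * Equiv.swap 2 3) =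
      (1 : Equiv.Perm (Fin 4)) := by decide
  simp [reverseFlag, mul_assoc φ.2, this]

theorem rotate_reverseFlag_rotate (φ : ι × Equiv.Perm (Fin 4)) :
    T.rotate (reverseFlag (T.rotate φ)) = reverseFlag φ := by
  have h1 := T.adj_adj φ.1 (φ.2 2)
  have h2 := T.perm_perm φ.1 (φ.2 2)
  have h3 : (Equiv.swap 2 3 * (Equiv.swap 0 1 * Equiv.swap 2 3)) =
      (Equiv.swap 0 1 : Equiv.Perm (Fin 4)) := by decide
  have h4 : (Equiv.swap 0 1 : Equiv.Perm (Fin 4)) 2 = 2 := by decide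
  simp only [rotate, reverseFlag, mul_assoc, h3, Equiv.Perm.mul_apply, h4, h1, h2,
    inv_mul_cancel_left]

/-- Reversing the edge reverses the direction of rotation. An identity for `n + 2` steps at `φ` thus
yields one for `n` steps at the rotated flag. The descent ends at `n = 0`, where reversal would fix
a flag, or at `n = 1`, where a face would be glued to itself. -/
theorem iterate_rotate_ne_reverseFlag (n : ℕ) (φ : ι × Equiv.Perm (Fin 4)) :
    T.rotate^[n] φ ≠ reverseFlag φ := by
  induction n using Nat.strong_induction_on generalizing φ with
  | _ n ih =>
    intro h
    match n, ih, h with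
    | 0, _, h =>
      have h1 : φ.2 * (Equiv.swap 0 1 * Equiv.swap 2 3) = φ.2 * 1 := by
        rw [mul_one]
        exact (congrArg Prod.snd h).symm
      exact absurd (mul_left_cancel h1) (by decide)
    | 1, _, h =>
      refine T.not_self φ.1 (φ.2 2) ⟨congrArg Prod.fst h, ?_⟩
      have h1 := congrArg (fun ψ : ι × Equiv.Perm (Fin 4) => ψ.2 3) h
      exact h1
    | n + 2, ih, h =>
      rw [Function.iterate_succ_apply', Function.iterate_succ_apply, ← rotate_reverseFlag_rotate φ]
        at h
      exact ih n (by omega) (T.rotate φ) (rotate_injective h)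

theorem iterate_rotate_ne_reverseFlag_iterate (m n : ℕ) (φ : ι × Equiv.Perm (Fin 4)) :
    T.rotate^[m] φ ≠ reverseFlag (T.rotate^[n] φ) := by
  intro h
  rcases le_total n m with hmn | hmn
  · obtain ⟨k, rfl⟩ := Nat.exists_eq_add_of_le' hmn
    rw [Function.iterate_add_apply] at h
    exact iterate_rotate_ne_reverseFlag k _ h
  · obtain ⟨k, rfl⟩ := Nat.exists_eq_add_of_le' hmn
    rw [Function.iterate_add_apply] at h
    have h' := congrArg reverseFlag h
    rw [reverseFlag_reverseFlag] at h'
    exact iterate_rotate_ne_reverseFlag k _ h'.symm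

end Triangulation

end Index3D

/-! ### Rotation about a part of the split edge after the move -/

namespace Index3D

namespace Triangulation

variable {ι : Type*} {T : Triangulation ι}

namespace ZeroTwoSite

variable (s : T.ZeroTwoSite)

/-- Flags of the triangulation after the move that do not belong to a part of the split edge. -/
def OffSplitEdge (φ : (ι ⊕ Bool) × Equiv.Perm (Fin 4)) : Prop :=
  ∀ t, φ.1 = Sum.inr t → ¬ (φ.2 2 ≠ 0 ∧ φ.2 2 ≠ 1 ∧ φ.2 3 ≠ 0 ∧ φ.2 3 ≠ 1)

/-- A flag of `T` as a flag of the triangulation after the move. -/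
def inlFlag (φ : ι × Equiv.Perm (Fin 4)) : (ι ⊕ Bool) × Equiv.Perm (Fin 4) := (Sum.inl φ.1, φ.2)

/-- Rotation of a flag after the move up to some flag, without passing the split edge. -/
def RotatesTo (φ ψ : (ι ⊕ Bool) × Equiv.Perm (Fin 4)) : Prop :=
  ∃ M, 0 < M ∧ s.result.rotate^[M] φ = ψ ∧
    ∀ m, 0 < m → m < M → OffSplitEdge (s.result.rotate^[m] φ)

variable {s}

theorem RotatesTo.trans {φ ψ χ : (ι ⊕ Bool) × Equiv.Perm (Fin 4)} (h : s.RotatesTo φ ψ)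
    (hψ : OffSplitEdge ψ) (h' : s.RotatesTo ψ χ) : s.RotatesTo φ χ := by
  obtain ⟨M, hM, rfl, h⟩ := h
  obtain ⟨N, hN, rfl, h'⟩ := h'
  refine ⟨N + M, by omega, Function.iterate_add_apply _ _ _ _, fun m h0 hm => ?_⟩
  rcases lt_trichotomy m M with hlt | rfl | hgt
  · exact h m h0 hlt
  · exact hψ
  · have := h' (m - M) (by omega) (by omega)
    rwa [← Function.iterate_add_apply, Nat.sub_add_cancel hgt.le] at this

theorem RotatesTo.iterate {φ : (ι ⊕ Bool) × Equiv.Perm (Fin 4)} (h : s.RotatesTo φ φ) (m : ℕ) :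
    s.result.rotate^[m] φ = φ ∨ OffSplitEdge (s.result.rotate^[m] φ) := by
  obtain ⟨M, hM, hφ, h⟩ := h
  induction m using Nat.strong_induction_on with
  | _ m ih =>
    rcases Nat.eq_zero_or_pos m with rfl | h0
    · exact Or.inl rfl
    rcases lt_or_ge m M with hlt | hge
    · exact Or.inr (h m h0 hlt)
    · have := ih (m - M) (by omega)
      rwa [← Nat.sub_add_cancel hge, Function.iterate_add_apply, hφ]

theorem offSplitEdge_inlFlag (φ : ι × Equiv.Perm (Fin 4)) : OffSplitEdge (inlFlag φ) := by
  intro t h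
  simp [inlFlag] at h

theorem rotate_inlFlag_old {φ : ι × Equiv.Perm (Fin 4)}
    (h : ∀ t j, (j = 2 ∨ j = 3) → (φ.1, φ.2 2) ≠ s.target t j) :
    s.result.rotate (inlFlag φ) = inlFlag (T.rotate φ) := by
  simp only [rotate, inlFlag, (s.result_old φ.1 (φ.2 2) h).1, (s.result_old φ.1 (φ.2 2) h).2]

theorem rotate_inlFlag_target (t : Bool) {j : Fin 4} (hj : j = 2 ∨ j = 3) {π : Equiv.Perm (Fin 4)}
    (hπ : π 2 = j) : s.result.rotate (inlFlag ((s.attach t j).1, (s.attach t j).2 * π)) =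
      (Sum.inr t, π * Equiv.swap 2 3) := by
  have h := s.result_target t j hj
  simp only [target] at h
  simp only [rotate, inlFlag, Equiv.Perm.mul_apply, hπ, h.1, h.2, inv_mul_cancel_left]

theorem rotate_inr_pillow (t : Bool) {π : Equiv.Perm (Fin 4)} (hπ : π 3 = 0 ∨ π 3 = 1) :
    s.result.rotate (Sum.inr t, π * Equiv.swap 2 3) = (Sum.inr (!t), Equiv.swap 0 1 * π) := by
  have h := s.result_pillow t (π 3) hπ
  simp only [rotate, Equiv.Perm.mul_apply, Equiv.swap_apply_left, h.1, h.2, mul_assoc,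
    Equiv.swap_mul_self, mul_one]

theorem rotate_inr_new (t : Bool) {j : Fin 4} (hj : j = 2 ∨ j = 3) {π : Equiv.Perm (Fin 4)}
    (hπ : π 2 = j) : s.result.rotate (Sum.inr t, π) =
      inlFlag ((s.attach t j).1, (s.attach t j).2 * π * Equiv.swap 2 3) := by
  have h := s.result_new t j hj
  simp only [rotate, inlFlag, hπ, h.1, h.2]

theorem rotate_attach (t : Bool) {j : Fin 4} (hj : j = 2 ∨ j = 3) {π : Equiv.Perm (Fin 4)}
    (hπ : π 2 = j) : T.rotate ((s.attach t j).1, (s.attach t j).2 * π) =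
      ((s.attach (!t) j).1, (s.attach (!t) j).2 * (Equiv.swap 0 1 * π) * Equiv.swap 2 3) := by
  rw [s.attach_not t j hj]
  simp only [rotate, target, Equiv.Perm.mul_apply, hπ, mul_assoc]
  congr 3
  rw [← mul_assoc (Equiv.swap 0 1) (Equiv.swap 0 1), Equiv.swap_mul_self, one_mul]

/-- About an edge of the opened face other than `uv`, one rotation in `T` becomes three: into a new
tetrahedron, through a pillow face into the other one, and out again. -/
theorem rotatesTo_target (t : Bool) {j : Fin 4} (hj : j = 2 ∨ j = 3) {π : Equiv.Perm (Fin 4)}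
    (hπ : π 2 = j) (h3 : π 3 = 0 ∨ π 3 = 1) :
    s.RotatesTo (inlFlag ((s.attach t j).1, (s.attach t j).2 * π))
      (inlFlag (T.rotate ((s.attach t j).1, (s.attach t j).2 * π))) := by
  have h4 : ((Equiv.swap 0 1 : Equiv.Perm (Fin 4)) * π) 2 = j := by
    rw [Equiv.Perm.mul_apply, hπ]
    rcases hj with rfl | rfl <;> decide
  have r1 := rotate_inlFlag_target (s := s) t hj hπ
  have r2 := rotate_inr_pillow (s := s) t h3
  have r3 := rotate_inr_new (s := s) (!t) hj h4
  refine ⟨3, by norm_num, ?_, fun m h0 hm => ?_⟩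
  · rw [Function.iterate_succ_apply, Function.iterate_succ_apply, Function.iterate_one, r1, r2, r3,
      rotate_attach t hj hπ]
  · interval_cases m
    · rw [Function.iterate_one, r1]
      intro _ _
      simp only [Equiv.Perm.mul_apply, Equiv.swap_apply_left]
      rcases h3 with h | h <;> simp [h]
    · rw [Function.iterate_succ_apply, Function.iterate_one, r1, r2]
      intro _ _
      simp only [Equiv.Perm.mul_apply]
      rcases h3 with h | h <;> simp [h]

theorem sign_iterate_rotate (φ : ι × Equiv.Perm (Fin 4)) (n : ℕ) :
    Equiv.Perm.sign (T.rotate^[n] φ).2 = Equiv.Perm.sign φ.2 := by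
  induction n with
  | zero => rfl
  | succ n ih => rw [Function.iterate_succ_apply', sign_rotate, ih]

theorem even_perm_eq_one : ∀ π : Equiv.Perm (Fin 4), Equiv.Perm.sign π = 1 → π 2 = 2 →
    ¬ (π 3 = 0 ∨ π 3 = 1) → π = 1 := by
  decide +kernel

theorem even_perm_eq_swap : ∀ π : Equiv.Perm (Fin 4), Equiv.Perm.sign π = 1 → π 2 = 3 →
    ¬ (π 3 = 0 ∨ π 3 = 1) → π = Equiv.swap 0 1 * Equiv.swap 2 3 := by
  decide +kernel

variable (s)

/-- A step in `T` is the same step after the move unless an opened face is crossed, and then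
`rotatesTo_target` applies unless the edge is `uv` itself. The flag of this last kind would be one
of four: the flag `s.last`, excluded by minimality of `n`; two flags reversed to flags of the orbit,
excluded because no edge is its own reverse; or a flag whose rotation is the starting flag, which
would give a shorter way to `s.last`. -/
theorem rotatesTo_succ {n : ℕ} (hn : T.rotate^[n] (s.σ, s.p) = s.last)
    (hmin : ∀ m < n, T.rotate^[m] (s.σ, s.p) ≠ s.last) {i : ℕ} (hi : i < n) :
    s.RotatesTo (inlFlag (T.rotate^[i] (s.σ, s.p))) (inlFlag (T.rotate^[i + 1] (s.σ, s.p))) := by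
  rw [Function.iterate_succ_apply']
  have hsign := sign_iterate_rotate (T := T) (s.σ, s.p) i
  rw [show Equiv.Perm.sign (s.σ, s.p).2 = -1 from s.sign_p] at hsign
  by_cases h : ∃ t j, (j = 2 ∨ j = 3) ∧
      ((T.rotate^[i] (s.σ, s.p)).1, (T.rotate^[i] (s.σ, s.p)).2 2) = s.target t j
  · obtain ⟨t, j, hj, he⟩ := h
    obtain ⟨π, hπ⟩ : ∃ π, T.rotate^[i] (s.σ, s.p) = ((s.attach t j).1, (s.attach t j).2 * π) :=
      ⟨(s.attach t j).2⁻¹ * (T.rotate^[i] (s.σ, s.p)).2, by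
        rw [mul_inv_cancel_left]
        exact Prod.ext (Prod.ext_iff.1 he).1 rfl⟩
    have hπ2 : π 2 = j := by
      have := congrArg Prod.snd he
      rw [hπ] at this
      exact (s.attach t j).2.injective this
    have hπs : Equiv.Perm.sign π = 1 := by
      rw [hπ] at hsign
      simpa [s.sign_attach t j] using hsign
    by_cases h3 : π 3 = 0 ∨ π 3 = 1
    · rw [hπ]
      exact rotatesTo_target t hj hπ2 h3
    · exfalso
      rcases hj with rfl | rfl
      · have h1 := even_perm_eq_one π hπs hπ2 h3
        rw [h1, mul_one] at hπ
        cases t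
        · exact hmin i hi hπ
        · refine iterate_rotate_ne_reverseFlag_iterate (T := T) i (n + 1) (s.σ, s.p) ?_
          rw [Function.iterate_succ_apply', hn, hπ]
          refine Prod.ext rfl ?_
          simp only [attach, reverseFlag, rotate, mul_assoc]
          congr 2
          decide
      · have h1 := even_perm_eq_swap π hπs hπ2 h3
        rw [h1] at hπ
        cases t
        · exact iterate_rotate_ne_reverseFlag_iterate (T := T) i 0 (s.σ, s.p) hπ
        · have h2 : T.rotate^[i + 1] (s.σ, s.p) = (s.σ, s.p) := by
            rw [Function.iterate_succ_apply', hπ, rotate_attach true (Or.inr rfl) (by decide)]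
            refine Prod.ext rfl ?_
            simp only [attach, Bool.not_true, mul_assoc]
            rw [show (Equiv.swap 0 1 * (Equiv.swap 0 1 * (Equiv.swap 2 3 * Equiv.swap 2 3)) :
              Equiv.Perm (Fin 4)) = 1 by decide, mul_one]
          refine hmin (n - (i + 1)) (by omega) ?_
          rw [← hn, ← Nat.sub_add_cancel (show i + 1 ≤ n from hi), Function.iterate_add_apply, h2,
            Nat.add_sub_cancel]
  · push Not at h
    refine ⟨1, one_pos, ?_, fun m h0 hm => by omega⟩
    rw [Function.iterate_one, rotate_inlFlag_old h]

theorem rotatesTo_self :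
    s.RotatesTo (Sum.inr false, Equiv.swap 2 3) (Sum.inr false, Equiv.swap 2 3) := by
  classical
  -- The prescribed number of steps may lead several times around the edge, so it is replaced by the
  -- first time at which `s.last` is reached.
  have hex : ∃ n, T.rotate^[n] (s.σ, s.p) = s.last := ⟨s.steps, rfl⟩
  have hn := Nat.find_spec hex
  have hmin : ∀ m < Nat.find hex, T.rotate^[m] (s.σ, s.p) ≠ s.last := fun m => Nat.find_min hex
  generalize Nat.find hex = n at hn hmin
  have h0 : s.RotatesTo (Sum.inr false, Equiv.swap 2 3) (inlFlag (s.σ, s.p)) := by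
    refine ⟨1, one_pos, ?_, fun m h0 hm => by omega⟩
    rw [Function.iterate_one, rotate_inr_new false (Or.inr rfl) (by decide)]
    simp only [attach, mul_assoc, Equiv.swap_mul_self, mul_one]
  have h1 : ∀ i ≤ n, s.RotatesTo (Sum.inr false, Equiv.swap 2 3)
      (inlFlag (T.rotate^[i] (s.σ, s.p))) := by
    intro i hi
    induction i with
    | zero => exact h0
    | succ i ih =>
      exact (ih (by omega)).trans (offSplitEdge_inlFlag _) (s.rotatesTo_succ hn hmin (by omega))
  refine (h1 n le_rfl).trans (offSplitEdge_inlFlag _) ⟨1, one_pos, ?_, fun m h0 hm => by omega⟩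
  rw [hn, Function.iterate_one]
  have := rotate_inlFlag_target (s := s) false (j := 2) (π := 1) (Or.inl rfl) rfl
  rwa [one_mul, mul_one] at this

/-- The two parts of the split edge, both with both orientations, belong to different classes. -/
theorem orEdge_split_ne [Finite ι] {t : Bool} {x y : Fin 4} (hxy : x = 0 ∧ y = 1 ∨ x = 1 ∧ y = 0)
    (h : s.result.orEdge (edge (Sum.inr t) x y) = s.result.orEdge (edge (Sum.inr false) 0 1)) :
    t = false ∧ x = 0 ∧ y = 1 := by
  have hne : x ≠ y := by rcases hxy with ⟨rfl, rfl⟩ | ⟨rfl, rfl⟩ <;> decide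
  have hinv := edgeInvariant_orbit (T := s.result) (Sum.inr false, Equiv.swap 2 3)
  have h1 := hinv.eq_of_orEdge_eq h
  obtain ⟨m, hm⟩ := h1.mpr ⟨0, rfl⟩
  have hi := (s.result.rotate^[m] (Sum.inr false, Equiv.swap 2 3)).2.injective
  rcases s.rotatesTo_self.iterate m with h2 | h2
  · rw [h2, edge_inj (show Equiv.swap (2 : Fin 4) 3 0 ≠ Equiv.swap 2 3 1 by decide) hne] at hm
    obtain ⟨a1, a2, a3⟩ := hm
    exact ⟨(Sum.inr_injective a1).symm, a2.symm, a3.symm⟩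
  · rw [edge_inj (hi.ne (by decide)) hne] at hm
    obtain ⟨a1, a2, a3⟩ := hm
    refine absurd ?_ (h2 t a1)
    have b1 := hi.ne (show (2 : Fin 4) ≠ 0 by decide)
    have b2 := hi.ne (show (2 : Fin 4) ≠ 1 by decide)
    have b3 := hi.ne (show (3 : Fin 4) ≠ 0 by decide)
    have b4 := hi.ne (show (3 : Fin 4) ≠ 1 by decide)
    rw [a2] at b1 b3
    rw [a3] at b2 b4
    rcases hxy with ⟨rfl, rfl⟩ | ⟨rfl, rfl⟩
    · exact ⟨b1, b2, b3, b4⟩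
    · exact ⟨b2, b1, b4, b3⟩

end ZeroTwoSite

end Triangulation

end Index3D

namespace Index3D

namespace Triangulation

variable {ι : Type*} {T : Triangulation ι}

/-- No edge is identified with its own reverse. -/
theorem orEdge_ne_orEdge_rev [Finite ι] (σ : ι) {x y : Fin 4} (h : x ≠ y) :
    T.orEdge (edge σ x y) ≠ T.orEdge (edge σ y x) := by
  intro he
  have key0 : ∀ x y : Fin 4, x ≠ y → ∃ φ : Equiv.Perm (Fin 4), φ 0 = x ∧ φ 1 = y := by
    decide +kernel
  obtain ⟨φ, rfl, rfl⟩ := key0 x y h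
  have h1 := (edgeInvariant_orbit (T := T) (σ, φ)).eq_of_orEdge_eq he
  obtain ⟨m, hm⟩ := h1.mp ⟨0, rfl⟩
  have hs := ZeroTwoSite.sign_iterate_rotate (T := T) (σ, φ) m
  have hne := iterate_rotate_ne_reverseFlag (T := T) m (σ, φ)
  generalize T.rotate^[m] (σ, φ) = ψ at hm hs hne
  rw [edge_inj (ψ.2.injective.ne (by decide)) h.symm] at hm
  obtain ⟨a1, a2, a3⟩ := hm
  -- Rotation preserves the sign of the labelling, and only one even permutation exchanges `0` and
  -- `1`; it is the one that defines `reverseFlag`.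
  have key : ∀ π : Equiv.Perm (Fin 4), Equiv.Perm.sign π = 1 → π 0 = 1 → π 1 = 0 →
      π = Equiv.swap 0 1 * Equiv.swap 2 3 := by
    decide +kernel
  refine hne (Prod.ext a1 ?_)
  have := key (φ⁻¹ * ψ.2) (by simp [hs]) (by simp [a2]) (by simp [a3])
  simp only [reverseFlag, ← this, mul_inv_cancel_left]

namespace ZeroTwoSite

/-! ### Classes before and after the move -/

/-- The restriction of a class to the common tetrahedra. -/
def restrict (S : ι ⊕ Bool → Fin 3 → ℤ) : ι → Fin 3 → ℤ := fun σ => S (Sum.inl σ)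

/-- The defect of a class after the move: its vanishing says that the shears along the new edges
that are glued to an edge of `T` other than the split one cancel. -/
def defect (S : ι ⊕ Bool → Fin 3 → ℤ) : ℤ :=
  S (Sum.inr false) 0 - S (Sum.inr false) 1 - (S (Sum.inr true) 0 - S (Sum.inr true) 2)

variable {s : T.ZeroTwoSite}

/-- The pillow faces are glued by exchanging `u` and `v` in the labels. This identifies the edges of
`A` with those of `B`, except for the two parts of the split edge, and interchanges the quad types 1
and 2. -/
theorem edgeSum_inr {f : Corner (ι ⊕ Bool) → ℤ} (hf : s.result.EdgeInvariant f) :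
    edgeSum f (Sum.inr true) 1 = edgeSum f (Sum.inr false) 2 ∧
    edgeSum f (Sum.inr true) 2 = edgeSum f (Sum.inr false) 1 ∧
    edgeSum f (Sum.inr false) 0 = f (edge (Sum.inr false) 0 1) + f (edge (Sum.inr false) 1 0) +
      (f (edge (Sum.inr false) 2 3) + f (edge (Sum.inr false) 3 2)) ∧
    edgeSum f (Sum.inr true) 0 = f (edge (Sum.inr true) 1 0) + f (edge (Sum.inr true) 0 1) +
      (f (edge (Sum.inr false) 2 3) + f (edge (Sum.inr false) 3 2)) := by
  have key : ∀ x y : Fin 4, x ≠ y → (∃ h : Fin 4, (h = 0 ∨ h = 1) ∧ h ≠ x ∧ h ≠ y) →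
      f (edge (Sum.inr true) (Equiv.swap 0 1 x) (Equiv.swap 0 1 y)) =
        f (edge (Sum.inr false) x y) := by
    rintro x y hxy ⟨h, h1, h2, h3⟩
    exact edge_pillow hf false h1 hxy h2 h3
  have k02 : f (edge (Sum.inr true) 1 2) = f (edge (Sum.inr false) 0 2) :=
    key 0 2 (by decide) (by decide)
  have k20 : f (edge (Sum.inr true) 2 1) = f (edge (Sum.inr false) 2 0) :=
    key 2 0 (by decide) (by decide)
  have k03 : f (edge (Sum.inr true) 1 3) = f (edge (Sum.inr false) 0 3) :=
    key 0 3 (by decide) (by decide)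
  have k30 : f (edge (Sum.inr true) 3 1) = f (edge (Sum.inr false) 3 0) :=
    key 3 0 (by decide) (by decide)
  have k12 : f (edge (Sum.inr true) 0 2) = f (edge (Sum.inr false) 1 2) :=
    key 1 2 (by decide) (by decide)
  have k21 : f (edge (Sum.inr true) 2 0) = f (edge (Sum.inr false) 2 1) :=
    key 2 1 (by decide) (by decide)
  have k13 : f (edge (Sum.inr true) 0 3) = f (edge (Sum.inr false) 1 3) :=
    key 1 3 (by decide) (by decide)
  have k31 : f (edge (Sum.inr true) 3 0) = f (edge (Sum.inr false) 3 1) :=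
    key 3 1 (by decide) (by decide)
  have k23 : f (edge (Sum.inr true) 2 3) = f (edge (Sum.inr false) 2 3) :=
    key 2 3 (by decide) (by decide)
  have k32 : f (edge (Sum.inr true) 3 2) = f (edge (Sum.inr false) 3 2) :=
    key 3 2 (by decide) (by decide)
  have q : quadOf 0 1 = 0 ∧ quadOf 1 0 = 0 ∧ quadOf 2 3 = 0 ∧ quadOf 3 2 = 0 ∧
      quadOf 0 2 = 1 ∧ quadOf 2 0 = 1 ∧ quadOf 1 3 = 1 ∧ quadOf 3 1 = 1 ∧
      quadOf 0 3 = 2 ∧ quadOf 3 0 = 2 ∧ quadOf 1 2 = 2 ∧ quadOf 2 1 = 2 := by decide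
  obtain ⟨q1, q2, q3, q4, q5, q6, q7, q8, q9, q10, q11, q12⟩ := q
  simp only [edge, q1, q2, q3, q4, q5, q6, q7, q8, q9, q10, q11, q12] at *
  simp only [edgeSum, Fin.sum_univ_four]
  refine ⟨?_, ?_, ?_, ?_⟩ <;> linarith

theorem restrict_edgeSum (f : Corner (ι ⊕ Bool) → ℤ) :
    restrict (edgeSum f) = edgeSum fun c : Corner ι => f (inlCorner c) := rfl

theorem restrict_shear (S : ι ⊕ Bool → Fin 3 → ℤ) : restrict (shear S) = shear (restrict S) := rfl

/-- The new edge `w₁w₂`, as an invariant function. -/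
def newEdgeFun : Corner (ι ⊕ Bool) → ℤ
  | (Sum.inl _, _, _) => 0
  | (Sum.inr _, v, k) => if v = 2 ∧ k = 0 then 1 else 0

theorem newEdgeFun_inr (t : Bool) {x y : Fin 4} (h : x ≠ y) :
    newEdgeFun (edge (Sum.inr t : ι ⊕ Bool) x y) = if x = 2 ∧ y = 3 then 1 else 0 := by
  have : ∀ x y : Fin 4, x ≠ y → ((x = 2 ∧ quadOf x y = 0) ↔ (x = 2 ∧ y = 3)) := by decide
  simp only [edge, newEdgeFun, this x y h]

variable [Fintype ι]

theorem dot_sum_type (A S : ι ⊕ Bool → Fin 3 → ℤ) :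
    dot A S = dot (restrict A) (restrict S) + (∑ k, A (Sum.inr true) k * S (Sum.inr true) k +
      ∑ k, A (Sum.inr false) k * S (Sum.inr false) k) := by
  simp only [dot, Fintype.sum_sum_type, Fintype.sum_bool]
  rfl

/-- The matching equations after the move. -/
theorem dot_edgeSum_result {f : Corner (ι ⊕ Bool) → ℤ} (hf : s.result.EdgeInvariant f)
    (S : ι ⊕ Bool → Fin 3 → ℤ) :
    dot (edgeSum f) (shear S) =
      dot (edgeSum fun c : Corner ι => f (inlCorner c)) (shear (restrict S)) +
      (f (edge (Sum.inr false) 0 1) + f (edge (Sum.inr false) 1 0)) * shear S (Sum.inr false) 0 +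
      (f (edge (Sum.inr true) 1 0) + f (edge (Sum.inr true) 0 1)) * shear S (Sum.inr true) 0 +
      (f (edge (Sum.inr false) 2 3) + f (edge (Sum.inr false) 3 2)) *
        (shear S (Sum.inr false) 0 + shear S (Sum.inr true) 0) +
      edgeSum f (Sum.inr false) 1 * (shear S (Sum.inr false) 1 + shear S (Sum.inr true) 2) +
      edgeSum f (Sum.inr false) 2 * (shear S (Sum.inr false) 2 + shear S (Sum.inr true) 1) := by
  obtain ⟨h1, h2, h3, h4⟩ := edgeSum_inr hf
  rw [dot_sum_type, restrict_edgeSum, restrict_shear]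
  simp only [Fin.sum_univ_three, h1, h2, h3, h4]
  ring

end ZeroTwoSite

end Triangulation

end Index3D

/-! ### Lifting and restricting Q-normal classes -/

namespace Index3D

namespace Triangulation

variable {ι : Type*} {T : Triangulation ι}

theorem edgeSum_rev (f : Corner ι → ℤ) : edgeSum (fun c => f (revEdge c)) = edgeSum f := by
  funext σ k
  exact Equiv.sum_comp (mate k) fun v => f (σ, v, k)

theorem edgeSum_add (f g : Corner ι → ℤ) : edgeSum (f + g) = edgeSum f + edgeSum g := by
  funext σ k
  exact Finset.sum_add_distrib

theorem edgeSum_smul (m : ℤ) (f : Corner ι → ℤ) : edgeSum (m • f) = m • edgeSum f := by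
  funext σ k
  simp [edgeSum, Finset.mul_sum]

theorem dot_add_left [Fintype ι] (A A' S : ι → Fin 3 → ℤ) : dot (A + A') S = dot A S + dot A' S := by
  rw [dot_comm, dot_add_right, dot_comm S, dot_comm S]

theorem shear_add (S S' : ι → Fin 3 → ℤ) : shear (S + S') = shear S + shear S' := by
  funext σ k
  simp only [shear, Pi.add_apply]
  ring

namespace ZeroTwoSite

variable {s : T.ZeroTwoSite}

theorem extend_split {X : Type*} {f : Corner ι → X} (hf : T.EdgeInvariant f) (d : X) :
    s.extend f d (edge (Sum.inr true) 1 0) = s.extend f d (edge (Sum.inr false) 0 1) ∧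
    s.extend f d (edge (Sum.inr true) 0 1) = s.extend f d (edge (Sum.inr false) 1 0) := by
  constructor
  · rw [extend_inr_of_face hf d _ (j := 3) (by decide) (by decide) (by decide) (by decide),
      extend_inr_of_face hf d _ (j := 3) (by decide) (by decide) (by decide) (by decide)]
    exact edge_attach_not hf false (j := 3) (x := 0) (y := 1) (by decide) (by decide) (by decide)
      (by decide)
  · rw [extend_inr_of_face hf d _ (j := 3) (by decide) (by decide) (by decide) (by decide),
      extend_inr_of_face hf d _ (j := 3) (by decide) (by decide) (by decide) (by decide)]
    exact edge_attach_not hf false (j := 3) (x := 1) (y := 0) (by decide) (by decide) (by decide)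
      (by decide)

theorem edgeInvariant_newEdgeFun : s.result.EdgeInvariant newEdgeFun := by
  intro τ x y g hxy hx hy
  have key : ∀ j x y : Fin 4, (j = 2 ∨ j = 3) → j ≠ x → j ≠ y → ¬ (x = 2 ∧ y = 3) := by decide
  rcases τ with σ | t
  · by_cases h : ∃ t j, (j = 2 ∨ j = 3) ∧ (σ, g) = s.target t j
    · obtain ⟨t, j, hj, he⟩ := h
      obtain ⟨rfl, rfl⟩ := Prod.mk.inj he
      obtain ⟨x, rfl⟩ := (s.attach t j).2.surjective x
      obtain ⟨y, rfl⟩ := (s.attach t j).2.surjective y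
      have hi := (s.attach t j).2.injective
      have e1 := s.result_target t j hj
      simp only [target] at e1
      rw [e1.1, e1.2, perm_inv_apply, perm_inv_apply, newEdgeFun_inr t (hi.ne_iff.1 hxy),
        if_neg (key j x y hj (hi.ne_iff.1 hx) (hi.ne_iff.1 hy))]
      rfl
    · push Not at h
      rw [(s.result_old σ g h).1, (s.result_old σ g h).2]
      rfl
  · by_cases hg : g = 2 ∨ g = 3
    · rw [(s.result_new t g hg).1, (s.result_new t g hg).2, newEdgeFun_inr t hxy,
        if_neg (key g x y hg hx hy)]
      rfl
    · have hg' : g = 0 ∨ g = 1 := by clear hx hy; revert g; decide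
      rw [(s.result_pillow t g hg').1, (s.result_pillow t g hg').2]
      have hsw := (Equiv.swap (0 : Fin 4) 1).injective
      rw [newEdgeFun_inr _ hxy, newEdgeFun_inr _ (hsw.ne hxy)]
      have k1 : ∀ x y : Fin 4, (Equiv.swap 0 1 x = 2 ∧ Equiv.swap 0 1 y = 3) ↔ (x = 2 ∧ y = 3) := by
        decide
      simp only [k1]

open Classical in
theorem newEdgeFun_eq (c : Corner (ι ⊕ Bool)) : newEdgeFun c =
    if s.result.orEdge c = s.result.orEdge (edge (Sum.inr false) 2 3) then 1 else 0 := by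
  have h1 : newEdgeFun (edge (Sum.inr false : ι ⊕ Bool) 2 3) = 1 := by
    rw [newEdgeFun_inr false (by decide)]
    rfl
  split_ifs with h
  · rw [(edgeInvariant_newEdgeFun (s := s)).eq_of_orEdge_eq h, h1]
  · obtain ⟨σ | t, v, k⟩ := c
    · rfl
    · refine if_neg ?_
      rintro ⟨rfl, rfl⟩
      refine h ?_
      have hq : quadOf 2 3 = 0 := by decide
      cases t
      · rw [edge, hq]
      · have := edge_pillow s.result.edgeInvariant_orEdge false (j := 0) (x := 2) (y := 3)
          (by decide) (by decide) (by decide) (by decide)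
        rw [← this]
        simp only [edge]
        congr 1

/-- The edge solution of the new edge. -/
def newEdgeSol : ι ⊕ Bool → Fin 3 → ℤ := Sum.elim 0 fun _ => ![1, 0, 0]

theorem newEdgeSol_eq : s.result.edgeSol (s.result.orEdge (edge (Sum.inr false) 2 3)) =
    newEdgeSol := by
  classical
  rw [edgeSol_eq_edgeSum]
  funext τ k
  simp only [edgeSum, ← newEdgeFun_eq]
  rcases τ with σ | t
  · simp [newEdgeFun, newEdgeSol]
  · fin_cases k <;> simp [newEdgeFun, newEdgeSol]

open Classical in
variable (s) in
/-- The indicator function of the first part of the split edge. -/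
noncomputable def splitFun (c : Corner (ι ⊕ Bool)) : ℤ :=
  if s.result.orEdge c = s.result.orEdge (edge (Sum.inr false) 0 1) then 1 else 0

theorem edgeInvariant_splitFun : s.result.EdgeInvariant s.splitFun := by
  classical
  exact s.result.edgeInvariant_orEdge.comp fun x =>
    if x = s.result.orEdge (edge (Sum.inr false) 0 1) then (1 : ℤ) else 0

theorem splitFun_values [Finite ι] : s.splitFun (edge (Sum.inr false) 0 1) = 1 ∧
    s.splitFun (edge (Sum.inr false) 1 0) = 0 ∧ s.splitFun (edge (Sum.inr true) 0 1) = 0 ∧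
    s.splitFun (edge (Sum.inr true) 1 0) = 0 := by
  refine ⟨if_pos rfl, if_neg fun h => ?_, if_neg fun h => ?_, if_neg fun h => ?_⟩
  · exact absurd (s.orEdge_split_ne (Or.inr ⟨rfl, rfl⟩) h).2.1 (by decide)
  · exact absurd (s.orEdge_split_ne (Or.inl ⟨rfl, rfl⟩) h).1 (by decide)
  · exact absurd (s.orEdge_split_ne (Or.inr ⟨rfl, rfl⟩) h).1 (by decide)

variable [Fintype ι]

variable (s) in
/-- The total shear of a class of `T` along the first part of the split edge. -/
noncomputable def splitShear (S : ι → Fin 3 → ℤ) : ℤ :=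
  dot (edgeSum fun c : Corner ι => s.splitFun (inlCorner c)) (shear S)

/-- Subtracting from `f` suitable multiples of the indicator of the first part of the split edge, in
both orientations, makes it agree on the two parts. The remainder restricts to an invariant function
of `T`, which pairs to zero with the shears of `S`. -/
theorem dot_edgeSum_inl {f : Corner (ι ⊕ Bool) → ℤ} (hf : s.result.EdgeInvariant f)
    {S : ι → Fin 3 → ℤ} (hS : S ∈ T.Q) :
    dot (edgeSum fun c : Corner ι => f (inlCorner c)) (shear S) =
      (f (edge (Sum.inr false) 0 1) + f (edge (Sum.inr false) 1 0) -
        (f (edge (Sum.inr true) 1 0) + f (edge (Sum.inr true) 0 1))) * s.splitShear S := by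
  set p := f (edge (Sum.inr false) 0 1) - f (edge (Sum.inr true) 1 0) with hp
  set q := f (edge (Sum.inr false) 1 0) - f (edge (Sum.inr true) 0 1) with hq
  obtain ⟨v1, v2, v3, v4⟩ := splitFun_values (s := s)
  let g : Corner (ι ⊕ Bool) → ℤ := fun c => f c - p * s.splitFun c - q * s.splitFun (revEdge c)
  have hg : s.result.EdgeInvariant g := fun σ x y k h1 h2 h3 => by
    have h := (edgeInvariant_splitFun (s := s)).rev σ x y k h1 h2 h3
    dsimp only at h
    simp only [g]
    rw [hf σ x y k h1 h2 h3, edgeInvariant_splitFun σ x y k h1 h2 h3, h]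
  have r1 (t : Bool) : revEdge (edge (Sum.inr t : ι ⊕ Bool) 0 1) = edge (Sum.inr t) 1 0 :=
    revEdge_edge _ (by decide)
  have r2 (t : Bool) : revEdge (edge (Sum.inr t : ι ⊕ Bool) 1 0) = edge (Sum.inr t) 0 1 :=
    revEdge_edge _ (by decide)
  have h1 := mem_Q_iff.1 hS _ (edgeInvariant_restrict hg
    (by simp only [g, r1, r2, v1, v2, v3, v4, hp]; ring)
    (by simp only [g, r1, r2, v1, v2, v3, v4, hq]; ring))
  have h2 : (edgeSum fun c : Corner ι => f (inlCorner c)) =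
      (edgeSum fun c : Corner ι => g (inlCorner c)) +
        (p + q) • edgeSum fun c : Corner ι => s.splitFun (inlCorner c) := by
    have : (fun c : Corner ι => f (inlCorner c)) = (fun c : Corner ι => g (inlCorner c)) +
        (p • (fun c : Corner ι => s.splitFun (inlCorner c)) +
        q • fun c : Corner ι => s.splitFun (inlCorner (revEdge c))) := by
      funext c
      simp only [g, Pi.add_apply, Pi.smul_apply, smul_eq_mul, inlCorner, revEdge]
      ring
    rw [this, edgeSum_add, edgeSum_add, edgeSum_smul, edgeSum_smul,
      edgeSum_rev fun c : Corner ι => s.splitFun (inlCorner c), add_smul]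
  rw [h2, dot_add_left, h1, dot_smul_left, splitShear, zero_add]
  congr 1
  rw [hp, hq]
  ring

variable (s) in
/-- The class after the move that agrees with a given class on the common tetrahedra. -/
noncomputable def liftFun (S : ι → Fin 3 → ℤ) : ι ⊕ Bool → Fin 3 → ℤ :=
  Sum.elim S fun t => if t then ![0, 0, s.splitShear S] else ![0, s.splitShear S, 0]

/-- The coordinates chosen in `A` and `B` give the shears `-splitShear` and `+splitShear` along the
two parts of the split edge. They compensate the remainder found in `dot_edgeSum_inl`; all other
shears of the pillow cancel. -/
theorem liftFun_mem {S : ι → Fin 3 → ℤ} (hS : S ∈ T.Q) : s.liftFun S ∈ s.result.Q := by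
  refine mem_Q_iff.2 fun f hf => ?_
  rw [dot_edgeSum_result hf]
  have h := dot_edgeSum_inl hf hS
  have h1 : restrict (s.liftFun S) = S := rfl
  rw [h1, h]
  simp [shear, liftFun]
  ring

theorem splitShear_add (S S' : ι → Fin 3 → ℤ) :
    s.splitShear (S + S') = s.splitShear S + s.splitShear S' := by
  rw [splitShear, shear_add, dot_add_right]
  rfl

variable (s) in
/-- The lift of classes. -/
noncomputable def lift : T.Q →+ s.result.Q where
  toFun S := ⟨s.liftFun S, liftFun_mem S.2⟩
  map_zero' := by
    apply Subtype.ext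
    funext τ k
    have : s.splitShear (0 : ι → Fin 3 → ℤ) = 0 := by
      have := splitShear_add (s := s) 0 0
      rw [add_zero] at this
      linarith
    rcases τ with σ | t
    · rfl
    · cases t <;> simp [liftFun, this] <;> fin_cases k <;> simp
  map_add' S S' := by
    apply Subtype.ext
    funext τ k
    rcases τ with σ | t
    · rfl
    · cases t <;> simp [liftFun, splitShear_add] <;> fin_cases k <;> simp

theorem coe_lift (S : T.Q) : (s.lift S : ι ⊕ Bool → Fin 3 → ℤ) = s.liftFun S := rfl

variable {S : ι ⊕ Bool → Fin 3 → ℤ}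

/-- The matching equation at the new edge, obtained from the test function that is 1 on this edge
and 0 elsewhere. -/
theorem shear_add_shear (hS : S ∈ s.result.Q) :
    shear S (Sum.inr false) 0 + shear S (Sum.inr true) 0 = 0 := by
  have hc : T.EdgeInvariant fun _ : Corner ι => (0 : ℤ) := fun _ _ _ _ _ _ _ => rfl
  have h1 := edgeInvariant_extend (s := s) hc 1
  have h2 := mem_Q_iff.1 hS _ h1
  rw [dot_edgeSum_result h1] at h2
  obtain ⟨e1, e2, e3, e4⟩ := edgeSum_inr h1
  have h0 : (fun c : Corner ι => s.extend (fun _ => 0) 1 (inlCorner c)) = fun _ => (0 : ℤ) := rfl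
  have d1 : dot (edgeSum fun _ : Corner ι => 0) (shear (restrict S)) = 0 := by
    simp [dot, edgeSum]
  have d2 : ∀ k : Fin 3, k = 1 ∨ k = 2 →
      edgeSum (s.extend (fun _ => 0) 1) (Sum.inr false) k = (0 : ℤ) := by
    rintro k (rfl | rfl) <;> refine Finset.sum_eq_zero fun v _ => ?_ <;>
      simp only [extend] <;> revert v <;> decide
  rw [h0, d1, d2 1 (Or.inl rfl), d2 2 (Or.inr rfl)] at h2
  simp only [extend_inr (s := s) (fun _ : Corner ι => (0 : ℤ)) 1 _ (show (0 : Fin 4) ≠ 1 by decide),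
    extend_inr (s := s) (fun _ : Corner ι => (0 : ℤ)) 1 _ (show (1 : Fin 4) ≠ 0 by decide),
    extend_inr (s := s) (fun _ : Corner ι => (0 : ℤ)) 1 _ (show (2 : Fin 4) ≠ 3 by decide),
    extend_inr (s := s) (fun _ : Corner ι => (0 : ℤ)) 1 _ (show (3 : Fin 4) ≠ 2 by decide)] at h2
  simp at h2
  linarith

/-- With the equation at the new edge, and since the shears of a tetrahedron add up to zero, one
more condition makes `B` the mirror image of `A`. The defect is this condition. -/
theorem shear_of_defect (hS : S ∈ s.result.Q) (hd : defect S = 0) :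
    shear S (Sum.inr true) 0 = -shear S (Sum.inr false) 0 ∧
    shear S (Sum.inr true) 1 = -shear S (Sum.inr false) 2 ∧
    shear S (Sum.inr true) 2 = -shear S (Sum.inr false) 1 := by
  have h := shear_add_shear hS
  simp only [shear, defect, zero_add, Fin.isValue, Fin.reduceAdd] at h hd ⊢
  refine ⟨?_, ?_, ?_⟩ <;> linarith

theorem shear_eq_splitShear (hS : S ∈ s.result.Q) (hd : defect S = 0) :
    shear S (Sum.inr false) 0 = -s.splitShear (restrict S) := by
  obtain ⟨h1, h2, h3⟩ := shear_of_defect hS hd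
  have h := mem_Q_iff.1 hS _ edgeInvariant_splitFun
  obtain ⟨v1, v2, v3, v4⟩ := splitFun_values (s := s)
  rw [dot_edgeSum_result edgeInvariant_splitFun, h1, h2, h3, v1, v2, v3, v4] at h
  change s.splitShear (restrict S) + _ + _ + _ + _ + _ = 0 at h
  linarith

/-- Every test function on `T` extends to the new triangulation with equal values on the two parts
of the split edge, and the cancelling shears of `A` and `B` then contribute nothing. -/
theorem restrict_mem (hS : S ∈ s.result.Q) (hd : defect S = 0) : restrict S ∈ T.Q := by
  obtain ⟨h1, h2, h3⟩ := shear_of_defect hS hd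
  refine mem_Q_iff.2 fun f hf => ?_
  have hi := edgeInvariant_extend (s := s) hf 0
  have h := mem_Q_iff.1 hS _ hi
  obtain ⟨k1, k2⟩ := extend_split (s := s) hf 0
  rw [dot_edgeSum_result hi, h1, h2, h3, k1, k2] at h
  change dot (edgeSum f) (shear (restrict S)) + _ + _ + _ + _ + _ = 0 at h
  linarith

variable (s) in
/-- The edge solution of the new edge as a Q-normal class. -/
noncomputable def newEdge : s.result.Q :=
  ⟨newEdgeSol, newEdgeSol_eq (s := s) ▸ s.result.edgeSol_mem_Q _⟩

/-- The lift has coordinates `(0,x,0)` in `A` and `(0,0,x)` in `B`. The two tetrahedral solutions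
restore the coordinate 2 of `A` and the coordinate 1 of `B`, the new edge solution restores the
coordinate 0, and the vanishing defect together with the matching equations settles the rest. -/
theorem eq_lift_add (S : s.result.Q) (hd : defect S.1 = 0) :
    S = s.lift ⟨restrict S.1, restrict_mem S.2 hd⟩ +
      S.1 (Sum.inr false) 2 • s.result.tetSol (Sum.inr false) +
      S.1 (Sum.inr true) 1 • s.result.tetSol (Sum.inr true) +
      (S.1 (Sum.inr false) 0 - S.1 (Sum.inr false) 2) • s.newEdge := by
  apply Subtype.ext
  have h1 := shear_eq_splitShear S.2 hd
  have h2 := shear_add_shear S.2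
  obtain ⟨S, hS⟩ := S
  dsimp only at *
  simp only [shear, defect, zero_add, Fin.isValue] at h1 h2 hd
  funext τ k
  simp only [AddSubgroup.coe_add, AddSubgroup.coe_zsmul, coe_lift, newEdge, tetSol,
    Pi.add_apply, Pi.smul_apply, liftFun, newEdgeSol]
  rcases τ with σ | t
  · simp [restrict]
  · cases t <;> fin_cases k <;> simp <;> linarith

end ZeroTwoSite

end Triangulation

end Index3D

/-! ### The formal Euler characteristic of lifted edge and tetrahedral solutions -/

namespace Index3D

namespace Triangulation

variable {ι : Type*} {T : Triangulation ι}

namespace ZeroTwoSite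

variable {s : T.ZeroTwoSite}

variable (s) in
/-- The class of the first or second part of the split edge, with the orientation of the edge `uv`
or the opposite one. -/
noncomputable def splitClass (first forward : Bool) : s.result.OrEdge :=
  match first, forward with
  | true, true => s.result.orEdge (edge (Sum.inr false) 0 1)
  | true, false => s.result.orEdge (edge (Sum.inr false) 1 0)
  | false, true => s.result.orEdge (edge (Sum.inr true) 1 0)
  | false, false => s.result.orEdge (edge (Sum.inr true) 0 1)

theorem splitClass_injective [Finite ι] {i j i' j' : Bool} (h : s.splitClass i j = s.splitClass i' j') :
    i = i' ∧ j = j' := by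
  have r (t : Bool) : revEdge (edge (Sum.inr t : ι ⊕ Bool) 0 1) = edge (Sum.inr t) 1 0 :=
    revEdge_edge _ (by decide)
  have r' (t : Bool) : revEdge (edge (Sum.inr t : ι ⊕ Bool) 1 0) = edge (Sum.inr t) 0 1 :=
    revEdge_edge _ (by decide)
  have h1 : s.splitClass true false ≠ s.splitClass true true := fun h =>
    absurd (s.orEdge_split_ne (Or.inr ⟨rfl, rfl⟩) h).2.1 (by decide)
  have h2 : s.splitClass false true ≠ s.splitClass true true := fun h =>
    absurd (s.orEdge_split_ne (Or.inr ⟨rfl, rfl⟩) h).1 (by decide)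
  have h3 : s.splitClass false false ≠ s.splitClass true true := fun h =>
    absurd (s.orEdge_split_ne (Or.inl ⟨rfl, rfl⟩) h).1 (by decide)
  have h4 : s.splitClass false false ≠ s.splitClass false true :=
    orEdge_ne_orEdge_rev _ (by decide)
  have h5 : s.splitClass false true ≠ s.splitClass true false := fun h => by
    have := orEdge_revEdge h
    rw [r', r'] at this
    exact h3 this
  have h6 : s.splitClass false false ≠ s.splitClass true false := fun h => by
    have := orEdge_revEdge h
    rw [r, r'] at this
    exact h2 this
  cases i <;> cases j <;> cases i' <;> cases j' <;> simp_all [eq_comm]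

/-- Two classes after the move lie in the same class before the move. -/
def Merged (x y : s.result.OrEdge) : Prop :=
  x = y ∨ ∃ j, (∃ i, x = s.splitClass i j) ∧ ∃ i, y = s.splitClass i j

theorem Merged.swap [Finite ι] {i j : Bool} {y : s.result.OrEdge} (h : Merged (s.splitClass i j) y) :
    Merged (s.splitClass (!i) j) y := by
  rcases h with rfl | ⟨j', ⟨i', h⟩, i'', rfl⟩
  · exact Or.inr ⟨j, ⟨_, rfl⟩, _, rfl⟩
  · rw [(splitClass_injective h).2]
    exact Or.inr ⟨j', ⟨_, rfl⟩, _, rfl⟩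

theorem merged_of_orEdge_eq [Finite ι] {c d : Corner ι} (h : T.orEdge c = T.orEdge d) :
    Merged (s.result.orEdge (inlCorner c)) (s.result.orEdge (inlCorner d)) := by
  have hinv := s.result.edgeInvariant_orEdge.comp
    fun x => Merged x (s.result.orEdge (inlCorner d))
  have hT := edgeInvariant_restrict hinv
    (propext ⟨Merged.swap (i := true) (j := true), Merged.swap (i := false) (j := true)⟩)
    (propext ⟨Merged.swap (i := true) (j := false), Merged.swap (i := false) (j := false)⟩)
  exact (hT.eq_of_orEdge_eq h).mpr (Or.inl rfl)

theorem extend_splitClass {X : Type*} {f : Corner ι → X} (hf : T.EdgeInvariant f) (d : X) (i j : Bool) :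
    (edgeInvariant_extend (s := s) hf d).lift (s.splitClass i j) =
      s.extend f d (edge (Sum.inr false) (if j then 0 else 1) (if j then 1 else 0)) := by
  obtain ⟨k1, k2⟩ := extend_split (s := s) hf d
  cases i <;> cases j
  · exact k2
  · exact k1
  · rfl
  · rfl

-- The extended indicator of an edge class is again an indicator: of a single class, or of both
-- parts of the split edge with the same orientation.
open Classical in
theorem extend_indicator [Finite ι] (c₀ : Corner ι) (c : Corner (ι ⊕ Bool)) :
    s.extend (fun c => if T.orEdge c = T.orEdge c₀ then (1 : ℤ) else 0) 0 c =
      if Merged (s.result.orEdge c) (s.result.orEdge (inlCorner c₀)) then 1 else 0 := by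
  have hf : T.EdgeInvariant fun c => if T.orEdge c = T.orEdge c₀ then (1 : ℤ) else 0 :=
    T.edgeInvariant_orEdge.comp fun x => if x = T.orEdge c₀ then (1 : ℤ) else 0
  have hF := edgeInvariant_extend (s := s) hf 0
  have h1 : s.extend (fun c => if T.orEdge c = T.orEdge c₀ then (1 : ℤ) else 0) 0
      (inlCorner c₀) = 1 := if_pos rfl
  split_ifs with h
  · rcases h with h | ⟨j, ⟨i, h⟩, i', h'⟩
    · rw [hF.eq_of_orEdge_eq h, h1]
    · have e1 := hF.lift_orEdge c
      have e2 := hF.lift_orEdge (inlCorner c₀)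
      rw [← e1, h, extend_splitClass hf, ← extend_splitClass hf 0 i', ← h', e2, h1]
  · obtain ⟨σ | t, v, k⟩ := c
    · refine if_neg fun he => h ?_
      exact merged_of_orEdge_eq (s := s) he
    · have hne := (mate_ne k v).symm
      rw [← edge_mate, extend_inr _ _ _ hne]
      split_ifs with h2 h3
      · rfl
      · refine absurd ?_ h
        obtain ⟨a1, a2, a3⟩ := oldFace_spec _ _ hne h2
        have := merged_of_orEdge_eq (s := s) h3
        have e := edge_attach (s := s) s.result.edgeInvariant_orEdge t a1 hne a2 a3
        rw [edge_mate] at e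
        rw [← e]
        exact this
      · rfl

variable [Fintype ι] {χ : s.result.Q →+ ℤ}

theorem euler_of_defect (hχ : s.result.IsFormalEuler χ) (S : s.result.Q) (hd : defect S.1 = 0) :
    χ S = χ (s.lift ⟨restrict S.1, restrict_mem S.2 hd⟩) - S.1 (Sum.inr false) 2 -
      S.1 (Sum.inr true) 1 - 2 * (S.1 (Sum.inr false) 0 - S.1 (Sum.inr false) 2) := by
  conv_lhs => rw [eq_lift_add S hd]
  simp only [map_add, map_zsmul, hχ.tet]
  rw [hχ.edge _ s.newEdge newEdgeSol_eq.symm]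
  simp only [smul_eq_mul]
  ring

/-- The extension of the edge solution differs from the lift by multiples of new solutions, and by
`euler_of_defect` its Euler characteristic is that of the lift minus twice its coordinate 0 in `A`.
For an edge that is not split this coordinate is 0 and the extension is one edge solution. For the
split edge the coordinate is 1 and the extension is a sum of two edge solutions, so that `-4 = χ -
2`. -/
theorem euler_lift_edgeSol (hχ : s.result.IsFormalEuler χ) (e : T.OrEdge) (S : T.Q)
    (hS : S.1 = T.edgeSol e) : χ (s.lift S) = -2 := by
  classical
  induction e using Quot.ind with | mk c₀ => ?_
  change S.1 = T.edgeSol (T.orEdge c₀) at hS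
  have hf : T.EdgeInvariant fun c => if T.orEdge c = T.orEdge c₀ then (1 : ℤ) else 0 :=
    T.edgeInvariant_orEdge.comp fun x => if x = T.orEdge c₀ then (1 : ℤ) else 0
  have hF := edgeInvariant_extend (s := s) hf 0
  have hval := extend_indicator (s := s) c₀
  have hR : restrict (edgeSum (s.extend (fun c => if T.orEdge c = T.orEdge c₀ then (1 : ℤ) else 0) 0))
      = T.edgeSol (T.orEdge c₀) := by
    rw [edgeSol_eq_edgeSum]
    rfl
  obtain ⟨i1, i2, i3, i4⟩ := edgeSum_inr hF
  have hn1 : s.extend (fun c => if T.orEdge c = T.orEdge c₀ then (1 : ℤ) else 0) 0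
      (edge (Sum.inr false) 2 3) = 0 := by rw [extend_inr _ _ _ (by decide)]; simp
  have hn2 : s.extend (fun c => if T.orEdge c = T.orEdge c₀ then (1 : ℤ) else 0) 0
      (edge (Sum.inr false) 3 2) = 0 := by rw [extend_inr _ _ _ (by decide)]; simp
  obtain ⟨hs1, hs2⟩ := extend_split (s := s) hf 0
  have hd : defect (edgeSum (s.extend (fun c => if T.orEdge c = T.orEdge c₀ then (1 : ℤ) else 0) 0))
      = 0 := by
    rw [defect, i2, i3, i4, hs1, hs2]
    ring
  have hE := euler_of_defect hχ ⟨_, edgeSum_mem_Q hF⟩ hd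
  have hL : (⟨restrict _, restrict_mem (edgeSum_mem_Q hF) hd⟩ : T.Q) = S :=
    Subtype.ext (hR.trans hS.symm)
  rw [hL] at hE
  dsimp only at hE
  rw [i1, i3, hn1, hn2] at hE
  rw [hval, hval] at hE
  change _ = _ - _ - _ - 2 * ((if Merged (s.splitClass true true) _ then 1 else 0) +
    (if Merged (s.splitClass true false) _ then 1 else 0) + _ - _) at hE
  by_cases hx : ∃ i j, s.result.orEdge (inlCorner c₀) = s.splitClass i j
  · obtain ⟨i, j, hx⟩ := hx
    have hm : ∀ y, Merged y (s.result.orEdge (inlCorner c₀)) ↔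
        y = s.splitClass true j ∨ y = s.splitClass false j := by
      intro y
      rw [hx]
      constructor
      · rintro (rfl | ⟨j', ⟨i', rfl⟩, i'', h⟩)
        · cases i <;> simp
        · rw [(splitClass_injective h).2]
          cases i' <;> simp
      · rintro (rfl | rfl)
        · exact Or.inr ⟨j, ⟨_, rfl⟩, _, rfl⟩
        · exact Or.inr ⟨j, ⟨_, rfl⟩, _, rfl⟩
    have hsum : (⟨_, edgeSum_mem_Q hF⟩ : s.result.Q) =
        ⟨_, s.result.edgeSol_mem_Q (s.splitClass true j)⟩ +
        ⟨_, s.result.edgeSol_mem_Q (s.splitClass false j)⟩ := by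
      apply Subtype.ext
      simp only [AddSubgroup.coe_add, edgeSol_eq_edgeSum]
      rw [← edgeSum_add]
      congr 1
      funext c
      rw [hval c]
      simp only [hm, Pi.add_apply]
      by_cases h1 : s.result.orEdge c = s.splitClass true j
      · have : s.splitClass true j ≠ s.splitClass false j := fun h =>
          absurd (splitClass_injective h).1 (by decide)
        simp [h1, this]
      · simp [h1]
    rw [hsum, map_add, hχ.edge _ _ rfl, hχ.edge _ _ rfl] at hE
    simp only [hm] at hE
    have h1 : s.splitClass true true ≠ s.splitClass true false := fun h =>
      absurd (splitClass_injective h).2 (by decide)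
    have h2 : s.splitClass true true ≠ s.splitClass false false := fun h =>
      absurd (splitClass_injective h).2 (by decide)
    have h3 : s.splitClass true false ≠ s.splitClass false true := fun h =>
      absurd (splitClass_injective h).2 (by decide)
    cases j
    · simp [h1, h2] at hE
      linarith
    · simp [h1.symm, h3] at hE
      linarith
  · push Not at hx
    have hm : ∀ y, Merged y (s.result.orEdge (inlCorner c₀)) ↔
        y = s.result.orEdge (inlCorner c₀) :=
      fun y => ⟨fun h => h.resolve_right fun ⟨j, _, i, h⟩ => hx i j h, Or.inl⟩
    have hsum : (⟨_, edgeSum_mem_Q hF⟩ : s.result.Q) =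
        ⟨_, s.result.edgeSol_mem_Q (s.result.orEdge (inlCorner c₀))⟩ := by
      apply Subtype.ext
      simp only [edgeSol_eq_edgeSum]
      congr 1
      funext c
      rw [hval c]
      simp only [hm]
    rw [hsum, hχ.edge _ _ rfl] at hE
    simp only [hm, (hx _ _).symm, if_false] at hE
    linarith

theorem euler_lift_tetSol (hχ : s.result.IsFormalEuler χ) (σ : ι) : χ (s.lift (T.tetSol σ)) = -1 := by
  rw [← hχ.tet (Sum.inl σ)]
  congr 1
  apply Subtype.ext
  have h0 : s.splitShear (T.tetSol σ).1 = 0 := by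
    simp [splitShear, dot, shear, tetSol]
  funext τ k
  rcases τ with τ | t
  · by_cases h : τ = σ <;> simp [coe_lift, liftFun, tetSol, h]
  · have h1 : (s.result.tetSol (Sum.inl σ)).1 (Sum.inr t) k = 0 := if_neg (by simp)
    rw [h1, coe_lift, liftFun, h0]
    cases t <;> fin_cases k <;> simp

end ZeroTwoSite

end Triangulation

end Index3D

namespace Index3D

namespace Triangulation

variable {ι : Type*} {T : Triangulation ι} {M : Type*} [AddCommGroup M]

/-! ### Cocycles and the homology of the boundary -/

/-- Flows with values in `M` are the homomorphisms from chains to `M` that vanish on boundaries. -/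
theorem IsFlow.linearCombination_eq_zero {w : Corner ι → M} (hw : T.IsFlow w) {x : Corner ι →₀ ℤ}
    (hx : x ∈ T.peripheralBoundaries) : Finsupp.linearCombination ℤ w x = 0 := by
  change x ∈ LinearMap.ker (Finsupp.linearCombination ℤ w)
  refine Submodule.span_le.2 ?_ hx
  rintro _ (⟨y, rfl⟩ | ⟨c, rfl⟩)
  · simpa using hw.sum y.1 y.2
  · simp [hw.glue]

theorem IsFlow.map {N : Type*} [AddCommGroup N] {w : Corner ι → M} (hw : T.IsFlow w) (φ : M →+ N) :
    T.IsFlow fun c => φ (w c) :=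
  ⟨fun c => by rw [hw.glue, map_neg], fun σ v => by rw [← map_sum, hw.sum, map_zero]⟩

variable (T) in
/-- The class of a side modulo boundaries. -/
noncomputable def sideClass (c : Corner ι) : (Corner ι →₀ ℤ) ⧸ T.peripheralBoundaries :=
  Submodule.Quotient.mk (Finsupp.single c 1)

-- This is the universal flow; applied to it, statements about flows become statements about chains
-- modulo boundaries.
variable (T) in
theorem isFlow_sideClass : T.IsFlow T.sideClass := by
  constructor
  · intro c
    rw [eq_neg_iff_add_eq_zero, add_comm, sideClass, sideClass, ← Submodule.Quotient.mk_add,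
      Submodule.Quotient.mk_eq_zero]
    exact Submodule.subset_span (Or.inr ⟨c, rfl⟩)
  · intro σ v
    have : ∑ k, T.sideClass (σ, v, k) =
        Submodule.Quotient.mk (∑ k : Fin 3, Finsupp.single ((σ, v, k) : Corner ι) (1 : ℤ)) :=
      (map_sum T.peripheralBoundaries.mkQ _ _).symm
    rw [this, Submodule.Quotient.mk_eq_zero]
    exact Submodule.subset_span (Or.inl ⟨(σ, v), rfl⟩)

theorem linearCombination_sideClass (x : Corner ι →₀ ℤ) :
    Finsupp.linearCombination ℤ T.sideClass x = Submodule.Quotient.mk x := by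
  have : Finsupp.linearCombination ℤ T.sideClass = T.peripheralBoundaries.mkQ := by
    ext c
    simp [sideClass]
  rw [this]
  rfl

-- The boundary of a boundary vanishes, and glued sides have the same end points in opposite order.
variable (T) in
theorem isFlow_sideBoundary : T.IsFlow fun c => T.sideBoundary (Finsupp.single c 1) := by
  have h : ∀ c : Corner ι, T.sideBoundary (Finsupp.single c 1) =
      Finsupp.single (T.orEdge (sideEnd c)) 1 - Finsupp.single (T.orEdge (sideStart c)) 1 := by
    intro c
    simp [sideBoundary, sideEnd, sideStart]
  constructor
  · intro c
    rw [h, h, T.edgeInvariant_orEdge.sideEnd_glue, T.edgeInvariant_orEdge.sideStart_glue]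
    abel
  · intro σ v
    simp only [h, Fin.sum_univ_three, sideEnd, sideStart, Fin.isValue, Fin.reduceAdd, zero_add]
    abel

theorem linearCombination_sideBoundary (x : Corner ι →₀ ℤ) :
    Finsupp.linearCombination ℤ (fun c => T.sideBoundary (Finsupp.single c 1)) x =
      T.sideBoundary x := by
  have : Finsupp.linearCombination ℤ (fun c => T.sideBoundary (Finsupp.single c 1)) =
      T.sideBoundary := by
    ext c
    simp
  rw [this]

theorem sideBoundary_edge {σ : ι} {x y y1 y2 : Fin 4} (h1 : quadOf x y1 = quadOf x y + 1)
    (h2 : quadOf x y2 = quadOf x y + 2) : T.sideBoundary (Finsupp.single (edge σ x y) 1) =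
      Finsupp.single (T.orEdge (edge σ x y2)) 1 - Finsupp.single (T.orEdge (edge σ x y1)) 1 := by
  simp [sideBoundary, edge, h1, h2]

namespace ZeroTwoSite

variable {s : T.ZeroTwoSite}

variable (s) in
/-- The side near the vertex `x` in the face of `T` to which the face `j` of a new tetrahedron is
glued. -/
def oldSide (t : Bool) (j x : Fin 4) : Corner ι :=
  edge (s.attach t j).1 ((s.attach t j).2 x) ((s.attach t j).2 j)

theorem sideGlue_oldSide (t : Bool) {j x : Fin 4} (hj : j = 2 ∨ j = 3) (hx : x ≠ j) :
    T.sideGlue (s.oldSide t j x) = s.oldSide (!t) j (Equiv.swap 0 1 x) := by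
  have hs : Equiv.swap (0 : Fin 4) 1 j = j := by rcases hj with rfl | rfl <;> decide
  rw [oldSide, sideGlue_edge T _ ((s.attach t j).2.injective.ne hx), oldSide, s.attach_not t j hj]
  simp only [Equiv.Perm.mul_apply, Equiv.swap_apply_self, hs]
  rfl

theorem sideGlue_result_oldSide (t : Bool) {j x : Fin 4} (hj : j = 2 ∨ j = 3) (hx : x ≠ j) :
    s.result.sideGlue (inlCorner (s.oldSide t j x)) = edge (Sum.inr t) x j := by
  have h := s.result_target t j hj
  simp only [target] at h
  change s.result.sideGlue (edge (Sum.inl (s.attach t j).1) ((s.attach t j).2 x)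
    ((s.attach t j).2 j)) = _
  rw [sideGlue_edge _ _ ((s.attach t j).2.injective.ne hx), h.1, h.2, perm_inv_apply,
    perm_inv_apply]

theorem sideGlue_result_new (t : Bool) {j x : Fin 4} (hj : j = 2 ∨ j = 3) (hx : x ≠ j) :
    s.result.sideGlue (edge (Sum.inr t) x j) = inlCorner (s.oldSide t j x) := by
  rw [← sideGlue_result_oldSide t hj hx, sideGlue_sideGlue]

theorem sideGlue_result_pillow (t : Bool) {h x : Fin 4} (hh : h = 0 ∨ h = 1) (hx : x ≠ h) :
    s.result.sideGlue (edge (Sum.inr t) x h) =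
      edge (Sum.inr (!t)) (Equiv.swap 0 1 x) (Equiv.swap 0 1 h) := by
  rw [sideGlue_edge _ _ hx, (s.result_pillow t h hh).1, (s.result_pillow t h hh).2]

theorem sideGlue_result_old {c : Corner ι}
    (hc : ∀ t j x, (j = 2 ∨ j = 3) → x ≠ j → c ≠ s.oldSide t j x) :
    s.result.sideGlue (inlCorner c) = inlCorner (T.sideGlue c) := by
  obtain ⟨σ, v, k⟩ := c
  have hne := (mate_ne k v).symm
  have h : ∀ t j, (j = 2 ∨ j = 3) → (σ, mate k v) ≠ s.target t j := by
    intro t j hj he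
    obtain ⟨x, hx⟩ := (s.attach t j).2.surjective v
    obtain ⟨h1, h2⟩ := Prod.mk.inj he
    refine hc t j x hj ?_ ?_
    · rintro rfl
      exact hne (hx.symm.trans h2.symm)
    · rw [oldSide, hx, ← h2, ← h1, edge_mate]
  rw [← edge_mate]
  change s.result.sideGlue (edge (Sum.inl σ) v (mate k v)) = _
  rw [sideGlue_edge _ _ hne, sideGlue_edge _ _ hne, (s.result_old _ _ h).1, (s.result_old _ _ h).2]
  rfl

/-! #### Extension of cocycles -/

variable (s) in
/-- The extension of a cocycle to the triangulation after the move. -/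
def extendFlow (w : Corner ι → M) : Corner (ι ⊕ Bool) → M
  | (Sum.inl σ, v, k) => w (σ, v, k)
  | (Sum.inr t, v, k) =>
    if mate k v = 2 ∨ mate k v = 3 then -w (s.oldSide t (mate k v) v)
    else if v = 0 ∨ v = 1 then w (s.oldSide t 2 v) + w (s.oldSide t 3 v)
    else if mate k v = (if t then 1 else 0) then w (s.oldSide t (if v = 2 then 3 else 2) v) else 0

theorem extendFlow_inr (w : Corner ι → M) (t : Bool) {x y : Fin 4} (h : x ≠ y) :
    s.extendFlow w (edge (Sum.inr t) x y) =
    if y = 2 ∨ y = 3 then -w (s.oldSide t y x)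
    else if x = 0 ∨ x = 1 then w (s.oldSide t 2 x) + w (s.oldSide t 3 x)
    else if y = (if t then 1 else 0) then w (s.oldSide t (if x = 2 then 3 else 2) x) else 0 := by
  simp only [edge, extendFlow, mate_quadOf x y h]

/-- The values at the faces glued to `T`, and at the pillow sides near `u` and `v`, are forced. Near
`w₁` and `w₂` only the sum over the two pillow sides is determined; it is placed entirely on the
face 0 of `A`, which is glued to the face 1 of `B`. -/
theorem isFlow_extendFlow {w : Corner ι → M} (hw : T.IsFlow w) :
    s.result.IsFlow (s.extendFlow w) := by
  have hg : ∀ t j x, (j = 2 ∨ j = 3) → x ≠ j →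
      w (s.oldSide (!t) j (Equiv.swap 0 1 x)) = -w (s.oldSide t j x) := fun t j x hj hx => by
    rw [← sideGlue_oldSide t hj hx, hw.glue]
  constructor
  · rintro ⟨τ, v, k⟩
    have hne := (mate_ne k v).symm
    rcases τ with σ | t
    · by_cases hc : ∃ t j x, (j = 2 ∨ j = 3) ∧ x ≠ j ∧ (σ, v, k) = s.oldSide t j x
      · obtain ⟨t, j, x, hj, hx, hc⟩ := hc
        have h := sideGlue_result_oldSide (s := s) t hj hx
        rw [← hc] at h
        change s.result.sideGlue (Sum.inl σ, v, k) = _ at h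
        rw [h, extendFlow_inr w t hx, if_pos hj, ← hc]
        rfl
      · push Not at hc
        have h := sideGlue_result_old (s := s) (c := (σ, v, k))
          fun t j x hj hx => hc t j x hj hx
        change s.result.sideGlue (Sum.inl σ, v, k) = _ at h
        rw [h]
        exact hw.glue (σ, v, k)
    · rw [← edge_mate]
      generalize mate k v = y at hne ⊢
      by_cases hy : y = 2 ∨ y = 3
      · rw [sideGlue_result_new t hy hne, extendFlow_inr w t hne, if_pos hy, neg_neg]
        rfl
      · have hy' : y = 0 ∨ y = 1 := by clear hne; revert y; decide
        rw [sideGlue_result_pillow t hy' hne, extendFlow_inr w t hne,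
          extendFlow_inr w (!t) ((Equiv.swap (0 : Fin 4) 1).injective.ne hne)]
        have k1 : ∀ x : Fin 4, (Equiv.swap 0 1 x = 2 ∨ Equiv.swap 0 1 x = 3) ↔ (x = 2 ∨ x = 3) := by
          decide
        have k2 : ∀ x : Fin 4, (Equiv.swap 0 1 x = 0 ∨ Equiv.swap 0 1 x = 1) ↔ (x = 0 ∨ x = 1) := by
          decide
        have k3 : (Equiv.swap 0 1 y = if (!t) = true then 1 else 0) ↔
            (y = if t = true then 1 else 0) := by
          cases t <;> rcases hy' with rfl | rfl <;> decide
        have k4 : ∀ x : Fin 4, Equiv.swap 0 1 x = 2 ↔ x = 2 := by decide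
        simp only [k1 y, k2 v, k3, k4 v]
        rw [if_neg hy, if_neg hy]
        by_cases h1 : v = 0 ∨ v = 1
        · rw [if_pos h1, if_pos h1, hg t 2 v (Or.inl rfl) (by rcases h1 with rfl | rfl <;> decide),
            hg t 3 v (Or.inr rfl) (by rcases h1 with rfl | rfl <;> decide)]
          abel
        · rw [if_neg h1, if_neg h1]
          by_cases h3 : y = if t = true then 1 else 0
          · rw [if_pos h3, if_pos h3]
            have h4 : v = 2 ∨ v = 3 := by clear hne; revert v; decide
            rcases h4 with rfl | rfl
            · exact hg t 3 2 (Or.inr rfl) (by decide)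
            · exact hg t 2 3 (Or.inl rfl) (by decide)
          · rw [if_neg h3, if_neg h3, neg_zero]
  · rintro (σ | t) v
    · exact hw.sum σ v
    · simp only [extendFlow]
      rw [Fin.sum_univ_three]
      cases t <;> fin_cases v <;>
        simp (decide := true) [mate, Equiv.swap_apply_def]

/-! #### Cocycles after the move -/

theorem flow_new {w : Corner (ι ⊕ Bool) → M} (hw : s.result.IsFlow w)
    (t : Bool) {j x : Fin 4} (hj : j = 2 ∨ j = 3) (hx : x ≠ j) :
    w (inlCorner (s.oldSide t j x)) = -w (edge (Sum.inr t) x j) := by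
  rw [← hw.glue, sideGlue_result_new t hj hx]

theorem flow_pillow {w : Corner (ι ⊕ Bool) → M} (hw : s.result.IsFlow w)
    (t : Bool) {h x : Fin 4} (hh : h = 0 ∨ h = 1) (hx : x ≠ h) :
    w (edge (Sum.inr (!t)) (Equiv.swap 0 1 x) (Equiv.swap 0 1 h)) = -w (edge (Sum.inr t) x h) := by
  rw [← hw.glue, sideGlue_result_pillow t hh hx]

theorem flow_relations {w : Corner (ι ⊕ Bool) → M} (hw : s.result.IsFlow w) :
    (∀ t, w (edge (Sum.inr t) 0 1) + w (edge (Sum.inr t) 0 2) + w (edge (Sum.inr t) 0 3) = 0 ∧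
      w (edge (Sum.inr t) 1 0) + w (edge (Sum.inr t) 1 3) + w (edge (Sum.inr t) 1 2) = 0 ∧
      w (edge (Sum.inr t) 2 3) + w (edge (Sum.inr t) 2 0) + w (edge (Sum.inr t) 2 1) = 0 ∧
      w (edge (Sum.inr t) 3 2) + w (edge (Sum.inr t) 3 1) + w (edge (Sum.inr t) 3 0) = 0) ∧
    w (edge (Sum.inr true) 1 0) = -w (edge (Sum.inr false) 0 1) ∧
    w (edge (Sum.inr true) 0 1) = -w (edge (Sum.inr false) 1 0) ∧
    w (edge (Sum.inr true) 2 0) = -w (edge (Sum.inr false) 2 1) ∧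
    w (edge (Sum.inr true) 2 1) = -w (edge (Sum.inr false) 2 0) ∧
    w (edge (Sum.inr true) 3 0) = -w (edge (Sum.inr false) 3 1) ∧
    w (edge (Sum.inr true) 3 1) = -w (edge (Sum.inr false) 3 0) := by
  refine ⟨fun t => ?_, ?_⟩
  · have h0 := hw.sum (Sum.inr t)
    simp only [Fin.sum_univ_three, ← edge_mate] at h0
    exact ⟨h0 0, h0 1, h0 2, h0 3⟩
  · have h := fun h x hh hx => flow_pillow hw false (h := h) (x := x) hh hx
    exact ⟨h 1 0 (by decide) (by decide), h 0 1 (by decide) (by decide),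
      h 1 2 (by decide) (by decide), h 0 2 (by decide) (by decide),
      h 1 3 (by decide) (by decide), h 0 3 (by decide) (by decide)⟩

variable (s) in
/-- The sum of the values of a function at both sides of a face along which `M` is opened, near the
vertex `x` of the split edge. -/
def gap (w : Corner (ι ⊕ Bool) → M) (x : Fin 4) : M :=
  w (inlCorner (s.oldSide false 2 x)) + w (inlCorner (s.oldSide true 2 (Equiv.swap 0 1 x)))

theorem gap_eq {w : Corner (ι ⊕ Bool) → M} (hw : s.result.IsFlow w) :
    s.gap w 0 = -w (edge (Sum.inr false) 0 2) - w (edge (Sum.inr true) 1 2) ∧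
    s.gap w 1 = -w (edge (Sum.inr false) 1 2) - w (edge (Sum.inr true) 0 2) := by
  simp only [gap, Equiv.swap_apply_left, Equiv.swap_apply_right]
  constructor
  · rw [flow_new hw _ (by decide) (by decide), flow_new hw _ (by decide) (by decide)]
    abel
  · rw [flow_new hw _ (by decide) (by decide), flow_new hw _ (by decide) (by decide)]
    abel

/-- The two gaps say that the copies of `F₂` cancel near `u` and `v`. The relations of the
truncation triangles of `A` and `B` carry this over to the copies of `F₁`, and they give the
cancellation at `w₁` and `w₂` without any assumption on the gaps. -/
theorem flow_add {w : Corner (ι ⊕ Bool) → M} (hw : s.result.IsFlow w) (h0 : s.gap w 0 = 0)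
    (h1 : s.gap w 1 = 0) (j x : Fin 4) (hj : j = 2 ∨ j = 3) (hx : x ≠ j) :
    w (edge (Sum.inr false) x j) + w (edge (Sum.inr true) (Equiv.swap 0 1 x) j) = 0 := by
  obtain ⟨g0, g1⟩ := gap_eq hw
  rw [h0] at g0
  rw [h1] at g1
  obtain ⟨ht, p1, p2, p3, p4, p5, p6⟩ := flow_relations hw
  obtain ⟨a1, a2, a3, a4⟩ := ht false
  obtain ⟨b1, b2, b3, b4⟩ := ht true
  rw [p1] at b2
  rw [p2] at b1
  rw [p3, p4] at b3
  rw [p5, p6] at b4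
  have s2 : Equiv.swap (0 : Fin 4) 1 2 = 2 := by decide
  have s3 : Equiv.swap (0 : Fin 4) 1 3 = 3 := by decide
  rcases hj with rfl | rfl <;> fin_cases x <;>
    simp only [Fin.isValue, Fin.zero_eta, Fin.mk_one, Fin.reduceFinMk, Equiv.swap_apply_left,
      Equiv.swap_apply_right, s2, s3] at hx ⊢
  · linear_combination (norm := module) g0
  · linear_combination (norm := module) g1
  · exact absurd rfl hx
  · linear_combination (norm := module) a4 + b4
  · linear_combination (norm := module) a1 + b2 - g0
  · linear_combination (norm := module) a2 + b1 - g1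
  · linear_combination (norm := module) a3 + b3
  · exact absurd rfl hx

theorem isFlow_restrict {w : Corner (ι ⊕ Bool) → M} (hw : s.result.IsFlow w) (h0 : s.gap w 0 = 0)
    (h1 : s.gap w 1 = 0) : T.IsFlow fun c => w (inlCorner c) := by
  constructor
  · intro c
    by_cases hc : ∃ t j x, (j = 2 ∨ j = 3) ∧ x ≠ j ∧ c = s.oldSide t j x
    · obtain ⟨t, j, x, hj, hx, rfl⟩ := hc
      have hx' : Equiv.swap 0 1 x ≠ j := (swap_ne j x hj hx.symm).symm
      rw [sideGlue_oldSide t hj hx, flow_new hw _ hj hx, flow_new hw _ hj hx', neg_inj,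
        eq_neg_iff_add_eq_zero]
      cases t
      · rw [add_comm]
        exact flow_add hw h0 h1 j x hj hx
      · have := flow_add hw h0 h1 j _ hj hx'
        rwa [Equiv.swap_apply_self] at this
    · push Not at hc
      rw [← hw.glue, sideGlue_result_old fun t j x hj hx => hc t j x hj hx]
  · exact fun σ v => hw.sum (Sum.inl σ) v

/-- The part of the boundary of a class that lies in the new tetrahedra. -/
theorem sum_new {w : Corner (ι ⊕ Bool) → M} (hw : s.result.IsFlow w) {S : ι ⊕ Bool → Fin 3 → ℤ}
    (hd : defect S = 0) (hs : shear S (Sum.inr false) 0 + shear S (Sum.inr true) 0 = 0) :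
    ∑ t : Bool, ∑ k, ∑ v, S (Sum.inr t) k • w (Sum.inr t, v, k) =
      (S (Sum.inr true) 1 - S (Sum.inr true) 2) • (s.gap w 0 - s.gap w 1) := by
  obtain ⟨g0, g1⟩ := gap_eq hw
  rw [g0, g1]
  obtain ⟨ht, p1, p2, p3, p4, p5, p6⟩ := flow_relations hw
  obtain ⟨a1, a2, a3, a4⟩ := ht false
  obtain ⟨b1, b2, b3, b4⟩ := ht true
  have e (t : Bool) (v : Fin 4) (k : Fin 3) : w (Sum.inr t, v, k) = w (edge (Sum.inr t) v (mate k v)) := by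
    rw [edge_mate]
  simp only [e, Fintype.sum_bool, Fin.sum_univ_three, Fin.sum_univ_four]
  have m : mate 0 0 = 1 ∧ mate 0 1 = 0 ∧ mate 0 2 = 3 ∧ mate 0 3 = 2 ∧ mate 1 0 = 2 ∧ mate 1 1 = 3 ∧
      mate 1 2 = 0 ∧ mate 1 3 = 1 ∧ mate 2 0 = 3 ∧ mate 2 1 = 2 ∧ mate 2 2 = 1 ∧ mate 2 3 = 0 := by
    decide
  obtain ⟨m1, m2, m3, m4, m5, m6, m7, m8, m9, m10, m11, m12⟩ := m
  simp only [m1, m2, m3, m4, m5, m6, m7, m8, m9, m10, m11, m12]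
  rw [p1] at b2
  rw [p2] at b1
  rw [p3, p4] at b3
  rw [p5, p6] at b4
  rw [p1, p2, p3, p4, p5, p6]
  simp only [defect, shear, zero_add, Fin.isValue] at hd hs
  obtain ⟨a, ha⟩ : ∃ a, S (Sum.inr false) 0 = a := ⟨_, rfl⟩
  obtain ⟨b, hb⟩ : ∃ b, S (Sum.inr false) 1 = b := ⟨_, rfl⟩
  obtain ⟨c, hc⟩ : ∃ c, S (Sum.inr false) 2 = c := ⟨_, rfl⟩
  obtain ⟨b', hb'⟩ : ∃ b, S (Sum.inr true) 1 = b := ⟨_, rfl⟩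
  have hc' : S (Sum.inr true) 2 = b - c + b' := by linarith
  have ha' : S (Sum.inr true) 0 = a - c + b' := by linarith
  rw [ha, hb, hc, hb', hc', ha']
  generalize w (edge (Sum.inr false) 0 1) = A01 at *
  generalize w (edge (Sum.inr false) 0 2) = A02 at *
  generalize w (edge (Sum.inr false) 0 3) = A03 at *
  generalize w (edge (Sum.inr false) 1 0) = A10 at *
  generalize w (edge (Sum.inr false) 1 2) = A12 at *
  generalize w (edge (Sum.inr false) 1 3) = A13 at *
  generalize w (edge (Sum.inr false) 2 0) = A20 at *
  generalize w (edge (Sum.inr false) 2 1) = A21 at *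
  generalize w (edge (Sum.inr false) 2 3) = A23 at *
  generalize w (edge (Sum.inr false) 3 0) = A30 at *
  generalize w (edge (Sum.inr false) 3 1) = A31 at *
  generalize w (edge (Sum.inr false) 3 2) = A32 at *
  generalize w (edge (Sum.inr true) 0 2) = B02 at *
  generalize w (edge (Sum.inr true) 0 3) = B03 at *
  generalize w (edge (Sum.inr true) 1 2) = B12 at *
  generalize w (edge (Sum.inr true) 1 3) = B13 at *
  generalize w (edge (Sum.inr true) 2 3) = B23 at *
  generalize w (edge (Sum.inr true) 3 2) = B32 at *
  obtain rfl : A03 = -A01 - A02 := by linear_combination (norm := module) a1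
  obtain rfl : A13 = -A10 - A12 := by linear_combination (norm := module) a2
  obtain rfl : A23 = -A20 - A21 := by linear_combination (norm := module) a3
  obtain rfl : A32 = -A30 - A31 := by linear_combination (norm := module) a4
  obtain rfl : B03 = A10 - B02 := by linear_combination (norm := module) b1
  obtain rfl : B13 = A01 - B12 := by linear_combination (norm := module) b2
  obtain rfl : B23 = A20 + A21 := by linear_combination (norm := module) b3
  obtain rfl : B32 = A30 + A31 := by linear_combination (norm := module) b4
  module

end ZeroTwoSite

end Triangulation

end Index3D

namespace Index3D

namespace Triangulation

variable {ι : Type*} {T : Triangulation ι}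

namespace ZeroTwoSite

variable {s : T.ZeroTwoSite}

/-! #### The class of the boundary before and after the move -/

/-- Each gap is an arc on `∂M` through the pillow that joins an end of one part of the split edge to
an end of the other part. -/
theorem gap_sideBoundary :
    s.gap (fun c => s.result.sideBoundary (Finsupp.single c 1)) 0 =
      Finsupp.single (s.splitClass false true) 1 - Finsupp.single (s.splitClass true true) 1 ∧
    s.gap (fun c => s.result.sideBoundary (Finsupp.single c 1)) 1 =
      Finsupp.single (s.splitClass true false) 1 - Finsupp.single (s.splitClass false false) 1 := by
  obtain ⟨g0, g1⟩ := gap_eq (s := s) s.result.isFlow_sideBoundary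
  have h03 := edge_pillow s.result.edgeInvariant_orEdge false (j := 1) (x := 0) (y := 3)
    (by decide) (by decide) (by decide) (by decide)
  have h13 := edge_pillow s.result.edgeInvariant_orEdge false (j := 0) (x := 1) (y := 3)
    (by decide) (by decide) (by decide) (by decide)
  rw [show Equiv.swap (0 : Fin 4) 1 3 = 3 by decide] at h03 h13
  simp only [Equiv.swap_apply_left, Equiv.swap_apply_right, Bool.not_false] at h03 h13
  rw [g0, g1, sideBoundary_edge (σ := Sum.inr false) (x := 0) (y := 2) (y1 := 3) (y2 := 1)
    (by decide) (by decide), sideBoundary_edge (σ := Sum.inr true) (x := 1) (y := 2) (y1 := 0)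
    (y2 := 3) (by decide) (by decide), sideBoundary_edge (σ := Sum.inr false) (x := 1) (y := 2)
    (y1 := 0) (y2 := 3) (by decide) (by decide), sideBoundary_edge (σ := Sum.inr true) (x := 0)
    (y := 2) (y1 := 3) (y2 := 1) (by decide) (by decide), h03, h13]
  constructor <;> simp only [splitClass] <;> abel

theorem gap_sideBoundary_independent [Finite ι] {m n : ℤ}
    (h : m • s.gap (fun c => s.result.sideBoundary (Finsupp.single c 1)) 0 +
      n • s.gap (fun c => s.result.sideBoundary (Finsupp.single c 1)) 1 = 0) : m = 0 ∧ n = 0 := by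
  classical
  rw [gap_sideBoundary.1, gap_sideBoundary.2] at h
  have key : ∀ i j i' j', s.splitClass i j = s.splitClass i' j' ↔ i = i' ∧ j = j' :=
    fun i j i' j' => ⟨splitClass_injective, fun h => by rw [h.1, h.2]⟩
  have h1 := DFunLike.congr_fun h (s.splitClass false true)
  have h2 := DFunLike.congr_fun h (s.splitClass true false)
  simp [key] at h1 h2
  exact ⟨h1, h2⟩

theorem gap_extendFlow {M : Type*} [AddCommGroup M] {w : Corner ι → M} (hw : T.IsFlow w) :
    s.gap (s.extendFlow w) 0 = 0 ∧ s.gap (s.extendFlow w) 1 = 0 := by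
  have h : ∀ x : Fin 4, x ≠ 2 → s.gap (s.extendFlow w) x = 0 := by
    intro x hx
    change w (s.oldSide false 2 x) + w (s.oldSide true 2 (Equiv.swap 0 1 x)) = 0
    have := sideGlue_oldSide (s := s) false (Or.inl rfl) hx
    rw [Bool.not_false] at this
    rw [← this, hw.glue, add_neg_cancel]
  exact ⟨h 0 (by decide), h 1 (by decide)⟩

theorem linearCombination_mapDomain {M : Type*} [AddCommGroup M] (w : Corner (ι ⊕ Bool) → M)
    (x : Corner ι →₀ ℤ) : Finsupp.linearCombination ℤ w (x.mapDomain (Prod.map Sum.inl id)) =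
      Finsupp.linearCombination ℤ (fun c => w (inlCorner c)) x := by
  rw [Finsupp.linearCombination_mapDomain]
  rfl

variable [Fintype ι]

theorem linearCombination_octagonBoundary {M : Type*} [AddCommGroup M] (w : Corner ι → M)
    (S : ι → Fin 3 → ℤ) : Finsupp.linearCombination ℤ w (octagonBoundary S) =
      ∑ σ, ∑ k, ∑ v, S σ k • w (σ, v, k) := by
  simp [octagonBoundary]

theorem linearCombination_octagonBoundary_result {M : Type*} [AddCommGroup M]
    {w : Corner (ι ⊕ Bool) → M} (hw : s.result.IsFlow w) {S : ι ⊕ Bool → Fin 3 → ℤ}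
    (hS : S ∈ s.result.Q) (hd : defect S = 0) :
    Finsupp.linearCombination ℤ w (octagonBoundary S) =
      Finsupp.linearCombination ℤ (fun c => w (inlCorner c)) (octagonBoundary (restrict S)) +
      (S (Sum.inr true) 1 - S (Sum.inr true) 2) • (s.gap w 0 - s.gap w 1) := by
  rw [linearCombination_octagonBoundary, linearCombination_octagonBoundary, Fintype.sum_sum_type,
    sum_new hw hd (shear_add_shear hS)]
  rfl

/-- If the classes agree after the move, apply the extension of the universal flow of `T`, whose
gaps are zero. Conversely, the universal flow after the move restricts only modulo its gaps, so the
difference of the two cycles is homologous to a combination of gaps. It is a cycle, and the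
boundaries of the gaps are independent, so the combination is trivial. -/
theorem boundaryClass_eq_iff {b : T.PeripheralHomology} {b' : s.result.PeripheralHomology}
    (hb : s.SamePeripheral b b') (S : s.result.Q) (hd : defect S.1 = 0) :
    s.result.boundaryClass S = b' ↔
      T.boundaryClass ⟨restrict S.1, restrict_mem S.2 hd⟩ = b := by
  obtain ⟨z, hz, hz', rfl, rfl⟩ := hb
  change Submodule.Quotient.mk (⟨octagonBoundary S.1, s.result.octagonBoundary_mem S⟩ :
      s.result.peripheralCycles) = _ ↔
    Submodule.Quotient.mk (⟨octagonBoundary (restrict S.1), T.octagonBoundary_mem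
      ⟨restrict S.1, restrict_mem S.2 hd⟩⟩ : T.peripheralCycles) = _
  rw [Submodule.Quotient.eq, Submodule.Quotient.eq, Submodule.submoduleOf, Submodule.submoduleOf,
    Submodule.mem_comap, Submodule.mem_comap]
  change octagonBoundary S.1 - z.mapDomain (Prod.map Sum.inl id) ∈ _ ↔
    octagonBoundary (restrict S.1) - z ∈ _
  constructor
  · intro h
    have h1 := isFlow_extendFlow (s := s) T.isFlow_sideClass
    have h2 := h1.linearCombination_eq_zero h
    rw [map_sub, linearCombination_octagonBoundary_result h1 S.2 hd, linearCombination_mapDomain,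
      (gap_extendFlow T.isFlow_sideClass).1, (gap_extendFlow T.isFlow_sideClass).2, sub_zero,
      smul_zero, add_zero, ← map_sub] at h2
    change Finsupp.linearCombination ℤ T.sideClass _ = 0 at h2
    rwa [linearCombination_sideClass, Submodule.Quotient.mk_eq_zero] at h2
  · intro h
    have hfl := s.result.isFlow_sideClass
    let J : AddSubgroup ((Corner (ι ⊕ Bool) →₀ ℤ) ⧸ s.result.peripheralBoundaries) :=
      AddSubgroup.closure {s.gap s.result.sideClass 0, s.gap s.result.sideClass 1}
    have h1 := hfl.map (QuotientAddGroup.mk' J)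
    have g : ∀ x, x = 0 ∨ x = 1 →
        s.gap (fun c => QuotientAddGroup.mk' J (s.result.sideClass c)) x = 0 := by
      intro x hx
      rw [gap, ← map_add]
      refine (QuotientAddGroup.eq_zero_iff _).2 (AddSubgroup.subset_closure ?_)
      rcases hx with rfl | rfl
      · exact Or.inl rfl
      · exact Or.inr rfl
    have h2 := (isFlow_restrict h1 (g 0 (Or.inl rfl)) (g 1 (Or.inr rfl))).linearCombination_eq_zero h
    have h3 : ∀ x : Corner ι →₀ ℤ,
        Finsupp.linearCombination ℤ (fun c => QuotientAddGroup.mk' J (s.result.sideClass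
          (inlCorner c))) x = QuotientAddGroup.mk' J (Finsupp.linearCombination ℤ
            (fun c => s.result.sideClass (inlCorner c)) x) := by
      intro x
      have : Finsupp.linearCombination ℤ (fun c => QuotientAddGroup.mk' J (s.result.sideClass
          (inlCorner c))) = (QuotientAddGroup.mk' J).toIntLinearMap ∘ₗ
            (Finsupp.linearCombination ℤ (fun c => s.result.sideClass (inlCorner c))) := by
        ext c
        simp
      rw [this]
      rfl
    rw [h3] at h2
    have h4 := (QuotientAddGroup.eq_zero_iff _).1 h2
    obtain ⟨m, n, hmn⟩ := AddSubgroup.mem_closure_pair.1 h4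
    set r := S.1 (Sum.inr true) 1 - S.1 (Sum.inr true) 2 with hr
    set y := octagonBoundary S.1 - z.mapDomain (Prod.map Sum.inl id) with hy
    -- The integers `m`, `n` come from working modulo the gaps, and `r` is the contribution of the
    -- octagons in the new tetrahedra.
    have h5 : Submodule.Quotient.mk y = (m + r) • s.gap s.result.sideClass 0 +
        (n - r) • s.gap s.result.sideClass 1 := by
      rw [← linearCombination_sideClass, hy, map_sub,
        linearCombination_octagonBoundary_result hfl S.2 hd, linearCombination_mapDomain,
        ← hr, add_sub_right_comm, ← map_sub, ← hmn]
      module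
    have hker : s.result.peripheralBoundaries ≤ LinearMap.ker s.result.sideBoundary := fun x hx => by
      rw [LinearMap.mem_ker, ← linearCombination_sideBoundary]
      exact s.result.isFlow_sideBoundary.linearCombination_eq_zero hx
    have h6 := congrArg (s.result.peripheralBoundaries.liftQ s.result.sideBoundary hker) h5
    have h7 : s.result.sideBoundary y = 0 := by
      rw [hy, map_sub, sub_eq_zero]
      exact (LinearMap.mem_ker.1 (s.result.octagonBoundary_mem S)).trans (LinearMap.mem_ker.1 hz').symm
    rw [map_add, map_smul, map_smul] at h6
    simp only [gap, map_add, sideClass, Submodule.liftQ_apply, h7] at h6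
    obtain ⟨hm, hn⟩ := gap_sideBoundary_independent (s := s) h6.symm
    rw [hm, hn, zero_smul, zero_smul, add_zero] at h5
    exact (Submodule.Quotient.mk_eq_zero _).1 h5

end ZeroTwoSite

end Triangulation

end Index3D

namespace Index3D

/-- Summation over the edges at a vertex. -/
theorem sum_mate {M : Type*} [AddCommMonoid M] (F : Fin 3 → Fin 4 → M) (v : Fin 4) :
    ∑ k, F k (mate k v) = ∑ y, if v ≠ y then F (quadOf v y) y else 0 := by
  rw [Fin.sum_univ_three, Fin.sum_univ_four]
  fin_cases v <;> simp (decide := true) [mate, quadOf, Equiv.swap_apply_def] <;> abel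

namespace Triangulation

variable {ι : Type*} {T : Triangulation ι} {M : Type*} [AddCommGroup M]

/-! ### Relative cocycles mod 2 -/

/-- Functions on faces that vanish on relative boundaries. -/
structure IsFaceFlow (T : Triangulation ι) (w : ι × Fin 4 → M) : Prop where
  glue : ∀ x, w (T.faceGlue x) = w x
  sum : ∀ σ, ∑ f, w (σ, f) = 0

theorem IsFaceFlow.map {N : Type*} [AddCommGroup N] {w : ι × Fin 4 → M} (hw : T.IsFaceFlow w)
    (φ : M →+ N) : T.IsFaceFlow fun c => φ (w c) :=
  ⟨fun c => by rw [hw.glue], fun σ => by rw [← map_sum, hw.sum, map_zero]⟩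

variable [Module (ZMod 2) M]

theorem zmod_two_add_self (x : M) : x + x = 0 := by
  rw [← two_smul (ZMod 2) x, show (2 : ZMod 2) = 0 by decide, zero_smul]

variable (T) in
/-- The relative boundaries mod 2 as a subspace. -/
noncomputable def relBoundarySpace : Submodule (ZMod 2) (ι × Fin 4 →₀ ZMod 2) :=
  AddSubgroup.toZModSubmodule 2 T.relBoundaries

theorem IsFaceFlow.linearCombination_eq_zero {w : ι × Fin 4 → M} (hw : T.IsFaceFlow w)
    {x : ι × Fin 4 →₀ ZMod 2} (hx : x ∈ T.relBoundaries) :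
    Finsupp.linearCombination (ZMod 2) w x = 0 := by
  change x ∈ (Finsupp.linearCombination (ZMod 2) w).toAddMonoidHom.ker
  refine (AddSubgroup.closure_le _).2 ?_ hx
  rintro _ (⟨y, rfl⟩ | ⟨c, rfl⟩)
  · simpa [AddMonoidHom.mem_ker] using hw.sum y
  · have := hw.glue c
    simp only [faceGlue] at this
    simp [AddMonoidHom.mem_ker, this, zmod_two_add_self]

variable (T) in
/-- The class of a face modulo boundaries. -/
noncomputable def faceClass (x : ι × Fin 4) : (ι × Fin 4 →₀ ZMod 2) ⧸ T.relBoundarySpace :=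
  Submodule.Quotient.mk (Finsupp.single x 1)

variable (T) in
theorem isFaceFlow_faceClass : T.IsFaceFlow T.faceClass := by
  constructor
  · intro c
    refine (eq_neg_of_add_eq_zero_right ?_).trans
      (eq_neg_of_add_eq_zero_right (zmod_two_add_self (T.faceClass c))).symm
    rw [faceClass, faceClass, ← Submodule.Quotient.mk_add,
      Submodule.Quotient.mk_eq_zero]
    exact AddSubgroup.subset_closure (Or.inr ⟨c, rfl⟩)
  · intro σ
    have : ∑ f, T.faceClass (σ, f) =
        Submodule.Quotient.mk (∑ f : Fin 4, Finsupp.single (σ, f) (1 : ZMod 2)) :=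
      (map_sum T.relBoundarySpace.mkQ _ _).symm
    rw [this, Submodule.Quotient.mk_eq_zero]
    exact AddSubgroup.subset_closure (Or.inl ⟨σ, rfl⟩)

theorem linearCombination_faceClass (x : ι × Fin 4 →₀ ZMod 2) :
    Finsupp.linearCombination (ZMod 2) T.faceClass x = Submodule.Quotient.mk x := by
  have : Finsupp.linearCombination (ZMod 2) T.faceClass = T.relBoundarySpace.mkQ := by
    ext c
    simp [faceClass]
  rw [this]
  rfl

theorem faceBoundary_single (σ : ι) (f : Fin 4) : T.faceBoundary (Finsupp.single (σ, f) 1) =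
    ∑ v : Fin 4, ∑ y : Fin 4, if v ≠ y ∧ v ≠ f ∧ y ≠ f then
      Finsupp.single (T.orEdge (edge σ v y)) (1 : ZMod 2) else 0 := by
  simp only [faceBoundary, Finsupp.linearCombination_single, one_smul]
  refine Finset.sum_congr rfl fun v _ => ?_
  rw [sum_mate (fun k y => if v ≠ f ∧ y ≠ f then
    Finsupp.single (T.orEdge (σ, v, k)) (1 : ZMod 2) else 0) v]
  refine Finset.sum_congr rfl fun y _ => ?_
  by_cases h : v = y <;> simp [h, edge]

variable (T) in
theorem isFaceFlow_faceBoundary : T.IsFaceFlow fun x => T.faceBoundary (Finsupp.single x 1) := by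
  constructor
  · rintro ⟨σ, f⟩
    have hi := (T.perm σ f).injective
    rw [faceGlue, faceBoundary_single, faceBoundary_single, ← Equiv.sum_comp (T.perm σ f)]
    refine Finset.sum_congr rfl fun v _ => ?_
    rw [← Equiv.sum_comp (T.perm σ f)]
    refine Finset.sum_congr rfl fun y _ => ?_
    simp only [hi.ne_iff]
    by_cases h : v ≠ y ∧ v ≠ f ∧ y ≠ f
    · rw [if_pos h, if_pos h, T.edgeInvariant_orEdge σ v y f h.1 h.2.1.symm h.2.2.symm]
    · rw [if_neg h, if_neg h]
  · intro σ
    simp only [faceBoundary_single]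
    rw [Finset.sum_comm]
    refine Finset.sum_eq_zero fun v _ => ?_
    rw [Finset.sum_comm]
    refine Finset.sum_eq_zero fun y _ => ?_
    have h2 := zmod_two_add_self (Finsupp.single (T.orEdge (edge σ v y)) (1 : ZMod 2))
    generalize Finsupp.single (T.orEdge (edge σ v y)) (1 : ZMod 2) = X at h2 ⊢
    rw [Fin.sum_univ_four]
    fin_cases v <;> fin_cases y <;> simp (decide := true) [h2]

theorem linearCombination_faceBoundary (x : ι × Fin 4 →₀ ZMod 2) :
    Finsupp.linearCombination (ZMod 2) (fun c => T.faceBoundary (Finsupp.single c 1)) x =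
      T.faceBoundary x := by
  have : Finsupp.linearCombination (ZMod 2) (fun c => T.faceBoundary (Finsupp.single c 1)) =
      T.faceBoundary := by
    ext c
    simp
  rw [this]

namespace ZeroTwoSite

variable {s : T.ZeroTwoSite}

/-- A face of `T` as a face of the triangulation after the move. -/
def inlFace (x : ι × Fin 4) : (ι ⊕ Bool) × Fin 4 := (Sum.inl x.1, x.2)

theorem faceGlue_target (t : Bool) {j : Fin 4} (hj : j = 2 ∨ j = 3) :
    s.result.faceGlue (inlFace (s.target t j)) = (Sum.inr t, j) := by
  have h := s.result_target t j hj
  simp only [faceGlue, inlFace, h.1, h.2]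
  rw [target, perm_inv_apply]

theorem faceGlue_new (t : Bool) {j : Fin 4} (hj : j = 2 ∨ j = 3) :
    s.result.faceGlue (Sum.inr t, j) = inlFace (s.target t j) := by
  rw [← faceGlue_target t hj, faceGlue_faceGlue]

theorem faceGlue_pillow (t : Bool) {h : Fin 4} (hh : h = 0 ∨ h = 1) :
    s.result.faceGlue (Sum.inr t, h) = (Sum.inr (!t), Equiv.swap 0 1 h) := by
  simp only [faceGlue, (s.result_pillow t h hh).1, (s.result_pillow t h hh).2]

theorem faceGlue_old {x : ι × Fin 4} (hx : ∀ t j, (j = 2 ∨ j = 3) → x ≠ s.target t j) :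
    s.result.faceGlue (inlFace x) = inlFace (T.faceGlue x) := by
  have h := s.result_old x.1 x.2 hx
  simp only [faceGlue, inlFace, h.1, h.2]

variable (s) in
/-- The extension of a relative cocycle to the triangulation after the move. -/
def extendFaceFlow (w : ι × Fin 4 → M) : (ι ⊕ Bool) × Fin 4 → M
  | (Sum.inl σ, f) => w (σ, f)
  | (Sum.inr t, f) =>
    if f = 2 ∨ f = 3 then w (s.target t f)
    else if f = (if t then 1 else 0) then w (s.target t 2) + w (s.target t 3) else 0

/-- As for sides, only the sum over the two pillow faces is forced; it is placed on the pillow face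
opposite the vertex 0 of `A`. -/
theorem isFaceFlow_extendFaceFlow {w : ι × Fin 4 → M} (hw : T.IsFaceFlow w) :
    s.result.IsFaceFlow (s.extendFaceFlow w) := by
  have hg : ∀ t j, (j = 2 ∨ j = 3) → w (s.target (!t) j) = w (s.target t j) := fun t j hj => by
    rw [← s.target_faceGlue t j hj, hw.glue]
  constructor
  · rintro ⟨σ | t, f⟩
    · by_cases hc : ∃ t j, (j = 2 ∨ j = 3) ∧ (σ, f) = s.target t j
      · obtain ⟨t, j, hj, hc⟩ := hc
        change s.extendFaceFlow w (s.result.faceGlue (inlFace (σ, f))) = w (σ, f)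
        rw [hc, faceGlue_target t hj]
        exact if_pos hj
      · push Not at hc
        change s.extendFaceFlow w (s.result.faceGlue (inlFace (σ, f))) = w (σ, f)
        rw [faceGlue_old hc]
        exact hw.glue (σ, f)
    · by_cases hf : f = 2 ∨ f = 3
      · rw [faceGlue_new t hf]
        exact (if_pos hf).symm
      · have hf' : f = 0 ∨ f = 1 := by revert f; decide
        rw [faceGlue_pillow t hf']
        have h2 := hg t 2 (Or.inl rfl)
        have h3 := hg t 3 (Or.inr rfl)
        simp only [extendFaceFlow, h2, h3]
        rcases hf' with rfl | rfl <;> cases t <;> simp (decide := true)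
  · rintro (σ | t)
    · exact hw.sum σ
    · simp only [extendFaceFlow]
      rw [Fin.sum_univ_four]
      have h2 := zmod_two_add_self (w (s.target t 2) + w (s.target t 3))
      cases t <;> simp (decide := true)
      · rwa [add_assoc]
      · rwa [add_assoc]

variable (s) in
/-- The sum of the values of a function at both copies of a face along which `M` is opened. -/
def faceGap (w : (ι ⊕ Bool) × Fin 4 → M) : M :=
  w (inlFace (s.target false 2)) + w (inlFace (s.target true 2))

theorem faceFlow_relations {N : Type*} [AddCommGroup N] {w : (ι ⊕ Bool) × Fin 4 → N}
    (hw : s.result.IsFaceFlow w) :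
    w (Sum.inr true, 1) = w (Sum.inr false, 0) ∧ w (Sum.inr true, 0) = w (Sum.inr false, 1) ∧
    w (Sum.inr true, 2) = s.faceGap w - w (Sum.inr false, 2) ∧
    w (Sum.inr true, 3) = w (Sum.inr false, 2) + w (Sum.inr false, 2) + w (Sum.inr false, 3) -
      s.faceGap w ∧
    w (Sum.inr false, 0) = -w (Sum.inr false, 1) - w (Sum.inr false, 2) - w (Sum.inr false, 3) := by
  have h0 : w (Sum.inr true, 1) = w (Sum.inr false, 0) := by
    have := hw.glue (Sum.inr false, 0)
    rwa [faceGlue_pillow false (by decide)] at this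
  have h1 : w (Sum.inr true, 0) = w (Sum.inr false, 1) := by
    have := hw.glue (Sum.inr false, 1)
    rwa [faceGlue_pillow false (by decide)] at this
  have h2 : s.faceGap w = w (Sum.inr false, 2) + w (Sum.inr true, 2) := by
    rw [faceGap, ← hw.glue, ← hw.glue (inlFace (s.target true 2)), faceGlue_target _ (by decide),
      faceGlue_target _ (by decide)]
  have hA := hw.sum (Sum.inr false)
  have hB := hw.sum (Sum.inr true)
  rw [Fin.sum_univ_four] at hA hB
  rw [h0, h1] at hB
  refine ⟨h0, h1, ?_, ?_, ?_⟩
  · rw [h2]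
    abel
  · rw [h2]
    linear_combination (norm := module) hB - hA
  · linear_combination (norm := module) hA

/-- The relations of `A` and `B` make the gaps of `F₁` and `F₂` equal mod 2, so one condition
suffices. -/
theorem isFaceFlow_restrict {w : (ι ⊕ Bool) × Fin 4 → M} (hw : s.result.IsFaceFlow w)
    (h0 : s.faceGap w = 0) : T.IsFaceFlow fun x => w (inlFace x) := by
  constructor
  · intro x
    by_cases hc : ∃ t j, (j = 2 ∨ j = 3) ∧ x = s.target t j
    · obtain ⟨t, j, hj, rfl⟩ := hc
      rw [s.target_faceGlue t j hj, ← hw.glue, ← hw.glue (inlFace (s.target t j)),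
        faceGlue_target _ hj, faceGlue_target _ hj]
      obtain ⟨r0, r1, r2, r3, r4⟩ := faceFlow_relations hw
      have two := zmod_two_add_self (w (Sum.inr false, 2))
      have key : w (Sum.inr true, j) = w (Sum.inr false, j) := by
        rcases hj with rfl | rfl
        · rw [r2, h0]
          linear_combination (norm := module) -two
        · rw [r3, h0]
          linear_combination (norm := module) two
      cases t
      · exact key
      · exact key.symm
    · push Not at hc
      rw [← hw.glue (inlFace x), faceGlue_old hc]
  · exact fun σ => hw.sum (Sum.inl σ)

theorem sum_new_face {w : (ι ⊕ Bool) × Fin 4 → M} (hw : s.result.IsFaceFlow w)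
    {S : ι ⊕ Bool → Fin 3 → ℤ} (hd : defect S = 0)
    (hs : shear S (Sum.inr false) 0 + shear S (Sum.inr true) 0 = 0) :
    ∑ t : Bool, ∑ k : Fin 3, (((S (Sum.inr t) k : ℤ) : ZMod 2) • w (Sum.inr t, mate (k + 1) 0) +
      ((S (Sum.inr t) k : ℤ) : ZMod 2) • w (Sum.inr t, mate (k + 2) 0)) =
      ((S (Sum.inr true) 2 - S (Sum.inr true) 1 : ℤ) : ZMod 2) • s.faceGap w := by
  obtain ⟨r0, r1, r2, r3, r4⟩ := faceFlow_relations hw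
  have m : mate 0 0 = 1 ∧ mate 1 0 = 2 ∧ mate 2 0 = 3 := by decide
  obtain ⟨m1, m2, m3⟩ := m
  simp only [Fintype.sum_bool, Fin.sum_univ_three, Fin.isValue, Fin.reduceAdd, zero_add, m1, m2, m3]
  rw [r0, r2, r3, r4]
  simp only [defect, shear, zero_add, Fin.isValue] at hd hs
  obtain ⟨a, ha⟩ : ∃ a, S (Sum.inr false) 0 = a := ⟨_, rfl⟩
  obtain ⟨b, hb⟩ : ∃ b, S (Sum.inr false) 1 = b := ⟨_, rfl⟩
  obtain ⟨c, hc⟩ : ∃ c, S (Sum.inr false) 2 = c := ⟨_, rfl⟩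
  obtain ⟨b', hb'⟩ : ∃ b, S (Sum.inr true) 1 = b := ⟨_, rfl⟩
  have hc' : S (Sum.inr true) 2 = b - c + b' := by linarith
  have ha' : S (Sum.inr true) 0 = a - c + b' := by linarith
  rw [ha, hb, hc, hb', hc', ha']
  have t1 := zmod_two_add_self (w (Sum.inr false, 1))
  have t2 := zmod_two_add_self (w (Sum.inr false, 2))
  have t3 := zmod_two_add_self (w (Sum.inr false, 3))
  push_cast
  generalize ((a : ℤ) : ZMod 2) = a
  generalize ((b : ℤ) : ZMod 2) = b
  generalize ((c : ℤ) : ZMod 2) = c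
  generalize ((b' : ℤ) : ZMod 2) = b'
  linear_combination (norm := module) (c - b') • t1 + (a - b + c) • t2 + a • t3

/-! #### The class of the surface before and after the move -/

/-- The two copies of `F₂` share all their edges but `uv`, so mod 2 the boundary of their union
consists of the two parts of the split edge, and these lie in different classes. -/
theorem faceGap_faceBoundary_ne [Finite ι] :
    s.faceGap (fun x => s.result.faceBoundary (Finsupp.single x 1)) ≠ 0 := by
  classical
  have hw := s.result.isFaceFlow_faceBoundary
  have h2 : s.faceGap (fun x => s.result.faceBoundary (Finsupp.single x 1)) =
      s.result.faceBoundary (Finsupp.single (Sum.inr false, 2) 1) +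
        s.result.faceBoundary (Finsupp.single (Sum.inr true, 2) 1) := by
    rw [faceGap, ← hw.glue, ← hw.glue (inlFace (s.target true 2)), faceGlue_target _ (by decide),
      faceGlue_target _ (by decide)]
  have hp := fun j x y hj hxy hx hy => edge_pillow (j := j) (x := x) (y := y)
    s.result.edgeInvariant_orEdge false hj hxy hx hy
  have s3 : Equiv.swap (0 : Fin 4) 1 3 = 3 := by decide
  have h03 : s.result.orEdge (edge (Sum.inr true) 1 3) = s.result.orEdge (edge (Sum.inr false) 0 3) := by
    have := hp 1 0 3 (by decide) (by decide) (by decide) (by decide)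
    rwa [s3] at this
  have h30 : s.result.orEdge (edge (Sum.inr true) 3 1) = s.result.orEdge (edge (Sum.inr false) 3 0) := by
    have := hp 1 3 0 (by decide) (by decide) (by decide) (by decide)
    rwa [s3] at this
  have h13 : s.result.orEdge (edge (Sum.inr true) 0 3) = s.result.orEdge (edge (Sum.inr false) 1 3) := by
    have := hp 0 1 3 (by decide) (by decide) (by decide) (by decide)
    rwa [s3] at this
  have h31 : s.result.orEdge (edge (Sum.inr true) 3 0) = s.result.orEdge (edge (Sum.inr false) 3 1) := by
    have := hp 0 3 1 (by decide) (by decide) (by decide) (by decide)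
    rwa [s3] at this
  rw [h2, faceBoundary_single, faceBoundary_single]
  simp (decide := true) only [Fin.sum_univ_four, if_true, if_false, h03, h30, h13, h31, zero_add,
    add_zero]
  generalize Finsupp.single (s.result.orEdge (edge (Sum.inr false) 0 3)) (1 : ZMod 2) = X
  generalize Finsupp.single (s.result.orEdge (edge (Sum.inr false) 3 0)) (1 : ZMod 2) = X'
  generalize Finsupp.single (s.result.orEdge (edge (Sum.inr false) 1 3)) (1 : ZMod 2) = Y
  generalize Finsupp.single (s.result.orEdge (edge (Sum.inr false) 3 1)) (1 : ZMod 2) = Y'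
  intro h
  have key : ∀ i j i' j', s.splitClass i j = s.splitClass i' j' ↔ i = i' ∧ j = j' :=
    fun i j i' j' => ⟨splitClass_injective, fun h => by rw [h.1, h.2]⟩
  have h4 : Finsupp.single (s.splitClass true true) (1 : ZMod 2) +
      Finsupp.single (s.splitClass true false) 1 + Finsupp.single (s.splitClass false true) 1 +
      Finsupp.single (s.splitClass false false) 1 = 0 := by
    simp only [splitClass]
    linear_combination (norm := module) h - zmod_two_add_self X - zmod_two_add_self X' -
      zmod_two_add_self Y - zmod_two_add_self Y'
  have h5 := DFunLike.congr_fun h4 (s.splitClass true true)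
  simp [key] at h5

theorem linearCombination_mapDomain_face (w : (ι ⊕ Bool) × Fin 4 → M)
    (x : ι × Fin 4 →₀ ZMod 2) :
    Finsupp.linearCombination (ZMod 2) w (x.mapDomain (Prod.map Sum.inl id)) =
      Finsupp.linearCombination (ZMod 2) (fun c => w (inlFace c)) x := by
  rw [Finsupp.linearCombination_mapDomain]
  rfl

variable [Fintype ι]

theorem linearCombination_twistedSquares (w : ι × Fin 4 → M) (S : ι → Fin 3 → ℤ) :
    Finsupp.linearCombination (ZMod 2) w (twistedSquares S) =
      ∑ σ, ∑ k : Fin 3, (((S σ k : ℤ) : ZMod 2) • w (σ, mate (k + 1) 0) +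
        ((S σ k : ℤ) : ZMod 2) • w (σ, mate (k + 2) 0)) := by
  simp [twistedSquares]

theorem linearCombination_twistedSquares_result {w : (ι ⊕ Bool) × Fin 4 → M}
    (hw : s.result.IsFaceFlow w) {S : ι ⊕ Bool → Fin 3 → ℤ} (hS : S ∈ s.result.Q)
    (hd : defect S = 0) :
    Finsupp.linearCombination (ZMod 2) w (twistedSquares S) =
      Finsupp.linearCombination (ZMod 2) (fun c => w (inlFace c)) (twistedSquares (restrict S)) +
      ((S (Sum.inr true) 2 - S (Sum.inr true) 1 : ℤ) : ZMod 2) • s.faceGap w := by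
  rw [linearCombination_twistedSquares, linearCombination_twistedSquares, Fintype.sum_sum_type,
    sum_new_face hw hd (shear_add_shear hS)]
  rfl

/-- The argument of `boundaryClass_eq_iff` with a single gap: a multiple of the gap that is a
relative cycle is zero, as the boundary of the gap does not vanish. -/
theorem surfaceClass_eq_iff {a : T.RelHomology} {a' : s.result.RelHomology}
    (ha : s.SameRel a a') (S : s.result.Q) (hd : defect S.1 = 0) :
    s.result.surfaceClass S = a' ↔
      T.surfaceClass ⟨restrict S.1, restrict_mem S.2 hd⟩ = a := by
  obtain ⟨z, hz, hz', rfl, rfl⟩ := ha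
  change QuotientAddGroup.mk (⟨twistedSquares S.1, s.result.twistedSquares_mem S⟩ :
      s.result.relCycles) = _ ↔
    QuotientAddGroup.mk (⟨twistedSquares (restrict S.1), T.twistedSquares_mem
      ⟨restrict S.1, restrict_mem S.2 hd⟩⟩ : T.relCycles) = _
  rw [QuotientAddGroup.eq, QuotientAddGroup.eq, AddSubgroup.mem_addSubgroupOf,
    AddSubgroup.mem_addSubgroupOf]
  change -twistedSquares S.1 + z.mapDomain (Prod.map Sum.inl id) ∈ _ ↔
    -twistedSquares (restrict S.1) + z ∈ _
  constructor
  · intro h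
    have h1 := isFaceFlow_extendFaceFlow (s := s) T.isFaceFlow_faceClass
    have h2 := h1.linearCombination_eq_zero h
    have h0 : s.faceGap (s.extendFaceFlow T.faceClass) = 0 := by
      change T.faceClass (s.target false 2) + T.faceClass (s.target true 2) = 0
      rw [s.target_true 2 (Or.inl rfl), T.isFaceFlow_faceClass.glue, zmod_two_add_self]
    rw [map_add, map_neg, linearCombination_twistedSquares_result h1 S.2 hd,
      linearCombination_mapDomain_face, h0, smul_zero, add_zero, ← map_neg, ← map_add] at h2
    change Finsupp.linearCombination (ZMod 2) T.faceClass _ = 0 at h2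
    rwa [linearCombination_faceClass, Submodule.Quotient.mk_eq_zero] at h2
  · intro h
    have hfl := s.result.isFaceFlow_faceClass
    let J : Submodule (ZMod 2) (((ι ⊕ Bool) × Fin 4 →₀ ZMod 2) ⧸ s.result.relBoundarySpace) :=
      Submodule.span (ZMod 2) {s.faceGap s.result.faceClass}
    have h1 := hfl.map J.mkQ.toAddMonoidHom
    have g : s.faceGap (fun c => J.mkQ.toAddMonoidHom (s.result.faceClass c)) = 0 := by
      rw [faceGap, ← map_add]
      exact (Submodule.Quotient.mk_eq_zero _).2 (Submodule.subset_span rfl)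
    have h2 := (isFaceFlow_restrict h1 g).linearCombination_eq_zero h
    have h3 : Finsupp.linearCombination (ZMod 2) (fun c => J.mkQ.toAddMonoidHom
        (s.result.faceClass (inlFace c))) = J.mkQ ∘ₗ (Finsupp.linearCombination (ZMod 2)
            (fun c => s.result.faceClass (inlFace c))) := by
      ext c
      simp
    rw [h3] at h2
    have h4 := (Submodule.Quotient.mk_eq_zero _).1 h2
    obtain ⟨m, hm⟩ := Submodule.mem_span_singleton.1 h4
    set r := ((S.1 (Sum.inr true) 2 - S.1 (Sum.inr true) 1 : ℤ) : ZMod 2) with hr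
    set y := -twistedSquares S.1 + z.mapDomain (Prod.map Sum.inl id) with hy
    have h5 : Submodule.Quotient.mk y = (m - r) • s.faceGap s.result.faceClass := by
      rw [← linearCombination_faceClass, hy, map_add, map_neg,
        linearCombination_twistedSquares_result hfl S.2 hd, linearCombination_mapDomain_face,
        ← hr, sub_smul, hm, map_add, map_neg]
      abel
    have hker : s.result.relBoundarySpace ≤ LinearMap.ker s.result.faceBoundary := fun x hx => by
      rw [LinearMap.mem_ker, ← linearCombination_faceBoundary]
      exact s.result.isFaceFlow_faceBoundary.linearCombination_eq_zero hx
    have h6 := congrArg (s.result.relBoundarySpace.liftQ s.result.faceBoundary hker) h5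
    have h7 : s.result.faceBoundary y = 0 := by
      have e1 : s.result.faceBoundary (twistedSquares S.1) = 0 := s.result.twistedSquares_mem S
      have e2 : s.result.faceBoundary (z.mapDomain (Prod.map Sum.inl id)) = 0 := hz'
      rw [hy, map_add, map_neg, e1, e2, neg_zero, add_zero]
    rw [map_smul] at h6
    simp only [faceGap, map_add, faceClass, Submodule.liftQ_apply, h7] at h6
    have h8 : m - r = 0 := (smul_eq_zero.1 h6.symm).resolve_right faceGap_faceBoundary_ne
    rw [h8, zero_smul] at h5
    exact (Submodule.Quotient.mk_eq_zero _).1 h5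

end ZeroTwoSite

end Triangulation

end Index3D

/-! ### The arcs of a lifted normal curve -/

namespace Index3D

/-- A lifted curve is naturally indexed by a finite set of arcs with a successor map. If the
successor map acts with a single orbit, this set can be numbered cyclically, as `NormalCurve`
requires. -/
theorem exists_cyclic_equiv {K : Type*} [Finite K] [Nonempty K] (nxt : K → K)
    (h : ∀ k k', ∃ n, nxt^[n] k = k') :
    ∃ (N : ℕ) (e : Fin (N + 1) ≃ K), ∀ i, e (i + 1) = nxt (e i) := by
  obtain ⟨k₀⟩ := ‹Nonempty K›
  have hper : k₀ ∈ Function.periodicPts nxt := by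
    obtain ⟨n, hn⟩ := h (nxt k₀) k₀
    refine ⟨n + 1, Nat.succ_pos n, ?_⟩
    rwa [Function.IsPeriodicPt, Function.IsFixedPt, Function.iterate_succ_apply]
  have hpos := Function.minimalPeriod_pos_of_mem_periodicPts hper
  obtain ⟨N, hN⟩ : ∃ N, Function.minimalPeriod nxt k₀ = N + 1 :=
    ⟨Function.minimalPeriod nxt k₀ - 1, by omega⟩
  have hinj : Function.Injective fun i : Fin (N + 1) => nxt^[i.val] k₀ := by
    intro i j hij
    exact Fin.ext (Function.iterate_injOn_Iio_minimalPeriod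
      (by rw [Set.mem_Iio, hN]; exact i.2) (by rw [Set.mem_Iio, hN]; exact j.2) hij)
  have hsurj : Function.Surjective fun i : Fin (N + 1) => nxt^[i.val] k₀ := by
    intro k
    obtain ⟨n, hn⟩ := h k₀ k
    refine ⟨⟨n % (N + 1), Nat.mod_lt _ (Nat.succ_pos N)⟩, ?_⟩
    dsimp only
    rw [← hN, Function.iterate_mod_minimalPeriod_eq, hn]
  refine ⟨N, Equiv.ofBijective _ ⟨hinj, hsurj⟩, fun i => ?_⟩
  change nxt^[(i + 1).val] k₀ = nxt (nxt^[i.val] k₀)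
  rw [← Function.iterate_succ_apply' nxt, ← Function.iterate_mod_minimalPeriod_eq (n := i.val + 1),
    hN, Fin.val_add, Fin.val_one', Nat.add_mod_mod]

namespace Triangulation

variable {ι : Type*} {T : Triangulation ι}

/-- A normal curve from a cyclic family of arcs with at most one arc around each corner. -/
theorem exists_normalCurve {K : Type*} [Finite K] [Nonempty K] (nxt : K → K)
    (h : ∀ k k', ∃ n, nxt^[n] k = k') (corner : K → Corner ι) (left : K → Bool) (pos start : K → ℝ)
    (hpos : ∀ k, pos k ∈ Set.Ioo (0 : ℝ) 1) (hstart : ∀ k, start (nxt k) = pos k)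
    (hglue : ∀ k, T.sideGlue ((corner k).1, (corner k).2.1, (corner k).2.2 + if left k then 1 else 2) =
      ((corner (nxt k)).1, (corner (nxt k)).2.1,
        (corner (nxt k)).2.2 + if left (nxt k) then 2 else 1))
    (hinj : Function.Injective corner)
    (hnext : ∀ k k', corner k' = ((corner k).1, (corner k).2.1, (corner k).2.2 + 1) →
      (if left k then 1 - start k else pos k) + (if left k' then 1 - pos k' else start k') < 1) :
    ∃ (γ : T.NormalCurve) (e : Fin (γ.len + 1) ≃ K),
      (∀ i, γ.corner i = corner (e i)) ∧ ∀ i, γ.left i = left (e i) := by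
  obtain ⟨N, e, he⟩ := exists_cyclic_equiv nxt h
  have hs : ∀ i, pos (e (i - 1)) = start (e i) := fun i => by
    rw [← hstart, ← he, sub_add_cancel]
  refine ⟨{
    len := N
    corner := fun i => corner (e i)
    left := fun i => left (e i)
    pos := fun i => pos (e i)
    pos_mem := fun i => hpos _
    glue := fun i => by rw [he]; exact hglue _
    disjoint_same := fun i j hij h => absurd (e.injective (hinj h)) hij
    disjoint_next := fun i j h => by
      simp only [hs]
      exact hnext _ _ h }, e, fun i => rfl, fun i => rfl⟩

namespace NormalCurve

theorem outSide_ne_inSide (γ : T.NormalCurve) (i : Fin (γ.len + 1)) : γ.outSide i ≠ γ.inSide i := by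
  have key : ∀ (k : Fin 3) (b : Bool), k + (if b then 1 else 2) ≠ k + (if b then 2 else 1) := by
    decide
  intro h
  exact key _ _ (congrArg (fun c : Corner ι => c.2.2) h)

theorem triangle_eq_of_outSide_eq_inSide {γ : T.NormalCurve} {i j : Fin (γ.len + 1)}
    (h : γ.outSide i = γ.inSide j) : γ.triangle i = γ.triangle j := by
  have h1 := congrArg (fun c : Corner ι => (c.1, c.2.1)) h
  exact h1

end NormalCurve

namespace ZeroTwoSite

/-! ### Curves after the move -/

/-- The corner of the truncation triangle at `x` of a new tetrahedron around which a curve winds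
which enters the triangle through the face `j`. -/
def turn (t : Bool) (j x : Fin 4) : Fin 4 :=
  if x = 0 ∨ x = 1 then 5 - j else if t then 1 else 0

/-- The face through which this curve leaves the tetrahedron. -/
def exit (t : Bool) (j x : Fin 4) : Fin 4 := 2 - x - turn t j x - j

/-- Whether this curve turns left. -/
def turnsLeft (t : Bool) (j x : Fin 4) : Bool :=
  decide (quadOf x (exit t j x) = quadOf x (turn t j x) + 1)

theorem turn_spec : ∀ (t : Bool) (j x : Fin 4), (j = 2 ∨ j = 3) → x ≠ j →
    (x ≠ turn t j x ∧ x ≠ exit t j x ∧ (exit t j x = 0 ∨ exit t j x = 1)) ∧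
    (turn t j x = 0 ∨ turn t j x = 1 ∨ turn t j x = 2 ∨ turn t j x = 3) ∧
    turn (!t) j (Equiv.swap 0 1 x) = Equiv.swap 0 1 (turn t j x) := by decide

theorem turn_side : ∀ (t : Bool) (j x : Fin 4), (j = 2 ∨ j = 3) → x ≠ j →
    quadOf x (turn t j x) + (if turnsLeft t j x then 1 else 2) = quadOf x (exit t j x) ∧
    quadOf x (turn t j x) + (if turnsLeft t j x then 2 else 1) = quadOf x j ∧
    quadOf (Equiv.swap 0 1 x) (Equiv.swap 0 1 (turn t j x)) + (if turnsLeft t j x then 1 else 2) =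
      quadOf (Equiv.swap 0 1 x) j ∧
    quadOf (Equiv.swap 0 1 x) (Equiv.swap 0 1 (turn t j x)) + (if turnsLeft t j x then 2 else 1) =
      quadOf (Equiv.swap 0 1 x) (Equiv.swap 0 1 (exit t j x)) := by decide

theorem turn_injective : ∀ (t : Bool) (j j' x : Fin 4), (j = 2 ∨ j = 3) → (j' = 2 ∨ j' = 3) → x ≠ j →
    x ≠ j' → turn t j x = turn t j' x → j = j' := by decide

/-- The two inserted arcs avoid the quad type 0 and use the types 1 and 2 in mirrored fashion, which
makes the defect of the lifted solution vanish. -/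
theorem turn_quad : ∀ (t : Bool) (j x : Fin 4), (j = 2 ∨ j = 3) → x ≠ j →
    quadOf x (turn t j x) = 1 ∧
      quadOf (Equiv.swap 0 1 x) (Equiv.swap 0 1 (turn t j x)) = 2 ∨
    quadOf x (turn t j x) = 2 ∧
      quadOf (Equiv.swap 0 1 x) (Equiv.swap 0 1 (turn t j x)) = 1 := by decide

variable {s : T.ZeroTwoSite}

/-- An arc is indexed by `(i, 0)` if it is the old arc `i`, and by `(i, 1)`, `(i, 2)` if it is
inserted after the arc `i` because this one leaves through an opened face (the condition `Cr i`).
The original curve visits each triangle at most once, so the lifted arcs have distinct corners. -/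
theorem exists_lift_arcs (γ : T.NormalCurve) (hγ : Function.Injective γ.triangle) :
    ∃ (γ' : s.result.NormalCurve) (Cr : Fin (γ.len + 1) → Prop)
      (q : Fin (γ.len + 1) → Bool × Fin 4 × Fin 4)
      (e : Fin (γ'.len + 1) ≃ {p : Fin (γ.len + 1) × Fin 3 // p.2 ≠ 0 → Cr p.1}),
      (∀ i, Cr i → ((q i).2.1 = 2 ∨ (q i).2.1 = 3) ∧ (q i).2.2 ≠ (q i).2.1) ∧
      (∀ i, γ'.corner i = (![inlCorner (γ.corner (e i).1.1),
        edge (Sum.inr (q (e i).1.1).1) (q (e i).1.1).2.2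
          (turn (q (e i).1.1).1 (q (e i).1.1).2.1 (q (e i).1.1).2.2),
        edge (Sum.inr (!(q (e i).1.1).1)) (Equiv.swap 0 1 (q (e i).1.1).2.2)
          (Equiv.swap 0 1 (turn (q (e i).1.1).1 (q (e i).1.1).2.1 (q (e i).1.1).2.2))] :
            Fin 3 → Corner (ι ⊕ Bool)) (e i).1.2) ∧
      (∀ i, γ'.left i = (![γ.left (e i).1.1,
        turnsLeft (q (e i).1.1).1 (q (e i).1.1).2.1 (q (e i).1.1).2.2,
        turnsLeft (q (e i).1.1).1 (q (e i).1.1).2.1 (q (e i).1.1).2.2] : Fin 3 → Bool) (e i).1.2) := by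
  classical
  let Cr : Fin (γ.len + 1) → Prop := fun i => ∃ q : Bool × Fin 4 × Fin 4,
    (q.2.1 = 2 ∨ q.2.1 = 3) ∧ q.2.2 ≠ q.2.1 ∧ γ.outSide i = s.oldSide q.1 q.2.1 q.2.2
  have hq : ∀ i, ∃ q : Bool × Fin 4 × Fin 4, Cr i →
      (q.2.1 = 2 ∨ q.2.1 = 3) ∧ q.2.2 ≠ q.2.1 ∧ γ.outSide i = s.oldSide q.1 q.2.1 q.2.2 := by
    intro i
    by_cases h : Cr i
    · exact ⟨h.choose, fun _ => h.choose_spec⟩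
    · exact ⟨(false, 0, 0), fun h' => absurd h' h⟩
  choose q hq using hq
  let K := {p : Fin (γ.len + 1) × Fin 3 // p.2 ≠ 0 → Cr p.1}
  let L : Fin (γ.len + 1) → Bool := fun i => turnsLeft (q i).1 (q i).2.1 (q i).2.2
  let corner : K → Corner (ι ⊕ Bool) := fun k => (![inlCorner (γ.corner k.1.1),
        edge (Sum.inr (q k.1.1).1) (q k.1.1).2.2
          (turn (q k.1.1).1 (q k.1.1).2.1 (q k.1.1).2.2),
        edge (Sum.inr (!(q k.1.1).1)) (Equiv.swap 0 1 (q k.1.1).2.2)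
          (Equiv.swap 0 1 (turn (q k.1.1).1 (q k.1.1).2.1 (q k.1.1).2.2))] :
            Fin 3 → Corner (ι ⊕ Bool)) k.1.2
  let left : K → Bool := fun k => (![γ.left k.1.1, L k.1.1, L k.1.1] : Fin 3 → Bool) k.1.2
  -- Both ends of an inserted arc then lie at distance `1/4` from its corner. Arcs around different
  -- corners of a triangle are disjoint because `1/4 + 1/4 < 1`.
  let P : Fin (γ.len + 1) → ℝ := fun i => if L i then 3 / 4 else 1 / 4
  let nxt : K → K := fun k => if h : Cr k.1.1 ∧ k.1.2 ≠ 2 then ⟨(k.1.1, k.1.2 + 1), fun _ => h.1⟩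
    else ⟨(k.1.1 + 1, 0), fun h => absurd rfl h⟩
  let base : Fin (γ.len + 1) → K := fun i => ⟨(i, 0), fun h => absurd rfl h⟩
  have hcase : ∀ k : K, k = base k.1.1 ∨ ∃ h : Cr k.1.1, k = ⟨(k.1.1, 1), fun _ => h⟩ ∨
      k = ⟨(k.1.1, 2), fun _ => h⟩ := by
    rintro ⟨⟨i, a⟩, ha⟩
    fin_cases a
    · exact Or.inl rfl
    · exact Or.inr ⟨ha (by simp), Or.inl rfl⟩
    · exact Or.inr ⟨ha (by simp), Or.inr rfl⟩
  have hn0 : ∀ i, ¬ Cr i → nxt (base i) = base (i + 1) := fun i h => dif_neg fun h' => h h'.1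
  have hn1 : ∀ i (h : Cr i), nxt (base i) = ⟨(i, 1), fun _ => h⟩ := fun i h =>
    dif_pos ⟨h, by simp [base]⟩
  have hn2 : ∀ i (h : Cr i), nxt ⟨(i, 1), fun _ => h⟩ = ⟨(i, 2), fun _ => h⟩ := fun i h =>
    dif_pos ⟨h, by simp⟩
  have hn3 : ∀ i (h : Cr i), nxt ⟨(i, 2), fun _ => h⟩ = base (i + 1) := fun i h =>
    dif_neg fun h' => h'.2 rfl
  have htrans : ∀ {a b c : K}, (∃ n, nxt^[n] a = b) → (∃ n, nxt^[n] b = c) → ∃ n, nxt^[n] a = c := by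
    rintro a b c ⟨n, rfl⟩ ⟨m, rfl⟩
    exact ⟨m + n, Function.iterate_add_apply _ _ _ _⟩
  have hstep : ∀ {a b : K}, nxt a = b → ∃ n, nxt^[n] a = b := fun h => ⟨1, h⟩
  have hup : ∀ k : K, ∃ n, nxt^[n] k = base (k.1.1 + 1) := by
    intro k
    rcases hcase k with h | ⟨hc, h | h⟩
    · rw [h]
      by_cases hc : Cr k.1.1
      · exact htrans (hstep (hn1 _ hc)) (htrans (hstep (hn2 _ hc)) (hstep (hn3 _ hc)))
      · exact hstep (hn0 _ hc)
    · rw [h]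
      exact htrans (hstep (hn2 _ hc)) (hstep (hn3 _ hc))
    · rw [h]
      exact hstep (hn3 _ hc)
  have hdown : ∀ k : K, ∃ n, nxt^[n] (base k.1.1) = k := by
    intro k
    rcases hcase k with h | ⟨hc, h | h⟩
    · exact ⟨0, h.symm⟩
    · rw [h]
      exact hstep (hn1 _ hc)
    · rw [h]
      exact htrans (hstep (hn1 _ hc)) (hstep (hn2 _ hc))
  have hfrom : ∀ j, ∃ n, nxt^[n] (base 0) = base j := by
    intro j
    induction j using Fin.induction with
    | zero => exact ⟨0, rfl⟩
    | succ i ih =>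
      rw [← Fin.coeSucc_eq_succ]
      exact htrans ih (hup (base i.castSucc))
  have hto : ∀ i, ∃ n, nxt^[n] (base i) = base 0 := by
    intro i
    induction i using Fin.reverseInduction with
    | last =>
      have := hup (base (Fin.last γ.len))
      rwa [show (base (Fin.last γ.len)).1.1 + 1 = 0 from Fin.last_add_one _] at this
    | cast i ih =>
      rw [← Fin.coeSucc_eq_succ] at ih
      exact htrans (hup (base i.castSucc)) ih
  have hreach : ∀ k k' : K, ∃ n, nxt^[n] k = k' := fun k k' =>
    htrans (hup k) (htrans (hto _) (htrans (hfrom _) (hdown k')))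
  have hne : Nonempty K := ⟨base 0⟩
  have hside : ∀ i, Cr i → s.result.sideGlue (inlCorner (γ.outSide i)) =
      edge (Sum.inr (q i).1) (q i).2.2 (q i).2.1 := fun i hi => by
    obtain ⟨h1, h2, h3⟩ := hq i hi
    rw [h3, sideGlue_result_oldSide _ h1 h2]
  have hback : ∀ i, Cr i → s.oldSide (!(q i).1) (q i).2.1 (Equiv.swap 0 1 (q i).2.2) =
      γ.inSide (i + 1) := fun i hi => by
    obtain ⟨h1, h2, h3⟩ := hq i hi
    rw [← sideGlue_oldSide _ h1 h2, ← h3, γ.sideGlue_outSide]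
  let start : K → ℝ := fun k => if k.1.2 = 0 then P (k.1.1 - 1) else P k.1.1
  have hpos : ∀ k : K, P k.1.1 ∈ Set.Ioo (0 : ℝ) 1 := by
    intro k
    simp only [P]
    split_ifs <;> norm_num
  have hstart : ∀ k, start (nxt k) = P k.1.1 := by
    intro k
    rcases hcase k with h | ⟨hc, h | h⟩
    · by_cases hc : Cr k.1.1
      · rw [h, hn1 _ hc]
        simp [base, start]
      · rw [h, hn0 _ hc]
        simp [base, start]
    · rw [h, hn2 _ hc]
      simp [start]
    · rw [h, hn3 _ hc]
      simp [base, start]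
  have hglue : ∀ k, s.result.sideGlue ((corner k).1, (corner k).2.1,
      (corner k).2.2 + if left k then 1 else 2) = ((corner (nxt k)).1, (corner (nxt k)).2.1,
        (corner (nxt k)).2.2 + if left (nxt k) then 2 else 1) := by
    intro k
    rcases hcase k with h | ⟨hc, h | h⟩
    · by_cases hc : Cr k.1.1
      · rw [h, hn1 _ hc]
        refine (hside _ hc).trans ?_
        have := (turn_side (q k.1.1).1 (q k.1.1).2.1 (q k.1.1).2.2 (hq _ hc).1 (hq _ hc).2.1).2.1
        change _ = ((Sum.inr (q k.1.1).1 : ι ⊕ Bool), (q k.1.1).2.2, _)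
        rw [edge, ← this]
        rfl
      · rw [h, hn0 _ hc]
        refine (sideGlue_result_old (s := s) (c := γ.outSide k.1.1) ?_).trans ?_
        · intro t j x hj hx he
          exact hc ⟨(t, j, x), hj, hx, he⟩
        · rw [γ.sideGlue_outSide]
          rfl
    · rw [h, hn2 _ hc]
      have h3 := turn_side (q k.1.1).1 (q k.1.1).2.1 (q k.1.1).2.2 (hq _ hc).1 (hq _ hc).2.1
      have h4 := turn_spec (q k.1.1).1 (q k.1.1).2.1 (q k.1.1).2.2 (hq _ hc).1 (hq _ hc).2.1
      have h5 := sideGlue_result_pillow (s := s) (q k.1.1).1 h4.1.2.2 h4.1.2.1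
      simp only [edge] at h5
      rw [← h3.1, ← h3.2.2.2] at h5
      exact h5
    · rw [h, hn3 _ hc]
      have h3 := turn_side (q k.1.1).1 (q k.1.1).2.1 (q k.1.1).2.2 (hq _ hc).1 (hq _ hc).2.1
      have h5 := sideGlue_result_new (s := s) (!(q k.1.1).1) (hq _ hc).1
        (swap_ne _ _ (hq _ hc).1 (hq _ hc).2.1.symm).symm
      rw [hback _ hc] at h5
      rw [edge, ← h3.2.2.1] at h5
      exact h5
  have hinj : Function.Injective corner := by
    have key : ∀ i i', Cr i → Cr i' → (q i).1 = (q i').1 → (q i).2.2 = (q i').2.2 →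
        turn (q i).1 (q i).2.1 (q i).2.2 = turn (q i').1 (q i').2.1 (q i').2.2 → i = i' := by
      intro i i' hi hi' e1 e2 e3
      obtain ⟨a1, a2, a3⟩ := hq i hi
      obtain ⟨b1, b2, b3⟩ := hq i' hi'
      rw [← e1, ← e2] at e3
      have e4 := turn_injective _ _ _ _ a1 b1 a2 (by rw [e2]; exact b2) e3
      refine γ.outSide_injective hγ ?_
      rw [a3, b3, e1, e2, e4]
    -- If a first inserted arc coincided with a second one, the curve would leave through the side
    -- by which it came in after its crossing at `i'`. Both arcs would lie in the same triangle and
    -- hence be the same arc, but no arc ends on the side where it begins.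
    have key2 : ∀ i i', Cr i → Cr i' → (q i).1 = !(q i').1 →
        (q i).2.2 = Equiv.swap 0 1 (q i').2.2 →
        turn (q i).1 (q i).2.1 (q i).2.2 =
          Equiv.swap 0 1 (turn (q i').1 (q i').2.1 (q i').2.2) → False := by
      intro i i' hi hi' e1 e2 e3
      obtain ⟨a1, a2, a3⟩ := hq i hi
      obtain ⟨b1, b2, b3⟩ := hq i' hi'
      rw [← (turn_spec _ _ _ b1 b2).2.2, ← e1, ← e2] at e3
      have b2' : (q i).2.2 ≠ (q i').2.1 := by
        rw [e2]
        exact (swap_ne _ _ b1 b2.symm).symm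
      have e4 := turn_injective _ _ _ _ a1 b1 a2 b2' e3
      have h5 := hback i' hi'
      rw [← e1, ← e2, ← e4, ← a3] at h5
      have h6 := hγ (NormalCurve.triangle_eq_of_outSide_eq_inSide h5)
      rw [h6] at h5
      exact γ.outSide_ne_inSide _ h5
    have hsw := (Equiv.swap (0 : Fin 4) 1).injective
    intro k k' hk
    have hinl : ∀ i, ∃ τ x, corner (base i) = (Sum.inl τ, x) := fun i => ⟨_, _, rfl⟩
    have hinr : ∀ k : K, k.1.2 ≠ 0 → ∃ t x, corner k = (Sum.inr t, x) := by
      intro k h0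
      rcases hcase k with h | ⟨hc, h | h⟩
      · exact absurd (by rw [h]) h0
      · rw [h]
        exact ⟨_, _, rfl⟩
      · rw [h]
        exact ⟨_, _, rfl⟩
    have hno : ∀ k k' : K, corner k = corner k' → k.1.2 = 0 → k'.1.2 = 0 := by
      intro k k' hk h0
      by_contra h1
      obtain ⟨t, x, hx⟩ := hinr k' h1
      have hb : k = base k.1.1 := Subtype.ext (Prod.ext rfl h0)
      obtain ⟨τ, y, hy⟩ := hinl k.1.1
      rw [← hb, hk, hx] at hy
      exact absurd (Prod.mk.inj hy).1 (by simp)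
    rcases hcase k with h | ⟨hc, h⟩
    · have h0 : k'.1.2 = 0 := hno k k' hk (by rw [h])
      have h' : k' = base k'.1.1 := Subtype.ext (Prod.ext rfl h0)
      rw [h, h'] at hk ⊢
      congr 1
      refine hγ ?_
      have : inlCorner (γ.corner k.1.1) = inlCorner (γ.corner k'.1.1) := hk
      obtain ⟨a1, a2⟩ := Prod.mk.inj this
      exact Prod.ext (Sum.inl_injective a1) (congrArg Prod.fst a2)
    · rcases hcase k' with h' | ⟨hc', h'⟩
      · have h0 := hno k' k hk.symm (by rw [h'])
        rcases h with h | h <;> rw [h] at h0 <;> simp at h0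
      · have c1 := (turn_spec (q k.1.1).1 _ _ (hq _ hc).1 (hq _ hc).2.1).1.1
        have c2 := (turn_spec (q k'.1.1).1 _ _ (hq _ hc').1 (hq _ hc').2.1).1.1
        rcases h with h | h <;> rcases h' with h' | h'
        · rw [h, h'] at hk
          have hk' : edge _ _ _ = edge _ _ _ := hk
          rw [edge_inj c1 c2] at hk'
          have := key _ _ hc hc' (Sum.inr_injective hk'.1) hk'.2.1 hk'.2.2
          rw [h, h']
          simp only [this]
        · rw [h, h'] at hk
          have hk' : edge _ _ _ = edge _ _ _ := hk
          rw [edge_inj c1 (hsw.ne c2)] at hk'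
          exact (key2 _ _ hc hc' (Sum.inr_injective hk'.1) hk'.2.1 hk'.2.2).elim
        · rw [h, h'] at hk
          have hk' : edge _ _ _ = edge _ _ _ := hk.symm
          rw [edge_inj c2 (hsw.ne c1)] at hk'
          exact (key2 _ _ hc' hc (Sum.inr_injective hk'.1) hk'.2.1 hk'.2.2).elim
        · rw [h, h'] at hk
          have hk' : edge _ _ _ = edge _ _ _ := hk
          rw [edge_inj (hsw.ne c1) (hsw.ne c2)] at hk'
          have := key _ _ hc hc' (by simpa using Sum.inr_injective hk'.1) (hsw hk'.2.1)
            (hsw hk'.2.2)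
          rw [h, h']
          simp only [this]
  have hnext : ∀ k k', corner k' = ((corner k).1, (corner k).2.1, (corner k).2.2 + 1) →
      (if left k then 1 - start k else P k.1.1) +
        (if left k' then 1 - P k'.1.1 else start k') < 1 := by
    intro k k' hk
    have hval : ∀ k : K, k.1.2 ≠ 0 →
        (if left k then 1 - (if k.1.2 = 0 then P (k.1.1 - 1) else P k.1.1) else P k.1.1) = 1 / 4 ∧
        (if left k then 1 - P k.1.1 else (if k.1.2 = 0 then P (k.1.1 - 1) else P k.1.1)) = 1 / 4 := by
      intro k h0
      have hl : left k = L k.1.1 := by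
        rcases hcase k with h | ⟨hc, h | h⟩
        · exact absurd (by rw [h]) h0
        · rw [h]
          rfl
        · rw [h]
          rfl
      rw [if_neg h0, hl]
      simp only [P]
      constructor <;> split_ifs <;> norm_num
    by_cases h0 : k.1.2 = 0 ∨ k'.1.2 = 0
    · exfalso
      have hinl : ∀ k : K, k.1.2 = 0 ↔ (corner k).1.isLeft := by
        intro k
        rcases hcase k with h | ⟨hc, h | h⟩
        · rw [h]
          exact ⟨fun _ => rfl, fun _ => rfl⟩
        · rw [h]
          exact ⟨fun h => absurd h (by simp), fun h => Bool.noConfusion h⟩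
        · rw [h]
          exact ⟨fun h => absurd h (by simp), fun h => Bool.noConfusion h⟩
      have h1 : k.1.2 = 0 ↔ k'.1.2 = 0 := by rw [hinl, hinl, hk]
      have a : k = base k.1.1 := Subtype.ext (Prod.ext rfl (h0.elim id h1.2))
      have a' : k' = base k'.1.1 := Subtype.ext (Prod.ext rfl (h0.elim h1.1 id))
      rw [a, a'] at hk
      obtain ⟨b1, b2⟩ := Prod.mk.inj hk
      obtain ⟨b2, b3⟩ := Prod.mk.inj b2
      have h2 : k'.1.1 = k.1.1 := hγ (Prod.ext (Sum.inl_injective b1) b2)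
      rw [← h2] at b3
      exact fin3_add_one_ne _ b3.symm
    · push Not at h0
      rw [(hval k h0.1).1, (hval k' h0.2).2]
      norm_num
  obtain ⟨γ', e, h1, h2⟩ := exists_normalCurve (T := s.result) nxt hreach corner left
    (fun k => P k.1.1) start hpos hstart hglue hinj hnext
  exact ⟨γ', Cr, q, e, fun i hi => ⟨(hq i hi).1, (hq i hi).2.1⟩, h1, h2⟩

end ZeroTwoSite

end Triangulation

end Index3D

/-! ### Solutions of lifted curves and the comparison of Euler characteristics -/

namespace Index3D

namespace Triangulation

variable {ι : Type*} {T : Triangulation ι}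

theorem sum_subtype_arcs {N : Type*} [AddCommMonoid N] {n : ℕ} (Cr : Fin n → Prop) [DecidablePred Cr]
    [Fintype {p : Fin n × Fin 3 // p.2 ≠ 0 → Cr p.1}] (G : Fin n × Fin 3 → N) :
    ∑ κ : {p : Fin n × Fin 3 // p.2 ≠ 0 → Cr p.1}, G κ.1 =
      ∑ i, (G (i, 0) + if Cr i then G (i, 1) + G (i, 2) else 0) := by
  classical
  rw [← Finset.sum_subtype (Finset.univ.filter fun p : Fin n × Fin 3 => p.2 ≠ 0 → Cr p.1)
    (fun p => by simp) G, Finset.sum_filter, Fintype.sum_prod_type]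
  refine Finset.sum_congr rfl fun i _ => ?_
  rw [Fin.sum_univ_three]
  by_cases h : Cr i <;> simp [h, add_assoc]

namespace ZeroTwoSite

variable {s : T.ZeroTwoSite}

/-- A curve on the boundary before the move gives a curve after the move. -/
theorem exists_lift_curve (γ : T.NormalCurve) (hγ : Function.Injective γ.triangle)
    (he : γ.Essential) : ∃ γ' : s.result.NormalCurve, γ'.Essential ∧ restrict γ'.sol = γ.sol ∧
      γ'.sol (Sum.inr false) 0 = 0 ∧ γ'.sol (Sum.inr true) 0 = 0 ∧
      γ'.sol (Sum.inr false) 1 = γ'.sol (Sum.inr true) 2 ∧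
      γ'.sol (Sum.inr false) 2 = γ'.sol (Sum.inr true) 1 := by
  classical
  obtain ⟨γ', Cr, q, e, hq, hcorner, hleft⟩ := exists_lift_arcs (s := s) γ hγ
  let C : Fin (γ.len + 1) × Fin 3 → Corner (ι ⊕ Bool) := fun p => (![inlCorner (γ.corner p.1),
        edge (Sum.inr (q p.1).1) (q p.1).2.2
          (turn (q p.1).1 (q p.1).2.1 (q p.1).2.2),
        edge (Sum.inr (!(q p.1).1)) (Equiv.swap 0 1 (q p.1).2.2)
          (Equiv.swap 0 1 (turn (q p.1).1 (q p.1).2.1 (q p.1).2.2))] :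
            Fin 3 → Corner (ι ⊕ Bool)) p.2
  let L : Fin (γ.len + 1) × Fin 3 → Bool := fun p => (![γ.left p.1,
        turnsLeft (q p.1).1 (q p.1).2.1 (q p.1).2.2,
        turnsLeft (q p.1).1 (q p.1).2.1 (q p.1).2.2] : Fin 3 → Bool) p.2
  replace hcorner : ∀ i, γ'.corner i = C (e i).1 := hcorner
  replace hleft : ∀ i, γ'.left i = L (e i).1 := hleft
  have hsol : ∀ τ k, γ'.sol τ k = ∑ i, ((if (C (i, 0)).1 = τ ∧ (C (i, 0)).2.2 = k then
        (if L (i, 0) then 1 else -1) else 0) +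
      if Cr i then (if (C (i, 1)).1 = τ ∧ (C (i, 1)).2.2 = k then
          (if L (i, 1) then 1 else -1) else 0) +
        (if (C (i, 2)).1 = τ ∧ (C (i, 2)).2.2 = k then
          (if L (i, 2) then 1 else -1) else 0) else 0 : ℤ) := by
    intro τ k
    rw [← sum_subtype_arcs Cr fun p => if (C p).1 = τ ∧ (C p).2.2 = k then
      (if L p then (1 : ℤ) else -1) else 0, ← Equiv.sum_comp e]
    refine Finset.sum_congr rfl fun i _ => ?_
    rw [hcorner, hleft]
    congr
  have hnew : ∀ i t k, ¬ ((C (i, 0)).1 = Sum.inr t ∧ (C (i, 0)).2.2 = k) := by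
    rintro i t k ⟨h, -⟩
    exact Sum.inl_ne_inr h
  have hquad : ∀ i, Cr i → (C (i, 1)).2.2 = 1 ∧ (C (i, 2)).2.2 = 2 ∨
      (C (i, 1)).2.2 = 2 ∧ (C (i, 2)).2.2 = 1 := fun i hi =>
    turn_quad (q i).1 (q i).2.1 (q i).2.2 (hq i hi).1 (hq i hi).2
  have hC1 : ∀ i, (C (i, 1)).1 = Sum.inr (q i).1 := fun i => rfl
  have hC2 : ∀ i, (C (i, 2)).1 = Sum.inr (!(q i).1) := fun i => rfl
  have hL : ∀ i, L (i, 1) = L (i, 2) := fun i => rfl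
  refine ⟨γ', ?_, ?_, ?_, ?_, ?_, ?_⟩
  · intro hmem
    refine he ?_
    have hfl := isFlow_extendFlow (s := s) T.isFlow_sideClass
    obtain ⟨g0, g1⟩ := gap_extendFlow (s := s) T.isFlow_sideClass
    have h1 := hfl.linearCombination_eq_zero hmem
    -- The inserted arcs of a pair turn the same way around corners exchanged by the pillow. The
    -- extended flow takes opposite values there, either by the gluing of a pillow face or by
    -- `flow_add`. Hence it sends the chain of the lifted curve to the class of the original chain.
    have hcancel : ∀ i, Cr i → s.extendFlow T.sideClass (C (i, 1)) +
        s.extendFlow T.sideClass (C (i, 2)) = 0 := by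
      intro i hi
      obtain ⟨a1, a2⟩ := hq i hi
      have a3 := turn_spec (q i).1 _ _ a1 a2
      change s.extendFlow T.sideClass (edge (Sum.inr (q i).1) (q i).2.2 (turn (q i).1 (q i).2.1
        (q i).2.2)) + s.extendFlow T.sideClass (edge (Sum.inr (!(q i).1))
          (Equiv.swap 0 1 (q i).2.2) (Equiv.swap 0 1 (turn (q i).1 (q i).2.1 (q i).2.2))) = 0
      generalize turn (q i).1 (q i).2.1 (q i).2.2 = y at a3
      have b : (y = 0 ∨ y = 1) ∨ (y = 2 ∨ y = 3) := by
        rw [or_assoc]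
        exact a3.2.1
      rcases b with b | b
      · rw [flow_pillow hfl _ b a3.1.1, add_neg_cancel]
      · have c : ∀ y : Fin 4, (y = 2 ∨ y = 3) → Equiv.swap 0 1 y = y := by decide
        rw [c y b]
        cases ht : (q i).1
        · exact flow_add hfl g0 g1 _ _ b a3.1.1
        · have := flow_add hfl g0 g1 y (Equiv.swap 0 1 (q i).2.2) b
            (swap_ne _ _ b a3.1.1.symm).symm
          rwa [Equiv.swap_apply_self, add_comm] at this
    have h2 : Finsupp.linearCombination ℤ (s.extendFlow T.sideClass) γ'.chain =
        Submodule.Quotient.mk γ.chain := by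
      rw [← linearCombination_sideClass, NormalCurve.chain, NormalCurve.chain, map_sum, map_sum]
      have h3 : ∀ i, Finsupp.linearCombination ℤ (s.extendFlow T.sideClass)
          (if γ'.left i then Finsupp.single (γ'.corner i) (1 : ℤ) else 0) =
          (fun p => if L p then s.extendFlow T.sideClass (C p) else 0) (e i).1 := by
        intro i
        rw [hcorner, hleft]
        dsimp only
        split_ifs <;> simp
      rw [Finset.sum_congr rfl fun i _ => h3 i]
      refine (Equiv.sum_comp e fun κ => (fun p => if L p then s.extendFlow T.sideClass (C p)
        else 0) κ.1).trans ?_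
      refine (sum_subtype_arcs Cr fun p => if L p then s.extendFlow T.sideClass (C p)
        else 0).trans ?_
      refine Finset.sum_congr rfl fun i _ => ?_
      rw [hL]
      have h4 : (if Cr i then (if L (i, 2) then s.extendFlow T.sideClass (C (i, 1)) else 0) +
          (if L (i, 2) then s.extendFlow T.sideClass (C (i, 2)) else 0) else 0) = 0 := by
        split_ifs with hc hl
        · exact hcancel i hc
        · exact add_zero _
        · rfl
      rw [h4, add_zero]
      change (if γ.left i then T.sideClass (γ.corner i) else 0) = _
      split_ifs <;> simp
    rw [h1] at h2
    exact (Submodule.Quotient.mk_eq_zero _).1 h2.symm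
  · funext σ k
    rw [restrict, hsol, NormalCurve.sol]
    refine Finset.sum_congr rfl fun i _ => ?_
    simp only [hC1, hC2, reduceCtorEq, false_and, if_false, add_zero, ite_self]
    simp only [C, L, inlCorner, Matrix.cons_val_zero, Sum.inl.injEq]
    congr
  · rw [hsol]
    refine Finset.sum_eq_zero fun i _ => ?_
    rw [if_neg (hnew i _ _), zero_add]
    by_cases hc : Cr i
    · rcases hquad i hc with h | h <;> simp [h.1, h.2]
    · exact if_neg hc
  · rw [hsol]
    refine Finset.sum_eq_zero fun i _ => ?_
    rw [if_neg (hnew i _ _), zero_add]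
    by_cases hc : Cr i
    · rcases hquad i hc with h | h <;> simp [h.1, h.2]
    · exact if_neg hc
  · rw [hsol, hsol]
    refine Finset.sum_congr rfl fun i _ => ?_
    rw [if_neg (hnew i _ _), if_neg (hnew i _ _), hC1, hC2, hL]
    by_cases hc : Cr i
    · cases (q i).1 <;> rcases hquad i hc with h | h <;> simp [h.1, h.2]
    · simp [hc]
  · rw [hsol, hsol]
    refine Finset.sum_congr rfl fun i _ => ?_
    rw [if_neg (hnew i _ _), if_neg (hnew i _ _), hC1, hC2, hL]
    by_cases hc : Cr i
    · cases (q i).1 <;> rcases hquad i hc with h | h <;> simp [h.1, h.2]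
    · simp [hc]

variable [Fintype ι]

/-- The formal Euler characteristics before and after the move agree. -/
theorem euler_lift {χ : T.Q →+ ℤ} {χ' : s.result.Q →+ ℤ} (hχ : T.IsFormalEuler χ)
    (hχ' : s.result.IsFormalEuler χ') (S : T.Q) : χ' (s.lift S) = χ S := by
  have h : χ'.comp s.lift - χ = 0 := by
    refine eq_zero_of_solutions _ ?_ ?_ ?_
    · intro e S hS
      rw [AddMonoidHom.sub_apply, AddMonoidHom.comp_apply, euler_lift_edgeSol hχ' e S hS,
        hχ.edge e S hS, sub_self]
    · intro σ
      rw [AddMonoidHom.sub_apply, AddMonoidHom.comp_apply, euler_lift_tetSol hχ' σ, hχ.tet,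
        sub_self]
    · intro γ hγ he S hS
      obtain ⟨γ', he', h1, h2, h3, h4, h5⟩ := exists_lift_curve (s := s) γ hγ he
      have hd : defect γ'.sol = 0 := by
        rw [defect, h2, h3, h4]
        ring
      -- The coordinate 0 in `A` is zero, and the coordinates 2 of `A` and 1 of `B` agree, so all
      -- correction terms cancel.
      have h6 := euler_of_defect hχ' ⟨γ'.sol, γ'.sol_mem_Q⟩ hd
      rw [hχ'.peripheral γ' he' _ rfl] at h6
      dsimp only at h6
      rw [show (⟨restrict γ'.sol, restrict_mem γ'.sol_mem_Q hd⟩ : T.Q) = S from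
        Subtype.ext (h1.trans hS.symm), h2, h5] at h6
      rw [AddMonoidHom.sub_apply, AddMonoidHom.comp_apply, hχ.peripheral γ he S hS]
      linarith
  have := DFunLike.congr_fun h S
  rwa [AddMonoidHom.sub_apply, AddMonoidHom.comp_apply, AddMonoidHom.zero_apply, sub_eq_zero] at this

end ZeroTwoSite

end Triangulation

end Index3D

namespace Index3D

namespace Triangulation

variable {ι : Type*} [Fintype ι] {T : Triangulation ι}

namespace ZeroTwoSite

variable {s : T.ZeroTwoSite}

/-! ### Sums over the multiples of the new edge solution -/

theorem weight_result (χ : s.result.Q →+ ℤ) (S : s.result.Q) :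
    weight χ S = negHalfPow (-χ S) * ((∏ σ, tetIndexJ (restrict S.1 σ 0) (restrict S.1 σ 1)
      (restrict S.1 σ 2)) * (tetIndexJ (S.1 (Sum.inr false) 0) (S.1 (Sum.inr false) 1)
        (S.1 (Sum.inr false) 2) * tetIndexJ (S.1 (Sum.inr true) 0) (S.1 (Sum.inr true) 1)
          (S.1 (Sum.inr true) 2))) := by
  rw [weight, Fintype.prod_sum_type, Fintype.prod_bool, mul_comm (tetIndexJ (S.1 (Sum.inr true) 0) _ _)]
  rfl

theorem weight_add_newEdge {χ : s.result.Q →+ ℤ} (hχ : s.result.IsFormalEuler χ) (S : s.result.Q)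
    (n : ℤ) : weight χ (S + n • s.newEdge) = negHalfPow (-χ S) * (∏ σ, tetIndexJ (restrict S.1 σ 0)
      (restrict S.1 σ 1) (restrict S.1 σ 2)) * (negHalfPow (2 * n) *
        (tetIndexJ (S.1 (Sum.inr false) 0 + n) (S.1 (Sum.inr false) 1) (S.1 (Sum.inr false) 2) *
          tetIndexJ (S.1 (Sum.inr true) 0 + n) (S.1 (Sum.inr true) 1) (S.1 (Sum.inr true) 2))) := by
  have h1 : χ (S + n • s.newEdge) = χ S - 2 * n := by
    rw [map_add, map_zsmul, hχ.edge _ s.newEdge newEdgeSol_eq.symm, smul_eq_mul]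
    ring
  have h2 : ∀ σ k, restrict (S + n • s.newEdge).1 σ k = restrict S.1 σ k := by
    intro σ k
    simp [restrict, newEdge, newEdgeSol]
  have h3 : ∀ t, (S + n • s.newEdge).1 (Sum.inr t) 0 = S.1 (Sum.inr t) 0 + n ∧
      (S + n • s.newEdge).1 (Sum.inr t) 1 = S.1 (Sum.inr t) 1 ∧
      (S + n • s.newEdge).1 (Sum.inr t) 2 = S.1 (Sum.inr t) 2 := by
    intro t
    simp [newEdge, newEdgeSol]
  rw [weight_result, h1, neg_sub, sub_eq_neg_add, negHalfPow_add]
  simp only [h2, h3]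
  ring

/-- The matching equation at the new edge is the hypothesis of `tetIndexJ_quadratic`, and the
condition under which its sum is nonzero is the vanishing of the defect. The resulting monomial is
the one by which the Euler characteristics of the class and of its restriction differ. -/
theorem laurentSum_weight_newEdge {χ : T.Q →+ ℤ} {χ' : s.result.Q →+ ℤ} (hχ : T.IsFormalEuler χ)
    (hχ' : s.result.IsFormalEuler χ') (S : s.result.Q) :
    laurentSum (fun n : ℤ => weight χ' (S + n • s.newEdge)) =
      if hd : defect S.1 = 0 then weight χ ⟨restrict S.1, restrict_mem S.2 hd⟩ else 0 := by
  have h := shear_add_shear S.2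
  simp only [shear, zero_add] at h
  obtain ⟨h1, h2⟩ := tetIndexJ_quadratic (S.1 (Sum.inr false) 0) _ _ (S.1 (Sum.inr true) 0) _ _ h
  rw [funext (weight_add_newEdge hχ' S), h1.laurentSum_const_mul, h2]
  split_ifs with h3 hd hd
  · rw [mul_right_comm, ← negHalfPow_add, weight]
    congr 2
    rw [euler_of_defect hχ' S hd, euler_lift hχ hχ']
    linarith
  · exact absurd (by rw [defect, h3, sub_self]) hd
  · exact absurd (sub_eq_zero.1 hd) h3
  · exact mul_zero _

/-! ### Classes modulo tetrahedral solutions before and after the move -/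

variable (s) in
/-- The difference of two coordinates in one of the new tetrahedra. -/
noncomputable def edgeCoord : s.result.Q ⧸ s.result.tetSubgroup →+ ℤ :=
  QuotientAddGroup.lift s.result.tetSubgroup
    { toFun S := S.1 (Sum.inr false) 0 - S.1 (Sum.inr false) 2
      map_zero' := by simp
      map_add' S S' := by
        simp only [AddSubgroup.coe_add, Pi.add_apply]
        ring } <| by
    rw [tetSubgroup, AddSubgroup.closure_le]
    rintro _ ⟨τ, rfl⟩
    simp [AddMonoidHom.mem_ker, tetSol]

theorem edgeCoord_mk (S : s.result.Q) : s.edgeCoord (QuotientAddGroup.mk S) =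
    S.1 (Sum.inr false) 0 - S.1 (Sum.inr false) 2 := rfl

variable (s) in
/-- The class of the edge solution of the new edge. -/
noncomputable def newEdgeClass : s.result.Q ⧸ s.result.tetSubgroup := QuotientAddGroup.mk s.newEdge

theorem edgeCoord_newEdgeClass : s.edgeCoord s.newEdgeClass = 1 := by
  rw [newEdgeClass, edgeCoord_mk]
  simp [newEdge, newEdgeSol]

theorem restrict_tetSol (σ : ι) :
    restrict (s.result.tetSol (Sum.inl σ)).1 = (T.tetSol σ).1 := by
  classical
  funext τ k
  simp only [restrict, tetSol, Sum.inl.injEq]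

theorem lift_tetSol (σ : ι) : s.lift (T.tetSol σ) = s.result.tetSol (Sum.inl σ) := by
  have h0 : ∀ t k, (s.result.tetSol (Sum.inl σ)).1 (Sum.inr t) k = 0 := fun t k =>
    if_neg Sum.inr_ne_inl
  have hd : defect (s.result.tetSol (Sum.inl σ)).1 = 0 := by
    simp only [defect, h0, sub_self]
  have hr : (⟨restrict (s.result.tetSol (Sum.inl σ)).1, restrict_mem (s.result.tetSol _).2 hd⟩ : T.Q) =
      T.tetSol σ := Subtype.ext (restrict_tetSol (s := s) σ)
  have h := eq_lift_add (s.result.tetSol (Sum.inl σ)) hd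
  rw [hr] at h
  simpa [h0] using h.symm

variable (s) in
/-- The map induced by `lift`. -/
noncomputable def liftClass : T.Q ⧸ T.tetSubgroup →+ s.result.Q ⧸ s.result.tetSubgroup :=
  QuotientAddGroup.map T.tetSubgroup s.result.tetSubgroup s.lift <| by
    rw [tetSubgroup, AddSubgroup.closure_le]
    rintro _ ⟨σ, rfl⟩
    change s.lift (T.tetSol σ) ∈ s.result.tetSubgroup
    rw [lift_tetSol]
    exact AddSubgroup.subset_closure ⟨_, rfl⟩

theorem mk_eq_liftClass_add (S : s.result.Q) (hd : defect S.1 = 0) :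
    (QuotientAddGroup.mk S : s.result.Q ⧸ s.result.tetSubgroup) =
      s.liftClass (QuotientAddGroup.mk ⟨restrict S.1, restrict_mem S.2 hd⟩) +
        (S.1 (Sum.inr false) 0 - S.1 (Sum.inr false) 2) • s.newEdgeClass := by
  have ht : ∀ τ, (QuotientAddGroup.mk (s.result.tetSol τ) : s.result.Q ⧸ s.result.tetSubgroup) = 0 :=
    fun τ => (QuotientAddGroup.eq_zero_iff _).2 (AddSubgroup.subset_closure ⟨_, rfl⟩)
  conv_lhs => rw [eq_lift_add S hd]
  simp only [QuotientAddGroup.mk_add, QuotientAddGroup.mk_zsmul, ht, smul_zero, add_zero]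
  rfl

theorem restrict_mem_tetSubgroup {S : s.result.Q} (hS : S ∈ s.result.tetSubgroup) :
    ∃ R ∈ T.tetSubgroup, R.1 = restrict S.1 := by
  induction hS using AddSubgroup.closure_induction with
  | mem x hx =>
    obtain ⟨σ | t, rfl⟩ := hx
    · exact ⟨_, AddSubgroup.subset_closure ⟨σ, rfl⟩, (restrict_tetSol σ).symm⟩
    · refine ⟨0, zero_mem _, ?_⟩
      funext τ k
      simp [restrict, tetSol]
  | zero => exact ⟨0, zero_mem _, rfl⟩
  | add x y _ _ hx hy =>
    obtain ⟨R, hR, h⟩ := hx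
    obtain ⟨R', hR', h'⟩ := hy
    refine ⟨R + R', add_mem hR hR', ?_⟩
    rw [AddSubgroup.coe_add, h, h']
    rfl
  | neg x _ hx =>
    obtain ⟨R, hR, h⟩ := hx
    refine ⟨-R, neg_mem hR, ?_⟩
    rw [AddSubgroup.coe_neg, h]
    rfl

variable (s) in
/-- The lift of a class, normalized by a multiple of the edge solution of the new edge. -/
noncomputable def normalLift : T.Q ⧸ T.tetSubgroup → s.result.Q ⧸ s.result.tetSubgroup := fun x =>
  s.liftClass x + (-s.edgeCoord (s.liftClass x)) • s.newEdgeClass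

theorem edgeCoord_normalLift (x : T.Q ⧸ T.tetSubgroup) : s.edgeCoord (s.normalLift x) = 0 := by
  rw [normalLift, map_add, map_zsmul, edgeCoord_newEdgeClass, smul_eq_mul]
  ring

theorem exists_normalLift (R : T.Q) : ∃ (S : s.result.Q) (hd : defect S.1 = 0),
    s.normalLift (QuotientAddGroup.mk R) = QuotientAddGroup.mk S ∧
      (⟨restrict S.1, restrict_mem S.2 hd⟩ : T.Q) = R := by
  refine ⟨s.lift R + (-s.edgeCoord (s.liftClass (QuotientAddGroup.mk R))) • s.newEdge, ?_, rfl, ?_⟩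
  · generalize -s.edgeCoord (s.liftClass (QuotientAddGroup.mk R)) = n
    simp [defect, coe_lift, liftFun, newEdge, newEdgeSol]
  · generalize -s.edgeCoord (s.liftClass (QuotientAddGroup.mk R)) = n
    apply Subtype.ext
    funext τ k
    simp [restrict, coe_lift, liftFun, newEdge, newEdgeSol]

/-- A class of `T` is recovered from its lift by restriction, and tetrahedral solutions restrict to
tetrahedral solutions or to zero. -/
theorem normalLift_injective : Function.Injective s.normalLift := by
  intro x y hxy
  induction x using QuotientAddGroup.induction_on with | H R => ?_
  induction y using QuotientAddGroup.induction_on with | H R' => ?_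
  obtain ⟨S, hd, h1, rfl⟩ := exists_normalLift (s := s) R
  obtain ⟨S', hd', h1', rfl⟩ := exists_normalLift (s := s) R'
  rw [h1, h1', QuotientAddGroup.eq] at hxy
  obtain ⟨R, hR, h⟩ := restrict_mem_tetSubgroup hxy
  rw [QuotientAddGroup.eq]
  convert hR using 1
  apply Subtype.ext
  rw [h]
  rfl

theorem mk_mem_range_normalLift (S : s.result.Q) (hd : defect S.1 = 0)
    (h : s.edgeCoord (QuotientAddGroup.mk S) = 0) :
    s.normalLift (QuotientAddGroup.mk ⟨restrict S.1, restrict_mem S.2 hd⟩) =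
      QuotientAddGroup.mk S := by
  have h1 := mk_eq_liftClass_add S hd
  rw [← edgeCoord_mk, h, zero_smul, add_zero] at h1
  rw [normalLift, ← h1, h, neg_zero, zero_smul, add_zero]

theorem homologyMap_mk_eq_iff {a : T.RelHomology} {b : T.PeripheralHomology}
    {a' : s.result.RelHomology} {b' : s.result.PeripheralHomology} (ha : s.SameRel a a')
    (hb : s.SamePeripheral b b') (S : s.result.Q) (hd : defect S.1 = 0) :
    s.result.homologyMap (QuotientAddGroup.mk S) = (a', b') ↔
      T.homologyMap (QuotientAddGroup.mk ⟨restrict S.1, restrict_mem S.2 hd⟩) = (a, b) := by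
  rw [Prod.ext_iff, Prod.ext_iff]
  exact and_congr (surfaceClass_eq_iff ha S hd) (boundaryClass_eq_iff hb S hd)

/-- The new edge solution has defect zero and restricts to zero, so the comparison of homology
classes applies with zero classes. Its multiples therefore stay within one fibre of the homology
map. -/
theorem homologyMap_newEdgeClass : s.result.homologyMap s.newEdgeClass = 0 := by
  have ha : s.SameRel 0 0 := ⟨0, zero_mem _, by simp [zero_mem], rfl, by
    symm
    refine (QuotientAddGroup.eq_zero_iff _).2 ?_
    simp [AddSubgroup.mem_addSubgroupOf, zero_mem]⟩
  have hb : s.SamePeripheral 0 0 := ⟨0, zero_mem _, by simp, rfl, by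
    symm
    refine (Submodule.Quotient.mk_eq_zero _).2 ?_
    simp [Submodule.submoduleOf]⟩
  have hd : defect s.newEdge.1 = 0 := by simp [defect, newEdge, newEdgeSol]
  refine (homologyMap_mk_eq_iff ha hb s.newEdge hd).2 ?_
  have : (⟨restrict s.newEdge.1, restrict_mem s.newEdge.2 hd⟩ : T.Q) = 0 := rfl
  rw [this, QuotientAddGroup.mk_zero, map_zero]
  rfl

variable (s) in
/-- Each class after the move is uniquely a normalized class plus a multiple of the edge solution of
the new edge. -/
noncomputable def fibreEquiv (p : s.result.RelHomology × s.result.PeripheralHomology) :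
    {y // s.result.homologyMap y = p ∧ s.edgeCoord y = 0} × ℤ ≃
      {y // s.result.homologyMap y = p} where
  toFun z := ⟨z.1.1 + z.2 • s.newEdgeClass, by
    rw [map_add, map_zsmul, homologyMap_newEdgeClass, smul_zero, add_zero, z.1.2.1]⟩
  invFun y := ⟨⟨y.1 + (-s.edgeCoord y.1) • s.newEdgeClass, by
    rw [map_add, map_zsmul, homologyMap_newEdgeClass, smul_zero, add_zero, y.2], by
    rw [map_add, map_zsmul, edgeCoord_newEdgeClass, smul_eq_mul, mul_one, add_neg_cancel]⟩,
    s.edgeCoord y.1⟩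
  left_inv z := by
    have h : s.edgeCoord (z.1.1 + z.2 • s.newEdgeClass) = z.2 := by
      rw [map_add, map_zsmul, edgeCoord_newEdgeClass, smul_eq_mul, mul_one, z.1.2.2, zero_add]
    refine Prod.ext (Subtype.ext ?_) h
    dsimp only
    rw [h, neg_smul, add_neg_cancel_right]
  right_inv y := by
    apply Subtype.ext
    dsimp only
    rw [neg_smul, neg_add_cancel_right]

end ZeroTwoSite

end Triangulation

end Index3D

/-! ### Comparison of the two indices -/

theorem mainTheorem6 {ι : Type*} [Fintype ι] (T : Index3D.Triangulation ι) (hT : T.TorusCusps)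
    (s : T.ZeroTwoSite) (a : T.RelHomology) (b : T.PeripheralHomology)
    (a' : s.result.RelHomology) (b' : s.result.PeripheralHomology)
    (ha : s.SameRel a a') (hb : s.SamePeripheral b b') (I I' : LaurentSeries ℤ)
    (hI : T.HasIndex a b I) (hI' : s.result.HasIndex a' b' I') :
    I = I' := by
  open Index3D Index3D.Triangulation Index3D.Triangulation.ZeroTwoSite in
  obtain ⟨χ, hχ, -, rfl⟩ := hI
  obtain ⟨χ', hχ', hs, rfl⟩ := hI'
  -- The index after the move as a double sum, over normalized classes and over the multiples of the
  -- new edge solution.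
  let F : {y // s.result.homologyMap y = (a', b') ∧ s.edgeCoord y = 0} × ℤ → LaurentSeries ℤ :=
    fun z => weightClass hχ' (z.1.1 + z.2 • s.newEdgeClass)
  have hF : LaurentSummable F := (laurentSummable_comp_equiv
    (s.fibreEquiv (a', b'))).2 hs
  have h1 : laurentSum F = laurentSum
      fun y : {y // s.result.homologyMap y = (a', b')} => weightClass hχ' y.1 :=
    laurentSum_comp_equiv (fun y : {y // s.result.homologyMap y = (a', b')} =>
      weightClass hχ' y.1) (s.fibreEquiv (a', b'))
  have horbit : ∀ S : s.result.Q, laurentSum (fun n : ℤ => weightClass hχ'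
      (QuotientAddGroup.mk S + n • s.newEdgeClass)) =
      if hd : defect S.1 = 0 then weight χ ⟨restrict S.1, restrict_mem S.2 hd⟩ else 0 :=
    fun S => laurentSum_weight_newEdge hχ hχ' S
  have hmap : ∀ x, T.homologyMap x = (a, b) →
      s.result.homologyMap (s.normalLift x) = (a', b') := by
    intro x hx
    induction x using QuotientAddGroup.induction_on with | H R => ?_
    obtain ⟨S, hd, h2, rfl⟩ := exists_normalLift (s := s) R
    rw [h2]
    exact (homologyMap_mk_eq_iff ha hb S hd).2 hx
  let g : {x // T.homologyMap x = (a, b)} →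
      {y // s.result.homologyMap y = (a', b') ∧ s.edgeCoord y = 0} :=
    fun x => ⟨s.normalLift x.1, hmap x.1 x.2, edgeCoord_normalLift x.1⟩
  have hg : Function.Injective g := fun x y hxy =>
    Subtype.ext (normalLift_injective (congrArg Subtype.val hxy))
  have hval : (fun x : {x // T.homologyMap x = (a, b)} => weightClass hχ x.1) =
      (fun y => laurentSum fun n => F (y, n)) ∘ g := by
    funext ⟨x, hx⟩
    induction x using QuotientAddGroup.induction_on with | H R => ?_
    obtain ⟨S, hd, h2, h3⟩ := exists_normalLift (s := s) R
    change weight χ R = laurentSum fun n : ℤ => weightClass hχ'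
      (s.normalLift (QuotientAddGroup.mk R) + n • s.newEdgeClass)
    rw [h2, horbit, dif_pos hd, h3]
  -- A normalized class that is not a normalized lift has nonzero defect, and its inner sum
  -- vanishes.
  have hrange : ∀ y, y ∉ Set.range g → laurentSum (fun n => F (y, n)) = 0 := by
    rintro ⟨y, hy⟩ hn
    induction y using QuotientAddGroup.induction_on with | H S => ?_
    refine (horbit S).trans (dif_neg fun hd => hn ?_)
    exact ⟨⟨_, (homologyMap_mk_eq_iff ha hb S hd).1 hy.1⟩,
      Subtype.ext (mk_mem_range_normalLift S hd hy.2)⟩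
  -- The index of `T` is the sum of the inner sums over normalized lifts. The other normalized
  -- classes add zero, and the iterated sum is the double sum.
  rw [hval, laurentSum_comp_injective hg hF.fst hrange, hF.laurentSum_prod, h1]
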